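/- Let $\tau\in\mathbb H$, $\Lambda_\tau=\mathbb Z+\mathbb Z\tau$, $E_\tau=\mathbb C/\Lambda_\tau$, $(\omega_0,\omega_1,\omega_2,\omega_3)=(0,1,\tau,1+\tau)$, let $\wp,\zeta$ be the Weierstrass functions of $\Lambda_\tau$ and $e_k=\wp(\omega_k/2)$, $k=1,2,3$. Let $\mathbf n=(n_0,\dots,n_3)\in\mathbb Z_{\ge0}^4$, $A\in\mathbb C$, and $p\in\mathbb C$ with $p\notin\bigcup_k(\omega_k/2+\Lambda_\tau)$. Consider the generalized Lamé equation (GLE) $y''(z)=I(z)\,y(z)$, $$I(z)=\sum_{k=0}^3n_k(n_k+1)\wp(z+\tfrac{\omega_k}2)+\tfrac34\big(\wp(z+p)+\wp(z-p)\big)+A\big(\zeta(z+p)-\zeta(z-p)\big)+B,$$ $$B=A^2-\zeta(2p)A-\tfrac34\wp(2p)-\sum_{k=0}^3n_k(n_k+1)\wp(p+\tfrac{\omega_k}2).$$ Put $x=x(z)=\frac{\wp(z)-e_1}{e_2-e_1}$, $t=\frac{e_3-e_1}{e_2-e_1}$, $\lambda=x(p)$, $\mathfrak p(\lambda)=4\lambda(\lambda-1)(\lambda-t)$,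 $$\theta=(\theta_0,\dots,\theta_4)=\big(-\tfrac{1+\sum n_k}2,\,n_1+\tfrac12,\,n_2+\tfrac12,\,n_3+\tfrac12,\,n_0+\tfrac12\big),$$ $$\mu=\frac{\mathfrak p'(\lambda)}{8\,\mathfrak p(\lambda)}+\frac{A\wp'(p)}{(e_2-e_1)^2\mathfrak p(\lambda)}+\frac{n_1}{2\lambda}+\frac{n_2}{2(\lambda-1)}+\frac{n_3}{2(\lambda-t)},$$ $$K=\frac{\lambda(\lambda-1)(\lambda-t)\mu^2+\theta_0(\theta_0+\theta_4)(\lambda-t)-\big[\theta_1(\lambda-1)(\lambda-t)+\theta_2\lambda(\lambda-t)+(\theta_3-1)\lambda(\lambda-1)\big]\mu}{t(t-1)},$$ $$p_1(x)=\frac{1-\theta_3}{x-t}+\frac{1-\theta_1}x+\frac{1-\theta_2}{x-1}-\frac1{x-\lambda},\qquad p_2(x)=\frac{\theta_0(\theta_0+\theta_4)}{x(x-1)}-\frac{t(t-1)K}{x(x-1)(x-t)}+\frac{\lambda(\lambda-1)\mu}{x(x-1)(x-\lambda)}.$$ The normal-form Fuchsian equation on $\mathbb{CP}^1$ corresponding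 to GLE is $$F''+P_1F'+P_2F=0,\qquad P_1=p_1+2\frac{\phi'}{\phi},\quad P_2=p_2+\frac{\phi'}{\phi}p_1+\frac{\phi''}{\phi},\quad \phi=(x-\lambda)x^{\theta_1/2}(x-1)^{\theta_2/2}(x-t)^{\theta_3/2}.$$ Choice of loops. Products of paths are run through from left to right. Let $L$ be the straight segment from $-p$ to $p$. Let $q_0\in\mathbb C$, $x_0=x(q_0)$, and for $j=1,2$ let $\ell_j$ be a path in $\mathbb C\setminus(L+\Lambda_\tau)$ from $q_0$ to $q_0+\omega_j$ (the lift of a fundamental cycle of $E_\tau$). Let $\gamma_1,\gamma_2,\gamma_3$ be loops in $\mathbb C\setminus\{0,1,t,\lambda\}$ based at $x_0$ which in $\pi_1(\mathbb C\setminus\{0,1,t\},x_0)$ encircle, once and counterclockwise, only $0$, only $1$, only $t$ respectively (that is, each is homotopic to: a path to a point near the puncture, a small counterclockwise circle around it, the same path back). Suppose that $z\mapsto x(z)$ maps $(\ell_1,\ell_2)$ to $(\gamma_2^{-1}\gamma_3^{-1},\gamma_1\gamma_3)$ in $\pi_1(\mathbb C\setminus\{0,1,t\},x_0)$. (i) Such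 loops exist: if $p=c+d\tau$ with $c,d\in(-\frac12,\frac12)$, then for every $q_0\notin L+\Lambda_\tau$ in the interior of the parallelogram with vertices $0,-\frac{\omega_1}2,-\frac{\omega_2}2,-\frac{\omega_3}2$ there are $\ell_1,\ell_2,\gamma_1,\gamma_2,\gamma_3$ as above. (ii) For every choice of such loops, both equations have fundamental systems of solutions near $q_0$ and $x_0$ respectively. For any fundamental systems $(y_1,y_2)$ of GLE near $q_0$ and $(F_1,F_2)$ of the normal form near $x_0$, analytic continuation along these paths is possible and defines unique monodromy matrices $\rho(\ell_j)$, $M_j$, by $(y_1,y_2)^T(z+\omega_j)=\ell_j^*(y_1,y_2)^T=\rho(\ell_j)(y_1,y_2)^T$ and $\gamma_j^*(F_1,F_2)^T=M_j(F_1,F_2)^T$; they lie in $SL(2,\mathbb C)$, and with $\varkappa_1=\mathrm{tr}(M_2M_3)$, $\varkappa_2=\mathrm{tr}(M_1M_3)$, $\varkappa_3=\mathrm{tr}(M_1M_2)$, $$\mathrm{tr}\,\rho(\ell_1)=-\varkappa_1,\qquad \mathrm{tr}\,\rho(\ell_2)=-\varkappa_2,\qquad \mathrm{tr}\big(\rho(\ell_1)^{-1}\rho(\ell_2)\big)=-\varkappa_3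 .$$ -/

import Mathlib

open Filter Topology

noncomputable section

namespace GLame

/-! ### The torus and its elliptic functions -/

/-- The period pair `(ω₁, ω₂) = (1, τ)`; its lattice is `Λ_τ = ℤ + ℤτ`. -/
def periods (τ : UpperHalfPlane) : PeriodPair where
  ω₁ := 1
  ω₂ := (τ : ℂ)
  indep := by
    rw [LinearIndependent.pair_iff]
    intro s t h
    have him := congrArg Complex.im h
    have hre := congrArg Complex.re h
    simp at him hre
    have ht : t = 0 := him.resolve_right (ne_of_gt τ.im_pos)
    subst ht
    simpa using hre

/-- `ω₀ = 0, ω₁ = 1, ω₂ = τ, ω₃ = 1 + τ`. -/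
def omega (τ : UpperHalfPlane) : Fin 4 → ℂ := ![0, 1, (τ : ℂ), 1 + (τ : ℂ)]

/-- The preimage in `ℂ` of `E_τ[2]`: all points `ω_k / 2 + v` with `v ∈ Λ_τ`. -/
def twoTorsion (τ : UpperHalfPlane) : Set ℂ :=
  {z | ∃ k : Fin 4, z - omega τ k / 2 ∈ (periods τ).lattice}

/-- The Weierstrass function `℘(z | τ)`. -/
def wp (τ : UpperHalfPlane) (z : ℂ) : ℂ := (periods τ).weierstrassP z

/-- The derivative `℘'(z | τ)`. -/
def wpDeriv (τ : UpperHalfPlane) (z : ℂ) : ℂ := (periods τ).derivWeierstrassP z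

/-- The Weierstrass zeta function
`ζ(z | τ) = 1 / z + ∑_{v ∈ Λ_τ, v ≠ 0} (1 / (z - v) + 1 / v + z / v ^ 2)`. The term of the sum
below at `v = 0` is `1 / z`, because `1 / 0 = z / 0 = 0`. -/
def wzeta (τ : UpperHalfPlane) (z : ℂ) : ℂ :=
  ∑' v : (periods τ).lattice, (1 / (z - (v : ℂ)) + 1 / (v : ℂ) + z / (v : ℂ) ^ 2)

/-- `e_k = ℘(ω_k / 2)`, used for `k = 1, 2, 3`. -/
def e (τ : UpperHalfPlane) (k : Fin 4) : ℂ := wp τ (omega τ k / 2)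

/-! ### The generalized Lamé equation `y'' = I y` -/

/-- The constant `B` that makes `±p` apparent singularities. -/
def constB (τ : UpperHalfPlane) (n : Fin 4 → ℕ) (p A : ℂ) : ℂ :=
  A ^ 2 - wzeta τ (2 * p) * A - 3 / 4 * wp τ (2 * p)
    - ∑ k : Fin 4, (n k : ℂ) * ((n k : ℂ) + 1) * wp τ (p + omega τ k / 2)

/-- The potential `I_n(z; p, A, τ)` of the generalized Lamé equation. -/
def potential (τ : UpperHalfPlane) (n : Fin 4 → ℕ) (p A z : ℂ) : ℂ :=
  (∑ k : Fin 4, (n k : ℂ) * ((n k : ℂ) + 1) * wp τ (z + omega τ k / 2))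
    + 3 / 4 * (wp τ (z + p) + wp τ (z - p))
    + A * (wzeta τ (z + p) - wzeta τ (z - p))
    + constB τ n p A

/-! ### The Fuchsian equation on `ℂP¹` and its normal form -/

/-- `x = (℘(z) - e₁) / (e₂ - e₁)`. -/
def xMap (τ : UpperHalfPlane) (z : ℂ) : ℂ := (wp τ z - e τ 1) / (e τ 2 - e τ 1)

/-- `t = (e₃ - e₁) / (e₂ - e₁)`. -/
def tPoint (τ : UpperHalfPlane) : ℂ := (e τ 3 - e τ 1) / (e τ 2 - e τ 1)

/-- The parameters `θ = (-(1 + ∑ n_k) / 2, n₁ + 1/2, n₂ + 1/2, n₃ + 1/2, n₀ + 1/2)`. -/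
def theta (n : Fin 4 → ℕ) : Fin 5 → ℂ :=
  ![-(1 + ∑ k : Fin 4, (n k : ℂ)) / 2, (n 1 : ℂ) + 1 / 2, (n 2 : ℂ) + 1 / 2,
    (n 3 : ℂ) + 1 / 2, (n 0 : ℂ) + 1 / 2]

/-- The Hamiltonian `K(λ, μ, t)` of Painlevé VI with parameters `θ`. -/
def hamK (θ : Fin 5 → ℂ) (lam mu t : ℂ) : ℂ :=
  1 / (t * (t - 1)) *
    (lam * (lam - 1) * (lam - t) * mu ^ 2 + θ 0 * (θ 0 + θ 4) * (lam - t)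
      - (θ 1 * (lam - 1) * (lam - t) + θ 2 * lam * (lam - t)
          + (θ 3 - 1) * lam * (lam - 1)) * mu)

/-- First coefficient of `f'' + p₁ f' + p₂ f = 0`. -/
def coeffP1 (θ : Fin 5 → ℂ) (lam t x : ℂ) : ℂ :=
  (1 - θ 3) / (x - t) + (1 - θ 1) / x + (1 - θ 2) / (x - 1) - 1 / (x - lam)

/-- Second coefficient of `f'' + p₁ f' + p₂ f = 0`. -/
def coeffP2 (θ : Fin 5 → ℂ) (lam mu t x : ℂ) : ℂ :=
  θ 0 * (θ 0 + θ 4) / (x * (x - 1))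
    - t * (t - 1) * hamK θ lam mu t / (x * (x - 1) * (x - t))
    + lam * (lam - 1) * mu / (x * (x - 1) * (x - lam))

/-- `φ' / φ` for the gauge factor `φ = (x - λ) x^(θ₁/2) (x - 1)^(θ₂/2) (x - t)^(θ₃/2)`. -/
def gaugeLogDeriv (θ : Fin 5 → ℂ) (lam t x : ℂ) : ℂ :=
  1 / (x - lam) + θ 1 / 2 / x + θ 2 / 2 / (x - 1) + θ 3 / 2 / (x - t)

/-- `φ'' / φ = (φ' / φ)' + (φ' / φ) ^ 2` for the same `φ`. -/
def gaugeSecond (θ : Fin 5 → ℂ) (lam t x : ℂ) : ℂ :=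
  (-1 / (x - lam) ^ 2 - θ 1 / 2 / x ^ 2 - θ 2 / 2 / (x - 1) ^ 2 - θ 3 / 2 / (x - t) ^ 2)
    + gaugeLogDeriv θ lam t x ^ 2

/-- First coefficient of the normal form `F'' + P₁ F' + P₂ F = 0`, where `f = φ F`. -/
def normalP1 (θ : Fin 5 → ℂ) (lam t x : ℂ) : ℂ :=
  coeffP1 θ lam t x + 2 * gaugeLogDeriv θ lam t x

/-- Second coefficient of the normal form `F'' + P₁ F' + P₂ F = 0`, where `f = φ F`. -/
def normalP2 (θ : Fin 5 → ℂ) (lam mu t x : ℂ) : ℂ :=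
  coeffP2 θ lam mu t x + gaugeLogDeriv θ lam t x * coeffP1 θ lam t x + gaugeSecond θ lam t x

/-- `λ = (℘(p) - e₁) / (e₂ - e₁)`. -/
def lamPoint (τ : UpperHalfPlane) (p : ℂ) : ℂ := xMap τ p

/-- The value of `μ` that corresponds to the generalized Lamé equation:
`μ = 𝔭'(λ) / (8 𝔭(λ)) + A ℘'(p) / ((e₂ - e₁)² 𝔭(λ)) + n₁/(2λ) + n₂/(2(λ-1)) + n₃/(2(λ-t))`
with `𝔭(λ) = 4 λ (λ - 1) (λ - t)`. -/
def muPoint (τ : UpperHalfPlane) (n : Fin 4 → ℕ) (p A : ℂ) : ℂ :=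
  let l := lamPoint τ p
  let t := tPoint τ
  let P := 4 * l * (l - 1) * (l - t)
  let dP := 4 * ((l - 1) * (l - t) + l * (l - t) + l * (l - 1))
  1 / 8 * (dP / P) + A * wpDeriv τ p / ((e τ 2 - e τ 1) ^ 2 * P)
    + (n 1 : ℂ) / (2 * l) + (n 2 : ℂ) / (2 * (l - 1)) + (n 3 : ℂ) / (2 * (l - t))

/-! ### Analytic continuation and monodromy matrices -/

/-- `(Y 0, Y 1)` is a fundamental system of germs at `a` of analytic solutions of
`y'' + P y' + Q y = 0`. -/
structure IsFundamentalSystem (P Q : ℂ → ℂ) (a : ℂ) (Y : Fin 2 → ℂ → ℂ) : Prop where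
  analytic : ∀ i, AnalyticAt ℂ (Y i) a
  solves : ∀ i, ∀ᶠ z in 𝓝 a, deriv (deriv (Y i)) z + P z * deriv (Y i) z + Q z * Y i z = 0
  independent : ∀ c : Fin 2 → ℂ, (∀ᶠ z in 𝓝 a, ∑ i, c i * Y i z = 0) → c = 0

/-- `f` is an analytic continuation along the path `γ`: `f s` is a germ of an analytic function
at `γ s`, and for `s'` close to `s` the germ at `γ s'` is the one given by `f s`. -/
structure IsContinuationAlong {a b : ℂ} (γ : Path a b) (f : unitInterval → ℂ → ℂ) : Prop where
  analytic : ∀ s, AnalyticAt ℂ (f s) (γ s)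
  compatible : ∀ s, ∀ᶠ s' in 𝓝 s, f s' =ᶠ[𝓝 (γ s')] f s

/-- `N` is the monodromy matrix of `(Y 0, Y 1)` along `γ : a ⇝ b`: the pair can be continued
analytically along `γ`, and the continued pair satisfies `γ^* (Y 0, Y 1)ᵀ = N (Y 0, Y 1)ᵀ`, where
`z` near `a` and `z + (b - a)` near `b` are identified. For a loop, `b - a = 0`; for the lift
to `ℂ` of a cycle of the torus, `b - a` is a period. -/
def IsMonodromyMatrix {a b : ℂ} (γ : Path a b) (Y : Fin 2 → ℂ → ℂ)
    (N : Matrix (Fin 2) (Fin 2) ℂ) : Prop :=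
  ∃ f : Fin 2 → unitInterval → ℂ → ℂ, ∀ i,
    IsContinuationAlong γ (f i) ∧ f i 0 =ᶠ[𝓝 a] Y i ∧
      ∀ᶠ z in 𝓝 a, f i 1 (z + (b - a)) = ∑ j, N i j * Y j z

/-! ### Loops -/

/-- Homotopy with fixed end points inside the set `S`. -/
def HomotopicIn (S : Set ℂ) {a b : ℂ} (γ γ' : Path a b) : Prop :=
  ∃ H : γ.Homotopy γ', ∀ u, H u ∈ S

/-- The circle of centre `a` and radius `r`, once counterclockwise, from `a + r`. -/
def circlePath (a : ℂ) (r : ℝ) : Path (a + r) (a + r) where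
  toFun s := a + r * Complex.exp (2 * Real.pi * Complex.I * ((s : ℝ) : ℂ))
  continuous_toFun := by fun_prop
  source' := by simp
  target' := by simp [Complex.exp_two_pi_mul_I]

/-- The class in `π₁(S, x₀)` of the loop `γ` is that of a loop that encircles the puncture `a`
of `S` once counterclockwise, and no other puncture: go along a path `δ` to a point close to `a`,
once counterclockwise around a small circle of centre `a`, and back along `δ`. -/
def EncirclesOnce (S : Set ℂ) (a : ℂ) {x₀ : ℂ} (γ : Path x₀ x₀) : Prop :=
  ∃ (r : ℝ) (δ : Path x₀ (a + r)), 0 < r ∧ Metric.closedBall a r \ {a} ⊆ S ∧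
    HomotopicIn S γ ((δ.trans (circlePath a r)).trans δ.symm)

/-- `L + Λ_τ`, where `L` is the straight segment from `-p` to `p`. -/
def cuts (τ : UpperHalfPlane) (p : ℂ) : Set ℂ :=
  {z | ∃ v ∈ (periods τ).lattice, z - v ∈ segment ℝ (-p) p}

/-- `ℂ \ {0, 1, t}`. -/
def punctured (t : ℂ) : Set ℂ := {x | x ≠ 0 ∧ x ≠ 1 ∧ x ≠ t}

/-- The interior of the parallelogram with vertices `0, -ω₁/2, -ω₂/2, -ω₃/2`. -/
def baseCell (τ : UpperHalfPlane) : Set ℂ :=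
  {z | ∃ a b : ℝ, 0 < a ∧ a < 1 / 2 ∧ 0 < b ∧ b < 1 / 2 ∧ z = -((a : ℂ) + b * (τ : ℂ))}

/-- The choice of loops. `ℓ₁, ℓ₂` are the lifts to `ℂ` of the fundamental cycles of `E_τ`, they
avoid `L + Λ_τ`; the loops `γ₁, γ₂, γ₃` encircle `0`, `1`, `t` respectively (and are represented
by loops that do not pass through the apparent singularity `λ`); and the map `z ↦ x` sends
`(ℓ₁, ℓ₂)` to `(γ₂⁻¹ γ₃⁻¹, γ₁ γ₃)` in `π₁(ℂ \ {0, 1, t}, x₀)`. A product of loops is run through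
from left to right. -/
structure IsLoopChoice (τ : UpperHalfPlane) (p : ℂ) {q₀ : ℂ}
    (ℓ₁ : Path q₀ (q₀ + 1)) (ℓ₂ : Path q₀ (q₀ + (τ : ℂ)))
    (γ₁ γ₂ γ₃ : Path (xMap τ q₀) (xMap τ q₀)) : Prop where
  avoid₁ : ∀ s, ℓ₁ s ∉ cuts τ p
  avoid₂ : ∀ s, ℓ₂ s ∉ cuts τ p
  encircles₁ : EncirclesOnce (punctured (tPoint τ)) 0 γ₁
  encircles₂ : EncirclesOnce (punctured (tPoint τ)) 1 γ₂
  encircles₃ : EncirclesOnce (punctured (tPoint τ)) (tPoint τ) γ₃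
  avoid_lam : ∀ s, γ₁ s ≠ lamPoint τ p ∧ γ₂ s ≠ lamPoint τ p ∧ γ₃ s ≠ lamPoint τ p
  image₁ : ∃ β : Path (xMap τ q₀) (xMap τ q₀), (∀ s, β s = xMap τ (ℓ₁ s)) ∧
    HomotopicIn (punctured (tPoint τ)) β (γ₂.symm.trans γ₃.symm)
  image₂ : ∃ β : Path (xMap τ q₀) (xMap τ q₀), (∀ s, β s = xMap τ (ℓ₂ s)) ∧
    HomotopicIn (punctured (tPoint τ)) β (γ₁.trans γ₃)

end GLame

end

/-! Both equations are one equation seen from two sides. Put `x = x(z)` and `y(z) = Ψ(x) F(x)` with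
`Ψ = (x (x - 1) (x - t))^(1/4) (x - λ)^(1/2)`. Since `x'² = 4 (e₂ - e₁) x (x - 1) (x - t)`, this
turns solutions `F` of the normal form into solutions `y` of the generalized Lamé equation
(`potential_solution`). The addition and duplication formulas for `℘` and `ζ` make the potential a
rational function of `x`, and the comparison becomes an identity of rational functions
(`potential_eq`). Continuing `y` along `ℓ_j` therefore means continuing `F` and `Ψ` along the image
loop `x ∘ ℓ_j`.

The factor `F`: the point `λ` is an apparent singularity. The trace free system `sysMatrix`, whose
solutions have first components `(x - λ) F`, is holomorphic on `ℂ \ {0, 1, t}`, including `λ`. So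
its transport depends only on the class in `π₁(ℂ \ {0, 1, t})` and has determinant one. At `0`, `1`,
`t` its residue has eigenvalues `± θ_j / 2`, so the local monodromy has trace `2 cos(π θ_j) = 0`,
because `θ_j` is half an odd integer (`trace_eq_zero_of_encircles`). By Cayley-Hamilton, `M_j² =
-1`.

The factor `Ψ`: the fourth root is multiplied by `i` around each of `0`, `1`, `t`
(`quarter_transport`), hence by `-1` along `x ∘ ℓ₁` and along `x ∘ ℓ₂`. The square root of `x - λ`
returns to itself: because `ℓ_j` avoids the cuts, `λ = x(p)` may be moved along `x(s p)` to infinity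
without meeting the image loop (`half_transport`).

Up to a common conjugation this gives `ρ(ℓ₁) = -M₂⁻¹ M₃⁻¹ = -M₂ M₃` and `ρ(ℓ₂) = -M₁ M₃`. Then
`ρ(ℓ₁)⁻¹ ρ(ℓ₂)` is conjugate to `M₂⁻¹ M₁ = -M₂ M₁`, and the three trace formulas follow
(`monodromy_of_loopChoice`).

Existence of the loops (`exists_loopChoice`): at a half period `x` is two-to-one, so a half turn
about it is mapped to a full turn about its image (`encirclesOnce_image`). Three such half turns,
built from four segments that end at one auxiliary vertex, give `γ₁, γ₂, γ₃`, and the required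
relations hold by cancellation.

Transport rests on power series solutions in a Banach algebra, glued over subdivisions of the unit
square. The local traces are computed by shrinking a circle and applying Gronwall's inequality. -/

open Filter Topology

noncomputable section

namespace GLame

/-! ### Linear differential equations in a Banach algebra -/

section ODE

variable {𝔸 : Type*} [NormedRing 𝔸] [NormedAlgebra ℂ 𝔸]

/-- `W` solves `W' = A W` near `c`. -/
def IsLocalSol (A W : ℂ → 𝔸) (c : ℂ) : Prop := ∀ᶠ x in 𝓝 c, HasDerivAt W (A x * W x) x

/-- Coefficients of the power series solution of `W' = A W`, `W c = 1`, where `a` are the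
coefficients of `A`. -/
def solCoeff (a : ℕ → 𝔸) : ℕ → 𝔸
  | 0 => 1
  | n + 1 => ((n : ℂ) + 1)⁻¹ • ∑ k : Fin (n + 1), a k * solCoeff a (n - k)

lemma solCoeff_succ (a : ℕ → 𝔸) (n : ℕ) :
    ((n : ℂ) + 1) • solCoeff a (n + 1) = ∑ k ∈ Finset.range (n + 1), a k * solCoeff a (n - k) := by
  rw [solCoeff, smul_smul, mul_inv_cancel₀ (Nat.cast_add_one_ne_zero n), one_smul,
    Fin.sum_univ_eq_sum_range (fun k => a k * solCoeff a (n - k)) (n + 1)]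

/-- The factor `1 / (n + 1)` of the recursion cancels the number of summands, each of which is at
most `M * (‖1‖ * (M + q) ^ n)`. -/
lemma norm_solCoeff_le {a : ℕ → 𝔸} {M q : ℝ} (hM : 0 ≤ M) (hq : 0 ≤ q)
    (ha : ∀ k, ‖a k‖ ≤ M * q ^ k) (n : ℕ) : ‖solCoeff a n‖ ≤ ‖(1 : 𝔸)‖ * (M + q) ^ n := by
  induction n using Nat.strong_induction_on with
  | _ n ih =>
    cases n with
    | zero => simp [solCoeff]
    | succ n =>
      rw [solCoeff, norm_smul, Fin.sum_univ_eq_sum_range (fun k => a k * solCoeff a (n - k)) (n + 1)]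
      have h1 : ‖∑ k ∈ Finset.range (n + 1), a k * solCoeff a (n - k)‖
          ≤ ∑ k ∈ Finset.range (n + 1), M * (‖(1 : 𝔸)‖ * (M + q) ^ n) := by
        refine (norm_sum_le _ _).trans (Finset.sum_le_sum fun k hk => ?_)
        have hk' : k ≤ n := Nat.lt_succ_iff.mp (Finset.mem_range.mp hk)
        calc ‖a k * solCoeff a (n - k)‖ ≤ ‖a k‖ * ‖solCoeff a (n - k)‖ := norm_mul_le _ _
          _ ≤ (M * (M + q) ^ k) * (‖(1 : 𝔸)‖ * (M + q) ^ (n - k)) := by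
              gcongr
              · refine (ha k).trans ?_
                gcongr
                linarith
              · exact ih _ (by omega)
          _ = M * (‖(1 : 𝔸)‖ * (M + q) ^ n) := by
              rw [← Nat.sub_add_cancel hk', pow_add, Nat.add_sub_cancel]; ring
      have h2 : ‖((n : ℂ) + 1)⁻¹‖ = ((n : ℝ) + 1)⁻¹ := by
        rw [norm_inv]; congr 1
        exact_mod_cast Complex.norm_natCast (n + 1)
      rw [h2]
      rw [Finset.sum_const, Finset.card_range, nsmul_eq_mul] at h1
      calc ((n : ℝ) + 1)⁻¹ * _ ≤ ((n : ℝ) + 1)⁻¹ * _ := mul_le_mul_of_nonneg_left h1 (by positivity)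
        _ = M * (‖(1 : 𝔸)‖ * (M + q) ^ n) := by
            rw [Nat.cast_succ, inv_mul_cancel_left₀ (Nat.cast_add_one_ne_zero n)]
        _ ≤ (M + q) * (‖(1 : 𝔸)‖ * (M + q) ^ n) := by gcongr; linarith
        _ = _ := by ring

theorem exists_isLocalSol [CompleteSpace 𝔸] {A : ℂ → 𝔸} {c : ℂ} (hA : AnalyticAt ℂ A c) :
    ∃ W : ℂ → 𝔸, IsLocalSol A W c ∧ W c = 1 := by
  obtain ⟨p, r, hp⟩ := hA
  obtain ⟨ρ, hρ0, hρ⟩ : ∃ ρ : NNReal, 0 < ρ ∧ (ρ : ENNReal) < r :=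
    ENNReal.lt_iff_exists_nnreal_btwn.mp hp.r_pos |>.imp fun x hx => ⟨by exact_mod_cast hx.1, hx.2⟩
  obtain ⟨M, hM0, hM⟩ := p.norm_mul_pow_le_of_lt_radius (lt_of_lt_of_le hρ hp.r_le)
  have hρ' : (0 : ℝ) < ρ := hρ0
  set a : ℕ → 𝔸 := fun n => p.coeff n
  set q : ℝ := (ρ : ℝ)⁻¹
  have hq : 0 < q := inv_pos.mpr hρ'
  have ha : ∀ k, ‖a k‖ ≤ M * q ^ k := by
    intro k
    have h1 : ‖a k‖ = ‖p k‖ := p.norm_apply_eq_norm_coef.symm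
    rw [h1, inv_pow, ← div_eq_mul_inv, le_div_iff₀ (by positivity)]
    exact hM k
  set b := solCoeff a
  set K := M + q
  have hK : 0 < K := by positivity
  have hb : ∀ n, ‖b n‖ ≤ ‖(1 : 𝔸)‖ * K ^ n := norm_solCoeff_le hM0.le hq.le ha
  -- With this radius `R * K = 1 / 2` and `R * q ≤ 1 / 2`, so the series of the solution, of the
  -- coefficient and of the derivative are all dominated by series of ratio `1 / 2`.
  set R : ℝ := (2 * K)⁻¹
  have hR : 0 < R := by positivity
  have hRK : R * K = 1 / 2 := by simp only [R]; field_simp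
  have hRρ : R * q ≤ 1 / 2 := by
    rw [← hRK]; gcongr; simp only [K]; linarith
  have hnb : ∀ (x : ℂ), x ∈ Metric.ball c R → ∀ n, ‖(x - c) ^ n • b n‖ ≤ ‖(1 : 𝔸)‖ * (1 / 2) ^ n := by
    intro x hx n
    rw [norm_smul, norm_pow]
    rw [mem_ball_iff_norm] at hx
    calc ‖x - c‖ ^ n * ‖b n‖ ≤ R ^ n * (‖(1 : 𝔸)‖ * K ^ n) := by
          gcongr
          exact hb n
      _ = _ := by rw [← hRK, mul_pow]; ring
  have hsum : ∀ x ∈ Metric.ball c R, Summable fun n => ‖(x - c) ^ n • b n‖ := fun x hx =>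
    Summable.of_nonneg_of_le (fun _ => norm_nonneg _) (hnb x hx)
      ((summable_geometric_of_lt_one (by norm_num) (by norm_num)).mul_left _)
  have hna : ∀ (x : ℂ), x ∈ Metric.ball c R → ∀ n, ‖(x - c) ^ n • a n‖ ≤ M * (1 / 2) ^ n := by
    intro x hx n
    rw [norm_smul, norm_pow]
    rw [mem_ball_iff_norm] at hx
    calc ‖x - c‖ ^ n * ‖a n‖ ≤ R ^ n * (M * q ^ n) := by
          gcongr
          exact ha n
      _ = M * (R * q) ^ n := by rw [mul_pow]; ring
      _ ≤ _ := by gcongr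
  have hsuma : ∀ x ∈ Metric.ball c R, Summable fun n => ‖(x - c) ^ n • a n‖ := fun x hx =>
    Summable.of_nonneg_of_le (fun _ => norm_nonneg _) (hna x hx)
      ((summable_geometric_of_lt_one (by norm_num) (by norm_num)).mul_left _)
  have hnd : ∀ (x : ℂ), x ∈ Metric.ball c R → ∀ n : ℕ, ‖((n : ℂ) * (x - c) ^ (n - 1)) • b n‖
      ≤ (n : ℝ) * (2 * K * ‖(1 : 𝔸)‖ * (1 / 2) ^ n) := by
    intro x hx n
    rw [mem_ball_iff_norm] at hx
    cases n with
    | zero => simp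
    | succ n =>
      rw [norm_smul, norm_mul, Complex.norm_natCast, norm_pow, Nat.add_sub_cancel, mul_assoc]
      refine mul_le_mul_of_nonneg_left ?_ (Nat.cast_nonneg _)
      calc ‖x - c‖ ^ n * ‖b (n + 1)‖ ≤ R ^ n * (‖(1 : 𝔸)‖ * K ^ (n + 1)) := by
            gcongr; exact hb _
        _ = K * ‖(1 : 𝔸)‖ * (R * K) ^ n := by rw [mul_pow, pow_succ]; ring
        _ = _ := by rw [hRK]; ring
  have hsd : Summable fun n : ℕ => (n : ℝ) * (2 * K * ‖(1 : 𝔸)‖ * (1 / 2) ^ n) := by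
    refine ((summable_pow_mul_geometric_of_norm_lt_one (R := ℝ) 1 (r := 1 / 2)
      (by norm_num)).mul_left (2 * K * ‖(1 : 𝔸)‖)).congr fun n => ?_
    ring
  refine ⟨fun x => ∑' n, (x - c) ^ n • b n, ?_, ?_⟩
  · filter_upwards [Metric.ball_mem_nhds c hR] with x hx
    have hAx : A x = ∑' n, (x - c) ^ n • a n := by
      have hxr : x - c ∈ Metric.eball (0 : ℂ) r := by
        refine Metric.eball_subset_eball hρ.le ?_
        rw [Metric.eball_coe]
        rw [mem_ball_iff_norm] at hx
        rw [mem_ball_zero_iff]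
        refine hx.trans_le ?_
        have : R * q ≤ 1 := by linarith
        calc R = R * q * ρ := by simp only [q]; field_simp
          _ ≤ 1 * ρ := by gcongr
          _ = ρ := one_mul _
      have := (hp.hasSum hxr).tsum_eq
      rw [add_sub_cancel] at this
      rw [← this]
      refine tsum_congr fun n => ?_
      rw [FormalMultilinearSeries.apply_eq_pow_smul_coeff]
    have hder : HasDerivAt (fun x => ∑' n, (x - c) ^ n • b n)
        (∑' n : ℕ, ((n : ℂ) * (x - c) ^ (n - 1)) • b n) x := by
      refine hasDerivAt_tsum_of_isPreconnected (t := Metric.ball c R) (y₀ := c)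
        (u := fun n : ℕ => (n : ℝ) * (2 * K * ‖(1 : 𝔸)‖ * (1 / 2) ^ n))
        (g := fun n x => (x - c) ^ n • b n)
        (g' := fun n x => ((n : ℂ) * (x - c) ^ (n - 1)) • b n)
        ?_ Metric.isOpen_ball (convex_ball c R).isPreconnected ?_ ?_ (Metric.mem_ball_self hR) ?_ hx
      · exact hsd
      · intro n y _
        have h1 : HasDerivAt (fun y : ℂ => (y - c) ^ n) ((n : ℂ) * (y - c) ^ (n - 1)) y := by
          simpa using ((hasDerivAt_id y).sub_const c).fun_pow n
        exact h1.smul_const (b n)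
      · intro n y hy
        exact hnd y hy n
      · exact (hsum c (Metric.mem_ball_self hR)).of_norm
    have hs' : Summable fun n : ℕ => ((n : ℂ) * (x - c) ^ (n - 1)) • b n := by
      refine Summable.of_norm_bounded (g := fun n : ℕ => (n : ℝ) * (2 * K * ‖(1 : 𝔸)‖ * (1 / 2) ^ n)) ?_ ?_
      · exact hsd
      · intro n
        exact hnd x hx n
    convert hder using 1
    -- The Cauchy product of the two series agrees with the termwise derivative coefficient by
    -- coefficient: this is the recursion.
    rw [hAx, tsum_mul_tsum_eq_tsum_sum_range_of_summable_norm (hsuma x hx) (hsum x hx),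
      hs'.tsum_eq_zero_add]
    simp only [Nat.cast_zero, zero_mul, zero_smul, zero_add, Nat.add_sub_cancel]
    refine tsum_congr fun n => ?_
    rw [mul_comm, mul_smul, Nat.cast_add, Nat.cast_one, solCoeff_succ, Finset.smul_sum]
    refine Finset.sum_congr rfl fun k hk => ?_
    have hk' : k ≤ n := Nat.lt_succ_iff.mp (Finset.mem_range.mp hk)
    rw [smul_mul_smul_comm, ← pow_add, Nat.add_sub_cancel' hk']
  · beta_reduce
    rw [tsum_eq_single 0]
    · simp [b, solCoeff]
    · intro n hn
      simp [hn]

end ODE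

/-! ### Horizontal sections along a map, and their existence over a square -/

section Sections

variable {𝔸 : Type*} [NormedRing 𝔸] [NormedAlgebra ℂ 𝔸]

lemma IsLocalSol.mul_const {A W : ℂ → 𝔸} {c : ℂ} (h : IsLocalSol A W c) (C : 𝔸) :
    IsLocalSol A (fun x => W x * C) c := by
  filter_upwards [h] with x hx
  simpa [mul_assoc] using hx.mul_const C

lemma IsLocalSol.eventually {A W : ℂ → 𝔸} {c : ℂ} (h : IsLocalSol A W c) :
    ∀ᶠ x in 𝓝 c, IsLocalSol A W x := eventually_eventually_nhds.mpr h

lemma IsLocalSol.continuousAt {A W : ℂ → 𝔸} {c : ℂ} (h : IsLocalSol A W c) : ContinuousAt W c :=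
  h.self_of_nhds.continuousAt

/-- Near every point there is an invertible solution, and every solution is a constant multiple. -/
lemma exists_fundamental [CompleteSpace 𝔸] {A : ℂ → 𝔸} {c : ℂ} (hA : AnalyticAt ℂ A c) :
    ∃ (r : ℝ) (Φ : ℂ → 𝔸), 0 < r ∧
      (∀ x ∈ Metric.ball c r, HasDerivAt Φ (A x * Φ x) x ∧ IsUnit (Φ x)) := by
  obtain ⟨Φ, hΦ, h1⟩ := exists_isLocalSol hA
  have hu : ∀ᶠ x in 𝓝 c, IsUnit (Φ x) := by
    refine hΦ.continuousAt.eventually (p := IsUnit) ?_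
    rw [h1]
    exact Units.isOpen.mem_nhds isUnit_one
  obtain ⟨r, hr, h⟩ := Metric.eventually_nhds_iff_ball.mp (hΦ.and hu)
  exact ⟨r, Φ, hr, h⟩

/-- Variation of constants: the two terms of `(Φ⁻¹ W)' = -Φ⁻¹ (A Φ) Φ⁻¹ W + Φ⁻¹ A W` cancel. Every
solution is thus an invertible one times a constant on the right. -/
lemma hasDerivAt_inverse_mul [CompleteSpace 𝔸] {A Φ W : ℂ → 𝔸} {x : ℂ}
    (hΦ : HasDerivAt Φ (A x * Φ x) x) (hu : IsUnit (Φ x)) (hW : HasDerivAt W (A x * W x) x) :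
    HasDerivAt (fun x => Ring.inverse (Φ x) * W x) 0 x := by
  obtain ⟨u, hu⟩ := hu
  have h1 : HasDerivAt (fun x => Ring.inverse (Φ x)) (-(↑u⁻¹ * (A x * Φ x) * ↑u⁻¹)) x := by
    have := (hasFDerivAt_ringInverse (𝕜 := ℂ) u)
    rw [hu] at this
    simpa [Function.comp_def] using this.comp_hasDerivAt x hΦ
  convert h1.fun_mul hW using 1
  rw [← hu, Ring.inverse_unit]
  simp [mul_assoc]

lemma IsLocalSol.eventuallyEq [CompleteSpace 𝔸] {A W₁ W₂ : ℂ → 𝔸} {c : ℂ} (hA : AnalyticAt ℂ A c)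
    (h₁ : IsLocalSol A W₁ c) (h₂ : IsLocalSol A W₂ c) (h : W₁ c = W₂ c) : W₁ =ᶠ[𝓝 c] W₂ := by
  obtain ⟨r, Φ, hr, hΦ⟩ := exists_fundamental hA
  obtain ⟨r', hr', hW⟩ := Metric.eventually_nhds_iff_ball.mp (h₁.and h₂)
  have hρ : 0 < min r r' := lt_min hr hr'
  have key : ∀ W : ℂ → 𝔸, (∀ x ∈ Metric.ball c r', HasDerivAt W (A x * W x) x) →
      ∀ x ∈ Metric.ball c (min r r'), W x = Φ x * (Ring.inverse (Φ c) * W c) := by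
    intro W hW x hx
    have hconst := (convex_ball c (min r r')).is_const_of_fderivWithin_eq_zero (𝕜 := ℂ)
      (f := fun x => Ring.inverse (Φ x) * W x) ?_ ?_ hx (Metric.mem_ball_self hρ)
    · rw [← hconst, ← mul_assoc, Ring.mul_inverse_cancel _ (hΦ x (Metric.ball_subset_ball
        (min_le_left _ _) hx)).2, one_mul]
    · intro y hy
      have h1 := hΦ y (Metric.ball_subset_ball (min_le_left _ _) hy)
      have h2 := hW y (Metric.ball_subset_ball (min_le_right _ _) hy)
      exact (hasDerivAt_inverse_mul h1.1 h1.2 h2).differentiableAt.differentiableWithinAt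
    · intro y hy
      have h1 := hΦ y (Metric.ball_subset_ball (min_le_left _ _) hy)
      have h2 := hW y (Metric.ball_subset_ball (min_le_right _ _) hy)
      rw [fderivWithin_of_isOpen Metric.isOpen_ball hy,
        (hasDerivAt_inverse_mul h1.1 h1.2 h2).hasFDerivAt.fderiv]
      ext; simp
  filter_upwards [Metric.ball_mem_nhds c hρ] with x hx
  rw [key W₁ (fun x hx => (hW x hx).1) x hx, key W₂ (fun x hx => (hW x hx).2) x hx, h]

/-- `w` is a horizontal section over `R` along `h`: locally it is `W ∘ h` for a solution `W` of
`W' = A W`. -/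
def IsSection (A : ℂ → 𝔸) {X : Type*} [TopologicalSpace X] (h : X → ℂ) (R : Set X) (w : X → 𝔸) :
    Prop :=
  ∀ q ∈ R, ∃ W : ℂ → 𝔸, IsLocalSol A W (h q) ∧ ∀ᶠ q' in 𝓝[R] q, w q' = W (h q')

variable {X Y : Type*} [TopologicalSpace X] [TopologicalSpace Y] {A : ℂ → 𝔸} {h : X → ℂ}

lemma IsSection.mono {R R' : Set X} {w : X → 𝔸} (hw : IsSection A h R w) (hR : R' ⊆ R) :
    IsSection A h R' w := fun q hq =>
  let ⟨W, h1, h2⟩ := hw q (hR hq)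
  ⟨W, h1, h2.filter_mono (nhdsWithin_mono q hR)⟩

lemma IsSection.mul_const {R : Set X} {w : X → 𝔸} (hw : IsSection A h R w) (C : 𝔸) :
    IsSection A h R (fun q => w q * C) := fun q hq =>
  let ⟨W, h1, h2⟩ := hw q hq
  ⟨_, h1.mul_const C, by filter_upwards [h2] with x hx; rw [hx]⟩

lemma IsSection.comp {R : Set X} {w : X → 𝔸} (hw : IsSection A h R w) {φ : Y → X} {R' : Set Y}
    (hφ : ContinuousOn φ R') (hR : Set.MapsTo φ R' R) :
    IsSection A (fun y => h (φ y)) R' (fun y => w (φ y)) := fun y hy =>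
  let ⟨W, h1, h2⟩ := hw (φ y) (hR hy)
  ⟨W, h1, ((hφ y hy).tendsto_nhdsWithin hR).eventually h2⟩

lemma IsSection.congr_map {R : Set X} {w : X → 𝔸} {h' : X → ℂ} (hw : IsSection A h R w)
    (hh : Set.EqOn h h' R) : IsSection A h' R w := fun q hq =>
  let ⟨W, h1, h2⟩ := hw q hq
  ⟨W, hh hq ▸ h1, by filter_upwards [h2, self_mem_nhdsWithin] with x hx hx'; rw [← hh hx', hx]⟩

lemma isSection_const (hA : ∀ q, AnalyticAt ℂ A (h q)) [CompleteSpace 𝔸] (hh : ∀ q q', h q = h q')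
    (C : 𝔸) (R : Set X) : IsSection A h R (fun _ => C) := fun q _ =>
  let ⟨W, h1, h2⟩ := exists_isLocalSol (hA q)
  ⟨_, h1.mul_const C, Eventually.of_forall fun q' => by simp [hh q' q, h2]⟩

variable [CompleteSpace 𝔸]

/-- Near `q` both sections are `Φ ∘ h` times a constant, with `Φ` invertible. Hence agreement at one
point near `q` forces agreement at all of them, and the set of agreement and its complement are both
relatively open. -/
lemma IsSection.eqOn {R : Set X} {w₁ w₂ : X → 𝔸} (hA : ∀ q ∈ R, AnalyticAt ℂ A (h q))
    (hh : ContinuousOn h R) (hR : IsPreconnected R) (h₁ : IsSection A h R w₁)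
    (h₂ : IsSection A h R w₂) {q₀ : X} (hq₀ : q₀ ∈ R) (he : w₁ q₀ = w₂ q₀) : Set.EqOn w₁ w₂ R := by
  -- near every point, agreement is decided by a single value
  have key : ∀ q ∈ R, ∃ U ∈ 𝓝[R] q, ∀ a ∈ U, ∀ b ∈ U, w₁ a = w₂ a → w₁ b = w₂ b := by
    intro q hq
    obtain ⟨W₁, hW₁, hw₁⟩ := h₁ q hq
    obtain ⟨W₂, hW₂, hw₂⟩ := h₂ q hq
    obtain ⟨r, Φ, hr, hΦ⟩ := exists_fundamental (hA q hq)
    have hΦ' : IsLocalSol A Φ (h q) := by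
      filter_upwards [Metric.ball_mem_nhds _ hr] with x hx using (hΦ x hx).1
    have hu := (hΦ _ (Metric.mem_ball_self hr)).2
    have e : ∀ W, IsLocalSol A W (h q) →
        W =ᶠ[𝓝 (h q)] fun x => Φ x * (Ring.inverse (Φ (h q)) * W (h q)) := fun W hW =>
      hW.eventuallyEq (hA q hq) (hΦ'.mul_const _) (by
        rw [← mul_assoc, Ring.mul_inverse_cancel _ hu, one_mul])
    refine ⟨{q' | w₁ q' = W₁ (h q') ∧ w₂ q' = W₂ (h q') ∧
      W₁ (h q') = Φ (h q') * (Ring.inverse (Φ (h q)) * W₁ (h q)) ∧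
      W₂ (h q') = Φ (h q') * (Ring.inverse (Φ (h q)) * W₂ (h q)) ∧ h q' ∈ Metric.ball (h q) r}, ?_, ?_⟩
    · have t := (hh q hq).tendsto
      filter_upwards [hw₁, hw₂, t.eventually (e W₁ hW₁), t.eventually (e W₂ hW₂),
        t.eventually (Metric.ball_mem_nhds _ hr)] with a h1 h2 h3 h4 h5 using ⟨h1, h2, h3, h4, h5⟩
    · rintro a ⟨a1, a2, a3, a4, a5⟩ b ⟨b1, b2, b3, b4, b5⟩ hab
      rw [a1, a2, a3, a4] at hab
      rw [b1, b2, b3, b4, ((hΦ _ a5).2.mul_right_injective) hab]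
  have hcl : R ⊆ {q | w₁ q = w₂ q} := by
    have : ∀ q ∈ R, ∃ V, IsOpen V ∧ q ∈ V ∧ ∀ a ∈ V ∩ R, ∀ b ∈ V ∩ R, w₁ a = w₂ a → w₁ b = w₂ b := by
      intro q hq
      obtain ⟨U, hU, hab⟩ := key q hq
      obtain ⟨V, hV, hqV, hVU⟩ := mem_nhdsWithin.mp hU
      exact ⟨V, hV, hqV, fun a ha b hb => hab a (hVU ha) b (hVU hb)⟩
    choose! V hVo hqV hV using this
    by_contra hne
    obtain ⟨q₁, hq₁, hq₁'⟩ := Set.not_subset.mp hne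
    obtain ⟨z, hzR, hz1, hz2⟩ := hR (⋃ q ∈ {q ∈ R | w₁ q = w₂ q}, V q)
      (⋃ q ∈ {q ∈ R | w₁ q ≠ w₂ q}, V q)
      (isOpen_biUnion fun q hq => hVo q hq.1) (isOpen_biUnion fun q hq => hVo q hq.1)
      (fun q hq => by
        by_cases hc : w₁ q = w₂ q
        · exact Or.inl (Set.mem_biUnion (show q ∈ {q ∈ R | w₁ q = w₂ q} from ⟨hq, hc⟩) (hqV q hq))
        · exact Or.inr (Set.mem_biUnion (show q ∈ {q ∈ R | w₁ q ≠ w₂ q} from ⟨hq, hc⟩) (hqV q hq)))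
      ⟨q₀, hq₀, Set.mem_biUnion (show q₀ ∈ {q ∈ R | w₁ q = w₂ q} from ⟨hq₀, he⟩) (hqV q₀ hq₀)⟩
      ⟨q₁, hq₁, Set.mem_biUnion (show q₁ ∈ {q ∈ R | w₁ q ≠ w₂ q} from ⟨hq₁, hq₁'⟩) (hqV q₁ hq₁)⟩
    obtain ⟨a, ha, hza⟩ := Set.mem_iUnion₂.mp hz1
    obtain ⟨b, hb, hzb⟩ := Set.mem_iUnion₂.mp hz2
    exact hb.2 (hV b hb.1 z ⟨hzb, hzR⟩ b ⟨hqV b hb.1, hb.1⟩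
      (hV a ha.1 a ⟨hqV a ha.1, ha.1⟩ z ⟨hza, hzR⟩ ha.2))
  exact fun q hq => hcl hq

-- Closedness keeps a point that lies in one piece only away from the other piece. At a common point
-- the two local solutions have the same value, so they coincide by uniqueness.
open Classical in
lemma IsSection.union {R₁ R₂ : Set X} {w₁ w₂ : X → 𝔸} (hA : ∀ q ∈ R₁ ∩ R₂, AnalyticAt ℂ A (h q))
    (hh : ∀ q ∈ R₁ ∩ R₂, ContinuousWithinAt h (R₁ ∪ R₂) q)
    (hc₁ : IsClosed R₁) (hc₂ : IsClosed R₂) (h₁ : IsSection A h R₁ w₁)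
    (h₂ : IsSection A h R₂ w₂) (he : Set.EqOn w₁ w₂ (R₁ ∩ R₂)) :
    IsSection A h (R₁ ∪ R₂) (R₁.piecewise w₁ w₂) := by
  have e₁ : ∀ q ∈ R₁, R₁.piecewise w₁ w₂ q = w₁ q := fun q hq => Set.piecewise_eq_of_mem _ _ _ hq
  have e₂ : ∀ q ∈ R₂, R₁.piecewise w₁ w₂ q = w₂ q := fun q hq => by
    by_cases hq1 : q ∈ R₁
    · rw [e₁ q hq1, he ⟨hq1, hq⟩]
    · exact Set.piecewise_eq_of_notMem _ _ _ hq1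
  intro q hq
  by_cases hq1 : q ∈ R₁
  · obtain ⟨W₁, hW₁, hw₁⟩ := h₁ q hq1
    by_cases hq2 : q ∈ R₂
    · obtain ⟨W₂, hW₂, hw₂⟩ := h₂ q hq2
      refine ⟨W₁, hW₁, ?_⟩
      have hv : W₁ (h q) = W₂ (h q) := by
        rw [← hw₁.self_of_nhdsWithin hq1, ← hw₂.self_of_nhdsWithin hq2, he ⟨hq1, hq2⟩]
      have hW := hW₁.eventuallyEq (hA q ⟨hq1, hq2⟩) hW₂ hv
      have hW' : ∀ᶠ q' in 𝓝[R₁ ∪ R₂] q, W₁ (h q') = W₂ (h q') :=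
        (hh q ⟨hq1, hq2⟩).tendsto.eventually hW
      rw [nhdsWithin_union] at hW' ⊢
      refine eventually_sup.mpr ⟨?_, ?_⟩
      · filter_upwards [hw₁, self_mem_nhdsWithin] with a ha ha1
        rw [e₁ a ha1, ha]
      · filter_upwards [hw₂, self_mem_nhdsWithin, (eventually_sup.mp hW').2] with a ha ha1 ha2
        rw [e₂ a ha1, ha, ha2]
    · refine ⟨W₁, hW₁, ?_⟩
      have : 𝓝[R₁ ∪ R₂] q = 𝓝[R₁] q := by
        rw [nhdsWithin_union, sup_eq_left, (notMem_closure_iff_nhdsWithin_eq_bot.mp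
          (by rwa [hc₂.closure_eq]))]
        exact bot_le
      rw [this]
      filter_upwards [hw₁, self_mem_nhdsWithin] with a ha ha1
      rw [e₁ a ha1, ha]
  · have hq2 : q ∈ R₂ := hq.resolve_left hq1
    obtain ⟨W₂, hW₂, hw₂⟩ := h₂ q hq2
    refine ⟨W₂, hW₂, ?_⟩
    have : 𝓝[R₁ ∪ R₂] q = 𝓝[R₂] q := by
      rw [nhdsWithin_union, sup_eq_right, (notMem_closure_iff_nhdsWithin_eq_bot.mp
        (by rwa [hc₁.closure_eq]))]
      exact bot_le
    rw [this]
    filter_upwards [hw₂, self_mem_nhdsWithin] with a ha ha1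
    rw [e₂ a ha1, ha]

/-- Through every value at every point of `R` passes a section over `R`. -/
def HasSections (A : ℂ → 𝔸) (h : X → ℂ) (R : Set X) : Prop :=
  ∀ q ∈ R, ∀ w₀ : 𝔸, ∃ w, IsSection A h R w ∧ w q = w₀

/-- A section over one piece is continued by the section over the other piece with the same value at
one common point; since the overlap is preconnected, they agree on all of it. -/
lemma HasSections.union (hA : ∀ q, AnalyticAt ℂ A (h q)) (hh : Continuous h) {R₁ R₂ : Set X}
    (hc₁ : IsClosed R₁) (hc₂ : IsClosed R₂) (h₁ : HasSections A h R₁) (h₂ : HasSections A h R₂)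
    (hp : IsPreconnected (R₁ ∩ R₂)) (hn : (R₁ ∩ R₂).Nonempty) : HasSections A h (R₁ ∪ R₂) := by
  classical
  obtain ⟨j, hj1, hj2⟩ := hn
  have glue : ∀ w₁ w₂ : X → 𝔸, IsSection A h R₁ w₁ → IsSection A h R₂ w₂ → w₁ j = w₂ j →
      ∃ w, IsSection A h (R₁ ∪ R₂) w ∧ Set.EqOn w w₁ R₁ ∧ Set.EqOn w w₂ R₂ := by
    intro w₁ w₂ hw₁ hw₂ e
    have he : Set.EqOn w₁ w₂ (R₁ ∩ R₂) :=
      (hw₁.mono Set.inter_subset_left).eqOn (fun q _ => hA q) hh.continuousOn hp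
        (hw₂.mono Set.inter_subset_right) ⟨hj1, hj2⟩ e
    refine ⟨_, hw₁.union (fun q _ => hA q) (fun q _ => hh.continuousWithinAt) hc₁ hc₂ hw₂ he,
      fun q hq => Set.piecewise_eq_of_mem _ _ _ hq, fun q hq => ?_⟩
    by_cases hq1 : q ∈ R₁
    · rw [Set.piecewise_eq_of_mem _ _ _ hq1, he ⟨hq1, hq⟩]
    · exact Set.piecewise_eq_of_notMem _ _ _ hq1
  rintro q (hq | hq) w₀
  · obtain ⟨w₁, hw₁, e₁⟩ := h₁ q hq w₀
    obtain ⟨w₂, hw₂, e₂⟩ := h₂ j hj2 (w₁ j)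
    obtain ⟨w, hw, k1, _⟩ := glue w₁ w₂ hw₁ hw₂ e₂.symm
    exact ⟨w, hw, by rw [k1 hq, e₁]⟩
  · obtain ⟨w₂, hw₂, e₂⟩ := h₂ q hq w₀
    obtain ⟨w₁, hw₁, e₁⟩ := h₁ j hj1 (w₂ j)
    obtain ⟨w, hw, _, k2⟩ := glue w₁ w₂ hw₁ hw₂ e₁
    exact ⟨w, hw, by rw [k2 hq, e₂]⟩

lemma hasSections_nhds (hA : ∀ q, AnalyticAt ℂ A (h q)) (hh : Continuous h) (q : X) :
    ∃ U : Set X, IsOpen U ∧ q ∈ U ∧ ∀ R ⊆ U, HasSections A h R := by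
  obtain ⟨r, Φ, hr, hΦ⟩ := exists_fundamental (hA q)
  refine ⟨h ⁻¹' Metric.ball (h q) r, Metric.isOpen_ball.preimage hh, Metric.mem_ball_self hr,
    fun R hR q' hq' w₀ => ⟨fun x => Φ (h x) * (Ring.inverse (Φ (h q')) * w₀), fun x hx =>
      ⟨fun y => Φ y * (Ring.inverse (Φ (h q')) * w₀), ?_, Eventually.of_forall fun _ => rfl⟩, ?_⟩⟩
  · refine IsLocalSol.mul_const ?_ _
    filter_upwards [Metric.isOpen_ball.mem_nhds (hR hx)] with y hy using (hΦ y hy).1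
  · beta_reduce
    rw [← mul_assoc, Ring.mul_inverse_cancel _ (hΦ _ (hR hq')).2, one_mul]

-- The monodromy theorem by subdivision: a fine grid cuts the square into rectangles over which a
-- fundamental solution exists. Rectangles are added to a row, and rows to one another, each time
-- along a common edge.
open unitInterval in
theorem hasSections_square {h : I × I → ℂ} (hA : ∀ q, AnalyticAt ℂ A (h q)) (hh : Continuous h) :
    HasSections A h Set.univ := by
  choose U hUo hqU hU using hasSections_nhds hA hh
  obtain ⟨t, t0, tm, ⟨N, hN⟩, ht⟩ := exists_monotone_Icc_subset_open_cover_unitInterval_prod_self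
    (c := U) hUo (fun q _ => Set.mem_iUnion.mpr ⟨q, hqU q⟩)
  have pre : ∀ a b : I, IsPreconnected (Set.Icc a b) := fun a b => isPreconnected_Icc
  have row : ∀ m n : ℕ, HasSections A h (Set.Icc 0 (t (n + 1)) ×ˢ Set.Icc (t m) (t (m + 1))) := by
    intro m n
    induction n with
    | zero =>
      obtain ⟨i, hi⟩ := ht 0 m
      rw [t0] at hi
      exact hU i _ hi
    | succ n ih =>
      obtain ⟨i, hi⟩ := ht (n + 1) m
      have hsplit : Set.Icc 0 (t (n + 1 + 1)) ×ˢ Set.Icc (t m) (t (m + 1)) =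
          Set.Icc 0 (t (n + 1)) ×ˢ Set.Icc (t m) (t (m + 1)) ∪
            Set.Icc (t (n + 1)) (t (n + 1 + 1)) ×ˢ Set.Icc (t m) (t (m + 1)) := by
        rw [← Set.union_prod, Set.Icc_union_Icc_eq_Icc unitInterval.nonneg' (tm (Nat.le_succ _))]
      have hint : Set.Icc 0 (t (n + 1)) ×ˢ Set.Icc (t m) (t (m + 1)) ∩
            Set.Icc (t (n + 1)) (t (n + 1 + 1)) ×ˢ Set.Icc (t m) (t (m + 1)) =
          Set.Icc (t (n + 1)) (t (n + 1)) ×ˢ Set.Icc (t m) (t (m + 1)) := by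
        rw [← Set.inter_prod, Set.Icc_inter_Icc, sup_eq_right.mpr unitInterval.nonneg',
          inf_eq_left.mpr (tm (Nat.le_succ _))]
      rw [hsplit]
      refine ih.union hA hh (isClosed_Icc.prod isClosed_Icc) (isClosed_Icc.prod isClosed_Icc)
        (hU i _ hi) ?_ ?_
      · rw [hint]; exact (pre _ _).prod (pre _ _)
      · rw [hint]
        exact ⟨(t (n + 1), t m), ⟨le_rfl, le_rfl⟩, ⟨le_rfl, tm (Nat.le_succ _)⟩⟩
  have rows : ∀ m : ℕ, HasSections A h (Set.univ ×ˢ Set.Icc 0 (t (m + 1))) := by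
    have row' : ∀ m : ℕ, HasSections A h (Set.univ ×ˢ Set.Icc (t m) (t (m + 1))) := by
      intro m
      have := row m N
      rwa [hN (N + 1) (Nat.le_succ N), show Set.Icc (0 : I) 1 = Set.univ from
        Set.eq_univ_of_forall fun x => ⟨unitInterval.nonneg', unitInterval.le_one'⟩] at this
    intro m
    induction m with
    | zero => simpa [t0] using row' 0
    | succ m ih =>
      have hsplit : (Set.univ : Set I) ×ˢ Set.Icc 0 (t (m + 1 + 1)) =
          Set.univ ×ˢ Set.Icc 0 (t (m + 1)) ∪ Set.univ ×ˢ Set.Icc (t (m + 1)) (t (m + 1 + 1)) := by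
        rw [← Set.prod_union, Set.Icc_union_Icc_eq_Icc unitInterval.nonneg' (tm (Nat.le_succ _))]
      have hint : (Set.univ : Set I) ×ˢ Set.Icc 0 (t (m + 1)) ∩
            Set.univ ×ˢ Set.Icc (t (m + 1)) (t (m + 1 + 1)) =
          Set.univ ×ˢ Set.Icc (t (m + 1)) (t (m + 1)) := by
        rw [← Set.prod_inter, Set.Icc_inter_Icc, sup_eq_right.mpr unitInterval.nonneg',
          inf_eq_left.mpr (tm (Nat.le_succ _))]
      rw [hsplit]
      refine ih.union hA hh (isClosed_univ.prod isClosed_Icc) (isClosed_univ.prod isClosed_Icc)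
        (row' (m + 1)) ?_ ?_
      · rw [hint]; exact isPreconnected_univ.prod (pre _ _)
      · rw [hint]
        exact ⟨(0, t (m + 1)), Set.mem_univ _, ⟨le_rfl, le_rfl⟩⟩
  have := rows N
  rwa [hN (N + 1) (Nat.le_succ N), show Set.Icc (0 : I) 1 = Set.univ from
    Set.eq_univ_of_forall fun x => ⟨unitInterval.nonneg', unitInterval.le_one'⟩,
    Set.univ_prod_univ] at this

open unitInterval in
theorem hasSections_path {γ : I → ℂ} (hA : ∀ q, AnalyticAt ℂ A (γ q)) (hγ : Continuous γ) :
    HasSections A γ Set.univ := fun q _ w₀ => by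
  obtain ⟨w, hw, e⟩ := hasSections_square (h := fun p : I × I => γ p.1) (fun p => hA p.1)
    (hγ.comp continuous_fst) (q, 0) (Set.mem_univ _) w₀
  exact ⟨fun s => w (s, 0), hw.comp (φ := fun s : I => (s, (0 : I))) (by fun_prop) (fun _ _ => Set.mem_univ _), e⟩

end Sections

/-! ### Parallel transport and its homotopy invariance -/

section Transport

open unitInterval

variable {𝔸 : Type*} [NormedRing 𝔸] [NormedAlgebra ℂ 𝔸] {A : ℂ → 𝔸} {γ : I → ℂ}

/-- `T` is the parallel transport of `W' = A W` along the path `γ`. -/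
def IsTransport (A : ℂ → 𝔸) (γ : I → ℂ) (T : 𝔸) : Prop :=
  ∃ w, IsSection A γ Set.univ w ∧ w 0 = 1 ∧ w 1 = T

variable [CompleteSpace 𝔸]

lemma exists_isTransport (hA : ∀ s, AnalyticAt ℂ A (γ s)) (hγ : Continuous γ) :
    ∃ T, IsTransport A γ T :=
  let ⟨w, hw, h0⟩ := hasSections_path hA hγ 0 (Set.mem_univ _) 1
  ⟨w 1, w, hw, h0, rfl⟩

lemma IsTransport.section_apply (hA : ∀ s, AnalyticAt ℂ A (γ s)) (hγ : Continuous γ) {T : 𝔸}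
    (hT : IsTransport A γ T) {w : I → 𝔸} (hw : IsSection A γ Set.univ w) : w 1 = T * w 0 := by
  obtain ⟨v, hv, v0, v1⟩ := hT
  have := hw.eqOn (fun q _ => hA q) hγ.continuousOn isPreconnected_univ (hv.mul_const (w 0))
    (Set.mem_univ 0) (by simp [v0])
  rw [this (Set.mem_univ 1), ← v1]

lemma IsTransport.unique (hA : ∀ s, AnalyticAt ℂ A (γ s)) (hγ : Continuous γ) {T T' : 𝔸}
    (hT : IsTransport A γ T) (hT' : IsTransport A γ T') : T = T' := by
  obtain ⟨v, hv, v0, v1⟩ := hT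
  rw [← v1, hT'.section_apply hA hγ hv, v0, mul_one]

lemma isTransport_const (hA : ∀ s, AnalyticAt ℂ A (γ s)) (hγ : ∀ s s', γ s = γ s') :
    IsTransport A γ 1 :=
  ⟨fun _ => 1, isSection_const hA hγ 1 _, rfl, rfl⟩

lemma IsTransport.symm_mul (hA : ∀ s, AnalyticAt ℂ A (γ s)) (hγ : Continuous γ) {T T' : 𝔸}
    (hT : IsTransport A γ T) (hT' : IsTransport A (fun s => γ (σ s)) T') : T' * T = 1 := by
  obtain ⟨v, hv, v0, v1⟩ := hT
  have := hT'.section_apply (fun s => hA _) (hγ.comp continuous_symm)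
    (hv.comp (φ := σ) continuous_symm.continuousOn (fun _ _ => Set.mem_univ _))
  simpa [v0, v1] using this.symm

lemma IsTransport.mul_symm (hA : ∀ s, AnalyticAt ℂ A (γ s)) (hγ : Continuous γ) {T T' : 𝔸}
    (hT : IsTransport A γ T) (hT' : IsTransport A (fun s => γ (σ s)) T') : T * T' = 1 :=
  hT'.symm_mul (fun s => hA _) (hγ.comp continuous_symm) (by simpa using hT)

/-- Constants multiply on the right, so the second section has to be taken as `v' * T` to match at
the midpoint. Later paths therefore stand on the left. -/
lemma IsTransport.trans {a b c : ℂ} {γ : Path a b} {γ' : Path b c}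
    (hA : ∀ s, AnalyticAt ℂ A (γ s)) {T T' : 𝔸}
    (hT : IsTransport A γ T) (hT' : IsTransport A γ' T') :
    IsTransport A (γ.trans γ') (T' * T) := by
  obtain ⟨v, hv, v0, v1⟩ := hT
  obtain ⟨v', hv', v0', v1'⟩ := hT'
  have cont1 : Continuous fun s : I => Set.projIcc (0 : ℝ) 1 zero_le_one (2 * (s : ℝ)) := by fun_prop
  have cont2 : Continuous fun s : I => Set.projIcc (0 : ℝ) 1 zero_le_one (2 * (s : ℝ) - 1) := by
    fun_prop
  have e1 : Set.EqOn (fun s : I => γ (Set.projIcc (0 : ℝ) 1 zero_le_one (2 * (s : ℝ))))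
      (γ.trans γ') {s : I | (s : ℝ) ≤ 1 / 2} := fun s hs => by
    rw [Path.trans_apply]
    have hs' : (s : ℝ) ≤ 1 / 2 := hs
    rw [dif_pos hs']
    exact congrArg γ (Set.projIcc_of_mem _ _)
  have e2 : Set.EqOn (fun s : I => γ' (Set.projIcc (0 : ℝ) 1 zero_le_one (2 * (s : ℝ) - 1)))
      (γ.trans γ') {s : I | 1 / 2 ≤ (s : ℝ)} := fun s hs => by
    rw [Path.trans_apply]
    have hs' : 1 / 2 ≤ (s : ℝ) := hs
    split_ifs with h
    · have : (s : ℝ) = 1 / 2 := le_antisymm h hs'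
      simp [this]
    · exact congrArg γ' (Set.projIcc_of_mem _ _)
  have s1 := ((hv.comp cont1.continuousOn (R' := {s : I | (s : ℝ) ≤ 1 / 2})
    (fun _ _ => Set.mem_univ _)).congr_map e1)
  have s2 := ((hv'.comp cont2.continuousOn (R' := {s : I | 1 / 2 ≤ (s : ℝ)})
    (fun _ _ => Set.mem_univ _)).congr_map e2).mul_const T
  have huniv : {s : I | (s : ℝ) ≤ 1 / 2} ∪ {s : I | 1 / 2 ≤ (s : ℝ)} = Set.univ :=
    Set.eq_univ_of_forall fun s => le_total (s : ℝ) (1 / 2)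
  have hs := s1.union (w₂ := _) (fun q hq => by
      rw [← e1 hq.1]; exact hA _)
    (fun q _ => (γ.trans γ').continuous.continuousWithinAt)
    (isClosed_le (by fun_prop) (by fun_prop)) (isClosed_le (by fun_prop) (by fun_prop)) s2 (by
      rintro q ⟨h1, h2⟩
      have : (q : ℝ) = 1 / 2 := le_antisymm h1 h2
      simp [this, v1, v0'])
  rw [huniv] at hs
  refine ⟨_, hs, ?_, ?_⟩
  · rw [Set.piecewise_eq_of_mem _ _ _ (by simp)]
    simp [v0]
  · rw [Set.piecewise_eq_of_notMem _ _ _ (by simp; norm_num)]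
    norm_num [v1']

/-- Transport around the boundary of a square. -/
lemma isTransport_square {h : I × I → ℂ} (hA : ∀ q, AnalyticAt ℂ A (h q)) (hh : Continuous h)
    {T₀ T₁ L R : 𝔸} (h₀ : IsTransport A (fun s => h (0, s)) T₀)
    (h₁ : IsTransport A (fun s => h (1, s)) T₁) (hL : IsTransport A (fun s => h (s, 0)) L)
    (hR : IsTransport A (fun s => h (s, 1)) R) : R * T₀ = T₁ * L := by
  obtain ⟨w, hw, e⟩ := hasSections_square hA hh (0, 0) (Set.mem_univ _) 1
  have a0 := h₀.section_apply (fun s => hA _) (by fun_prop)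
    (hw.comp (φ := fun s : I => ((0 : I), s)) (R' := Set.univ) (by fun_prop) (fun _ _ => Set.mem_univ _))
  have a1 := h₁.section_apply (fun s => hA _) (by fun_prop)
    (hw.comp (φ := fun s : I => ((1 : I), s)) (R' := Set.univ) (by fun_prop) (fun _ _ => Set.mem_univ _))
  have b0 := hL.section_apply (fun s => hA _) (by fun_prop)
    (hw.comp (φ := fun s : I => (s, (0 : I))) (R' := Set.univ) (by fun_prop) (fun _ _ => Set.mem_univ _))
  have b1 := hR.section_apply (fun s => hA _) (by fun_prop)
    (hw.comp (φ := fun s : I => (s, (1 : I))) (R' := Set.univ) (by fun_prop) (fun _ _ => Set.mem_univ _))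
  simp only [e, mul_one] at a0 a1 b0 b1
  rw [a1, b0, a0] at b1
  exact b1.symm

/-- The two sides of the homotopy square on which the end points rest have transport one, so going
around the square equates the other two. -/
lemma IsTransport.homotopicIn {S : Set ℂ} (hA : ∀ x ∈ S, AnalyticAt ℂ A x) {a b : ℂ}
    {γ γ' : Path a b} (hγ : HomotopicIn S γ γ') {T : 𝔸} (hT : IsTransport A γ T) :
    IsTransport A γ' T := by
  obtain ⟨H, hH⟩ := hγ
  have hA' : ∀ q, AnalyticAt ℂ A (H q) := fun q => hA _ (hH q)
  obtain ⟨T', hT'⟩ := exists_isTransport (A := A) (γ := γ') (fun s => by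
    have := hA' (1, s); rwa [H.apply_one] at this) γ'.continuous
  have hL : IsTransport A (fun s => H (s, 0)) 1 := isTransport_const (fun s => hA' _) (by simp)
  have hR : IsTransport A (fun s => H (s, 1)) 1 := isTransport_const (fun s => hA' _) (by simp)
  have := isTransport_square hA' H.continuous (T₀ := T) (T₁ := T') (by simpa using hT)
    (by simpa using hT') hL hR
  rw [one_mul, mul_one] at this
  rwa [this]

/-- Transports along freely homotopic loops are conjugate. -/
lemma isTransport_free_homotopy {h : I × I → ℂ} (hA : ∀ q, AnalyticAt ℂ A (h q)) (hh : Continuous h)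
    (hloop : ∀ s, h (s, 0) = h (s, 1)) {T₀ T₁ : 𝔸} (h₀ : IsTransport A (fun s => h (0, s)) T₀)
    (h₁ : IsTransport A (fun s => h (1, s)) T₁) : ∃ C : 𝔸ˣ, C * T₀ = T₁ * C := by
  obtain ⟨L, hL⟩ := exists_isTransport (A := A) (γ := fun s => h (s, 0)) (fun s => hA _) (by fun_prop)
  obtain ⟨L', hL'⟩ := exists_isTransport (A := A) (γ := fun s => h (σ s, 0)) (fun s => hA _)
    (by fun_prop)
  refine ⟨⟨L, L', hL.mul_symm (fun s => hA _) (by fun_prop) hL',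
    hL.symm_mul (fun s => hA _) (by fun_prop) hL'⟩, ?_⟩
  -- The base points of the loops trace one and the same path on both lateral sides; its transport
  -- conjugates.
  exact isTransport_square hA hh h₀ h₁ hL (by simpa only [← hloop] using hL)

lemma IsLocalSol.analyticAt {W : ℂ → 𝔸} {c : ℂ} (h : IsLocalSol A W c) : AnalyticAt ℂ W c := by
  obtain ⟨r, hr, h⟩ := Metric.eventually_nhds_iff_ball.mp h
  exact DifferentiableOn.analyticAt
    (fun x hx => (h x hx).differentiableAt.differentiableWithinAt) (Metric.ball_mem_nhds c hr)

/-- A solution can be continued along every path on which `A` is analytic. -/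
lemma IsTransport.exists_continuation (hA : ∀ s, AnalyticAt ℂ A (γ s)) (hγ : Continuous γ) {T : 𝔸}
    (hT : IsTransport A γ T) (C : 𝔸) :
    ∃ W : I → ℂ → 𝔸, (∀ s, IsLocalSol A (W s) (γ s)) ∧
      (∀ s, ∀ᶠ s' in 𝓝 s, W s' =ᶠ[𝓝 (γ s')] W s) ∧ W 0 (γ 0) = C ∧ W 1 (γ 1) = T * C := by
  obtain ⟨v, hv, v0, v1⟩ := hT
  have hw := hv.mul_const C
  choose W hW hWw using fun s => hw s (Set.mem_univ s)
  simp only [nhdsWithin_univ] at hWw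
  refine ⟨W, hW, fun s => ?_, ?_, ?_⟩
  · have h1 := hγ.continuousAt.eventually (hW s).eventually
    filter_upwards [h1, hWw s] with s' h2 h3
    refine (hW s').eventuallyEq (hA s') h2 ?_
    rw [← h3, (hWw s').self_of_nhds]
  · rw [← (hWw 0).self_of_nhds, v0, one_mul]
  · rw [← (hWw 1).self_of_nhds, v1]

end Transport

/-! ### Trace of the monodromy around a simple pole -/

section CircleTrace

open unitInterval

variable {𝔸 : Type*} [NormedRing 𝔸] [NormedAlgebra ℂ 𝔸] {A : ℂ → 𝔸}

lemma circlePath_ne {a : ℂ} {r : ℝ} (hr : 0 < r) (s : I) : circlePath a r s ≠ a := by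
  have : circlePath a r s = a + r * Complex.exp (2 * Real.pi * Complex.I * ((s : ℝ) : ℂ)) := rfl
  simp [this, hr.ne', Complex.exp_ne_zero]

lemma norm_circle_sub (a : ℂ) {r : ℝ} (hr : 0 ≤ r) (s : ℝ) :
    ‖a + r * Complex.exp (2 * Real.pi * Complex.I * (s : ℂ)) - a‖ = r := by
  rw [add_sub_cancel_left, norm_mul, show (2 * Real.pi * Complex.I * (s : ℂ)) =
    ((2 * Real.pi * s : ℝ) : ℂ) * Complex.I by push_cast; ring, Complex.norm_exp_ofReal_mul_I]
  simp [hr]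

lemma hasDerivAt_circle (a : ℂ) (r : ℝ) (s : ℝ) :
    HasDerivAt (fun s : ℝ => a + r * Complex.exp (2 * Real.pi * Complex.I * (s : ℂ)))
      (2 * Real.pi * Complex.I * (a + r * Complex.exp (2 * Real.pi * Complex.I * (s : ℂ)) - a)) s := by
  have h1 : HasDerivAt (fun s : ℝ => 2 * Real.pi * Complex.I * (s : ℂ)) (2 * Real.pi * Complex.I) s := by
    simpa using (Complex.ofRealCLM.hasDerivAt (x := s)).const_mul (2 * Real.pi * Complex.I)
  have h2 := ((h1.cexp).const_mul (r : ℂ)).const_add a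
  refine h2.congr_deriv ?_
  rw [add_sub_cancel_left]
  ring

/-- In the parameter `s` of the circle the equation reads `u' = 2πi ((x - a) A(x)) u`. Its
coefficient differs from that of the equation for `V` by at most `2π ε`, and Gronwall's inequality
compares the solutions. The bound does not involve the radius. -/
lemma norm_section_circle_sub_le {a : ℂ} {r : ℝ} (hr : 0 < r) {w : I → 𝔸}
    (hw : IsSection A (circlePath a r) Set.univ w) (h0 : w 0 = 1) {B : 𝔸} {ε : ℝ} (hε1 : ε ≤ 1)
    (hB : ∀ x, ‖x - a‖ = r → ‖(x - a) • A x - B‖ ≤ ε) {V : ℝ → 𝔸} (hV0 : V 0 = 1)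
    (hV : ∀ s, HasDerivAt V ((2 * Real.pi * Complex.I) • (B * V s)) s) :
    ‖w 1 - V 1‖ ≤ gronwallBound 0 (2 * Real.pi * ‖B‖)
      (2 * Real.pi * ε * (gronwallBound ‖(1 : 𝔸)‖ (2 * Real.pi * (‖B‖ + 1)) 0 1)) 1 := by
  set κ : ℂ := 2 * Real.pi * Complex.I
  have hκ : ‖κ‖ = 2 * Real.pi := by
    simp [κ, abs_of_pos Real.pi_pos]
  set g : ℝ → ℂ := fun s => a + r * Complex.exp (κ * (s : ℂ)) with hg
  have hgr : ∀ s, ‖g s - a‖ = r := norm_circle_sub a hr.le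
  set u : ℝ → 𝔸 := fun s => w (Set.projIcc 0 1 zero_le_one s) with hu
  have hu0 : u 0 = 1 := by simp [hu, h0]
  have hu1 : u 1 = w 1 := by simp [hu]
  have hgp : ∀ s ∈ Set.Icc (0 : ℝ) 1, circlePath a r (Set.projIcc 0 1 zero_le_one s) = g s := by
    intro s hs
    rw [Set.projIcc_of_mem _ hs]
    rfl
  have hder : ∀ s ∈ Set.Icc (0 : ℝ) 1,
      HasDerivWithinAt u (κ • (((g s - a) • A (g s)) * u s)) (Set.Icc 0 1) s := by
    intro s hs
    obtain ⟨W, hW, hWw⟩ := hw (Set.projIcc 0 1 zero_le_one s) (Set.mem_univ _)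
    rw [hgp s hs] at hW
    rw [nhdsWithin_univ] at hWw
    have h1 : ∀ᶠ s' in 𝓝[Set.Icc 0 1] s, u s' = W (g s') := by
      have := ((continuous_projIcc (a := (0 : ℝ)) (b := 1) (h := zero_le_one)).continuousAt
        (x := s)).eventually hWw
      filter_upwards [nhdsWithin_le_nhds this, self_mem_nhdsWithin] with s' h1 h2
      rw [← hgp s' h2, ← h1]
    have h2 := (hW.self_of_nhds.scomp s (hasDerivAt_circle a r s)).hasDerivWithinAt (s := Set.Icc 0 1)
    have h3 := h2.congr_of_eventuallyEq h1 (h1.self_of_nhdsWithin hs)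
    have h4 : u s = W (g s) := h1.self_of_nhdsWithin hs
    refine h3.congr_deriv ?_
    rw [h4, mul_smul, smul_mul_assoc]
  have hcont : ContinuousOn u (Set.Icc 0 1) := fun s hs => (hder s hs).continuousWithinAt
  have hder' : ∀ s ∈ Set.Ico (0 : ℝ) 1,
      HasDerivWithinAt u (κ • (((g s - a) • A (g s)) * u s)) (Set.Ici s) s := fun s hs =>
    (hder s ⟨hs.1, hs.2.le⟩).mono_of_mem_nhdsWithin (Icc_mem_nhdsGE_of_mem hs)
  have hbd : ∀ s, ‖(g s - a) • A (g s)‖ ≤ ‖B‖ + 1 := fun s => by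
    have := hB (g s) (hgr s)
    calc ‖(g s - a) • A (g s)‖ = ‖B + ((g s - a) • A (g s) - B)‖ := by rw [add_sub_cancel]
      _ ≤ ‖B‖ + ε := (norm_add_le _ _).trans (by gcongr)
      _ ≤ _ := by gcongr
  have hnorm : ∀ s ∈ Set.Icc (0 : ℝ) 1,
      ‖u s‖ ≤ gronwallBound ‖(1 : 𝔸)‖ (2 * Real.pi * (‖B‖ + 1)) 0 1 := by
    intro s hs
    have := norm_le_gronwallBound_of_norm_deriv_right_le hcont hder' (δ := ‖(1 : 𝔸)‖)
      (K := 2 * Real.pi * (‖B‖ + 1)) (ε := 0) (by rw [hu0]) (fun x _ => by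
        rw [norm_smul, hκ, add_zero, mul_assoc (2 * Real.pi)]
        refine mul_le_mul_of_nonneg_left ((norm_mul_le _ _).trans ?_) (by positivity)
        exact mul_le_mul_of_nonneg_right (hbd x) (norm_nonneg _)) s hs
    refine this.trans ?_
    rw [gronwallBound_ε0, gronwallBound_ε0]
    gcongr
    linarith [hs.2]
  have hε : 0 ≤ ε := (norm_nonneg _).trans (hB _ (hgr 0))
  have key := dist_le_of_approx_trajectories_ODE (v := fun _ y => κ • (B * y))
    (K := ⟨2 * Real.pi * ‖B‖, by positivity⟩) (δ := 0) (a := 0) (b := 1)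
    (εf := 2 * Real.pi * ε * (gronwallBound ‖(1 : 𝔸)‖ (2 * Real.pi * (‖B‖ + 1)) 0 1)) (εg := 0)
    (g := V) (g' := fun s => κ • (B * V s))
    (fun t => LipschitzWith.of_dist_le_mul fun x y => by
      rw [dist_eq_norm, dist_eq_norm, ← smul_sub, ← mul_sub, norm_smul, hκ]
      show _ ≤ 2 * Real.pi * ‖B‖ * _
      rw [mul_assoc (2 * Real.pi)]
      exact mul_le_mul_of_nonneg_left (norm_mul_le _ _) (by positivity))
    hcont hder' (fun t ht => by
      rw [dist_eq_norm, ← smul_sub, ← sub_mul, norm_smul, hκ, mul_assoc (2 * Real.pi)]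
      refine mul_le_mul_of_nonneg_left ((norm_mul_le _ _).trans ?_) (by positivity)
      refine mul_le_mul ?_ ?_ (norm_nonneg _) hε
      · exact hB _ (hgr t)
      · exact hnorm t ⟨ht.1, ht.2.le⟩)
    (fun s _ => (hV s).continuousAt.continuousWithinAt) (fun s _ => (hV s).hasDerivWithinAt)
    (fun s _ => by simp) (by simp [hu0, hV0]) 1 (by simp)
  rw [dist_eq_norm, hu1, add_zero, sub_zero] at key
  exact key

variable [CompleteSpace 𝔸]

/-- The trace of the local monodromy at a simple pole of `A` with residue `B` is that of the
local monodromy of `W' = B W / (x - a)`. -/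
theorem trace_transport_circle {a : ℂ} {r : ℝ} (hr : 0 < r)
    (hA : ∀ x ∈ Metric.closedBall a r \ {a}, AnalyticAt ℂ A x) {B : 𝔸}
    (hB : Tendsto (fun x => (x - a) • A x) (𝓝[≠] a) (𝓝 B)) {V : ℝ → 𝔸} (hV0 : V 0 = 1)
    (hV : ∀ s, HasDerivAt V ((2 * Real.pi * Complex.I) • (B * V s)) s) (tr : 𝔸 →L[ℂ] ℂ)
    (htr : ∀ x y, tr (x * y) = tr (y * x)) {T : 𝔸} (hT : IsTransport A (circlePath a r) T) :
    tr T = tr (V 1) := by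
  set C := gronwallBound ‖(1 : 𝔸)‖ (2 * Real.pi * (‖B‖ + 1)) 0 1
  have hlim : Tendsto (fun ε : ℝ => ‖tr‖ * gronwallBound 0 (2 * Real.pi * ‖B‖) (2 * Real.pi * ε * C) 1)
      (𝓝[>] 0) (𝓝 0) := by
    have hc : Continuous fun ε : ℝ =>
        ‖tr‖ * gronwallBound 0 (2 * Real.pi * ‖B‖) (2 * Real.pi * ε * C) 1 :=
      continuous_const.mul ((gronwallBound_continuous_ε _ _ _).comp (by fun_prop))
    have := hc.tendsto 0
    simp only [mul_zero, zero_mul, gronwallBound_ε0_δ0] at this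
    exact this.mono_left nhdsWithin_le_nhds
  -- Circles of different radii are freely homotopic in the punctured disc, so the trace stays the
  -- same when the circle shrinks, while the transport comes arbitrarily close to `V 1`. No normal
  -- form at the pole is needed, and resonance does no harm.
  rw [← sub_eq_zero, ← norm_le_zero_iff]
  refine ge_of_tendsto hlim ?_
  filter_upwards [Ioc_mem_nhdsGT (zero_lt_one (α := ℝ))] with ε hε
  obtain ⟨r₁, hr₁, h₁⟩ := Metric.mem_nhdsWithin_iff.mp (hB (Metric.closedBall_mem_nhds B hε.1))
  set r' := min r (r₁ / 2)
  have hr' : 0 < r' := lt_min hr (by linarith)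
  have hr'1 : r' < r₁ := (min_le_right _ _).trans_lt (by linarith)
  set h : I × I → ℂ := fun q => a + ((1 - (q.1 : ℝ)) * r + (q.1 : ℝ) * r' : ℝ) *
    Complex.exp (2 * Real.pi * Complex.I * ((q.2 : ℝ) : ℂ))
  have hh : Continuous h := by fun_prop
  have hhA : ∀ q, AnalyticAt ℂ A (h q) := by
    intro q
    have hq0 := q.1.2.1
    have hq1 := q.1.2.2
    have hpos : 0 < (1 - (q.1 : ℝ)) * r + (q.1 : ℝ) * r' := by
      rcases hq0.eq_or_lt with h | h
      · rw [← h]; simpa using hr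
      · have : 0 ≤ (1 - (q.1 : ℝ)) * r := mul_nonneg (by linarith) hr.le
        positivity
    have hn := norm_circle_sub a hpos.le (q.2 : ℝ)
    refine hA _ ⟨?_, ?_⟩
    · rw [mem_closedBall_iff_norm, hn]
      have : r' ≤ r := min_le_left _ _
      nlinarith
    · rw [Set.mem_singleton_iff, ← sub_eq_zero, ← norm_eq_zero, hn]
      exact hpos.ne'
  obtain ⟨T', hT'⟩ := exists_isTransport (A := A) (γ := fun s => h (1, s)) (fun s => hhA _)
    (by fun_prop)
  have e0 : (fun s => h (0, s)) = circlePath a r := by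
    funext s
    have : circlePath a r s = a + r * Complex.exp (2 * Real.pi * Complex.I * ((s : ℝ) : ℂ)) := rfl
    simp [h, this]
  have e1 : (fun s => h (1, s)) = circlePath a r' := by
    funext s
    have : circlePath a r' s = a + r' * Complex.exp (2 * Real.pi * Complex.I * ((s : ℝ) : ℂ)) := rfl
    simp [h, this]
  obtain ⟨U, hU⟩ := isTransport_free_homotopy hhA hh (fun s => by simp [h, Complex.exp_two_pi_mul_I])
    (e0 ▸ hT) hT'
  have hTT : tr T = tr T' := by
    have : T = ↑U⁻¹ * (T' * U) := by rw [← hU, Units.inv_mul_cancel_left]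
    rw [this, htr, mul_assoc, Units.mul_inv, mul_one]
  rw [e1] at hT'
  obtain ⟨w, hw, w0, w1⟩ := hT'
  have := norm_section_circle_sub_le hr' hw w0 hε.2 (B := B) (fun x hx => by
    have : x ∈ Metric.ball a r₁ ∩ {a}ᶜ := by
      refine ⟨by rwa [mem_ball_iff_norm, hx], ?_⟩
      rintro rfl
      simp at hx
      linarith
    have := h₁ this
    rwa [Set.mem_preimage, mem_closedBall_iff_norm] at this) hV0 hV
  rw [hTT, ← map_sub, ← w1]
  exact (tr.le_opNorm _).trans (by gcongr)

end CircleTrace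

/-! ### The Weierstrass zeta function -/

section Zeta

open PeriodPair

variable (L : PeriodPair)

/-- The Weierstrass zeta function of a lattice. -/
def zetaW (z : ℂ) : ℂ := ∑' v : L.lattice, (1 / (z - (v : ℂ)) + 1 / (v : ℂ) + z / (v : ℂ) ^ 2)

/-- `ζ(z) - 1 / z`. -/
def zetaReg (z : ℂ) : ℂ :=
  ∑' v : L.lattice, if v.1 = 0 then 0 else (1 / (z - (v : ℂ)) + 1 / (v : ℂ) + z / (v : ℂ) ^ 2)

/-- The three terms add up to `s ^ 2 / ((s - l) * l ^ 2)`, and `‖s - l‖ ≥ ‖l‖ / 2`. Cubic decay is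
summable over a lattice in the plane. -/
lemma zeta_summand_bound (r : ℝ) (hr : 0 < r) (s : ℂ) (hs : ‖s‖ < r) (l : ℂ) (h : 2 * r ≤ ‖l‖) :
    ‖1 / (s - l) + 1 / l + s / l ^ 2‖ ≤ 2 * r ^ 2 * ‖l‖ ^ (-3 : ℝ) := by
  have h1 : s ≠ l := by rintro rfl; linarith
  have hl : 0 < ‖l‖ := by linarith
  have hl0 : l ≠ 0 := norm_pos_iff.mp hl
  have h2 : s - l ≠ 0 := sub_ne_zero.mpr h1
  have h3 : 1 / (s - l) + 1 / l + s / l ^ 2 = s ^ 2 / ((s - l) * l ^ 2) := by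
    field_simp
    ring
  have h4 : ‖l‖ / 2 ≤ ‖s - l‖ := by
    rw [norm_sub_rev]
    exact .trans (by linarith) (norm_sub_norm_le l s)
  rw [h3, norm_div, norm_mul, norm_pow, norm_pow]
  calc ‖s‖ ^ 2 / (‖s - l‖ * ‖l‖ ^ 2) ≤ r ^ 2 / ((‖l‖ / 2) * ‖l‖ ^ 2) := by gcongr
    _ = 2 * r ^ 2 / ‖l‖ ^ 3 := by field
    _ = _ := by norm_cast

lemma hasSumLocallyUniformly_zetaReg :
    HasSumLocallyUniformly (fun (v : L.lattice) (z : ℂ) =>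
      if v.1 = 0 then 0 else (1 / (z - (v : ℂ)) + 1 / (v : ℂ) + z / (v : ℂ) ^ 2)) (zetaReg L) := by
  refine L.hasSumLocallyUniformly_aux (u := fun r l => 2 * r ^ 2 * ‖l‖ ^ (-3 : ℝ)) _
    (fun _ _ ↦ (ZLattice.summable_norm_rpow _ _ (by simp; norm_num)).mul_left _) fun r hr ↦
    Filter.eventually_atTop.mpr ⟨2 * r, ?_⟩
  rintro _ h s hs l rfl
  split_ifs
  · simpa using! show 0 ≤ 2 * r ^ 2 * (‖↑l‖ ^ 3)⁻¹ by positivity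
  · exact zeta_summand_bound r hr s hs l h

lemma zetaReg_summand_differentiableOn (s : Finset L.lattice) :
    DifferentiableOn ℂ (fun z : ℂ => ∑ v ∈ s,
      if v.1 = 0 then 0 else (1 / (z - (v : ℂ)) + 1 / (v : ℂ) + z / (v : ℂ) ^ 2))
      (L.lattice \ {0})ᶜ := by
  refine .fun_sum fun v _ => ?_
  split_ifs with h
  · simp
  · refine .add (.add (.div (by fun_prop) (by fun_prop) fun x hx => ?_) (by fun_prop)) (by fun_prop)
    rw [sub_ne_zero]
    rintro rfl
    exact hx ⟨v.2, h⟩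

lemma differentiableOn_zetaReg : DifferentiableOn ℂ (zetaReg L) (L.lattice \ {0})ᶜ :=
  (hasSumLocallyUniformly_zetaReg L).hasSumLocallyUniformlyOn.differentiableOn
    (.of_forall fun s ↦ zetaReg_summand_differentiableOn L s) L.isOpen_compl_lattice_sdiff

/-- Locally uniform convergence allows termwise differentiation; `weierstrassPExcept 0` is the
series of `℘` without its term at the lattice point `0`. -/
lemma deriv_zetaReg {z : ℂ} (hz : z ∈ ((L.lattice : Set ℂ) \ {0})ᶜ) :
    deriv (zetaReg L) z = -L.weierstrassPExcept 0 z := by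
  have h1 := (hasSumLocallyUniformly_zetaReg L).tendstoLocallyUniformlyOn.deriv
    (.of_forall fun s ↦ zetaReg_summand_differentiableOn L s) L.isOpen_compl_lattice_sdiff
  have h2 : TendstoLocallyUniformlyOn _ _ _ (((L.lattice : Set ℂ) \ {0})ᶜ) :=
    ((L.hasSumLocallyUniformly_weierstrassPExcept 0).tendstoLocallyUniformlyOn)
  refine tendsto_nhds_unique (h1.tendsto_at hz) ((h2.tendsto_at hz).neg.congr fun s => ?_)
  simp only [Function.comp_apply]
  rw [deriv_fun_sum, ← Finset.sum_neg_distrib]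
  · refine Finset.sum_congr rfl fun v _ => ?_
    split_ifs with h
    · simp
    have hzv : z - v ≠ 0 := fun e => by
      obtain rfl := sub_eq_zero.mp e
      exact hz ⟨v.2, h⟩
    have hv : HasDerivAt (fun z : ℂ => 1 / (z - (v : ℂ)) + 1 / (v : ℂ) + z / (v : ℂ) ^ 2)
        (-1 / (z - v) ^ 2 + 1 / (v : ℂ) ^ 2) z := by
      have a := (((hasDerivAt_id z).sub_const (v : ℂ)).fun_inv hzv)
      have b := (hasDerivAt_id z).div_const ((v : ℂ) ^ 2)
      simpa using (a.add_const (1 / (v : ℂ))).fun_add b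
    rw [hv.deriv]
    ring
  · intro v _
    split_ifs with h
    · simp
    have hzv : z - v ≠ 0 := fun e => by
      obtain rfl := sub_eq_zero.mp e
      exact hz ⟨v.2, h⟩
    exact .add (.add (.div (by fun_prop) (by fun_prop) hzv) (by fun_prop)) (by fun_prop)

lemma zetaW_eq (z : ℂ) : zetaW L z = 1 / z + zetaReg L z := by
  have : (1 / z : ℂ) = ∑' v : L.lattice, if v = 0 then (1 / z : ℂ) else 0 := by simp
  rw [zetaReg, this, zetaW, ← Summable.tsum_add]
  · refine tsum_congr fun v => ?_
    by_cases h : v = 0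
    · simp [h]
    · have : v.1 ≠ 0 := by simpa using h
      simp [h]
  · exact summable_of_hasFiniteSupport ((Set.finite_singleton (0 : L.lattice)).subset (by
      intro v; simp; tauto))
  · exact ⟨_, (hasSumLocallyUniformly_zetaReg L).hasSum⟩

lemma zetaW_neg (z : ℂ) : zetaW L (-z) = -zetaW L z := by
  rw [zetaW, zetaW, ← (Equiv.neg L.lattice).tsum_eq, ← tsum_neg]
  refine tsum_congr fun v => ?_
  simp only [Equiv.neg_apply, Submodule.coe_neg]
  rw [show -z - -(v : ℂ) = -(z - v) by ring, one_div_neg_eq_neg_one_div]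
  simp only [one_div, inv_neg]
  ring

lemma hasDerivAt_zetaW {z : ℂ} (hz : z ∉ L.lattice) : HasDerivAt (zetaW L) (-L.weierstrassP z) z := by
  have hz0 : z ≠ 0 := by rintro rfl; exact hz (zero_mem _)
  have hmem : z ∈ ((L.lattice : Set ℂ) \ {0})ᶜ := fun h => hz h.1
  have h1 : HasDerivAt (zetaReg L) (-L.weierstrassPExcept 0 z) z := by
    rw [← deriv_zetaReg L hmem]
    exact ((differentiableOn_zetaReg L).differentiableAt
      (L.isOpen_compl_lattice_sdiff.mem_nhds hmem)).hasDerivAt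
  have h2 := ((hasDerivAt_id z).fun_inv hz0).fun_add h1
  have h3 := L.weierstrassPExcept_add 0 z
  refine (h2.congr_deriv ?_).congr_of_eventuallyEq (Eventually.of_forall fun x => ?_)
  · rw [← h3]
    simp
    ring
  · rw [zetaW_eq, one_div]
    rfl

lemma hasDerivAt_weierstrassP {z : ℂ} (hz : z ∉ L.lattice) :
    HasDerivAt L.weierstrassP (L.derivWeierstrassP z) z := by
  rw [← L.deriv_weierstrassP]
  exact (L.analyticOnNhd_weierstrassP z hz).differentiableAt.hasDerivAt

lemma continuousAt_zetaReg_zero : ContinuousAt (zetaReg L) 0 :=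
  ((differentiableOn_zetaReg L).differentiableAt
    (L.isOpen_compl_lattice_sdiff.mem_nhds (by simp))).continuousAt

lemma tendsto_zetaW_sub_zero : Tendsto (fun z => zetaW L z - 1 / z) (𝓝[≠] 0) (𝓝 0) := by
  have h := (continuousAt_zetaReg_zero L).tendsto
  have h0 : zetaReg L 0 = 0 := by
    rw [zetaReg]
    convert tsum_zero with v
    split_ifs <;> simp
  rw [h0] at h
  refine (h.mono_left nhdsWithin_le_nhds).congr fun z => ?_
  rw [zetaW_eq]; ring

lemma tendsto_mul_zetaW : Tendsto (fun z => z * zetaW L z) (𝓝[≠] 0) (𝓝 1) := by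
  have h1 : Tendsto (fun z : ℂ => z * (zetaW L z - 1 / z) + 1) (𝓝[≠] 0) (𝓝 (0 * 0 + 1)) :=
    ((tendsto_id.mono_left nhdsWithin_le_nhds).mul (tendsto_zetaW_sub_zero L)).add_const 1
  rw [zero_mul, zero_add] at h1
  refine h1.congr' ?_
  filter_upwards [self_mem_nhdsWithin] with z hz
  have : z ≠ 0 := hz
  field_simp
  ring

lemma tendsto_sq_mul_weierstrassP :
    Tendsto (fun z => z ^ 2 * L.weierstrassP z) (𝓝[≠] 0) (𝓝 1) := by
  have hc : ContinuousAt (fun z => z ^ 2 * L.weierstrassPExcept 0 z + 1) 0 := by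
    have := (L.analyticAt_weierstrassPExcept 0).continuousAt
    fun_prop
  have h := hc.tendsto
  simp only [ne_eq, OfNat.ofNat_ne_zero, not_false_eq_true, zero_pow, zero_mul, zero_add] at h
  refine (h.mono_left nhdsWithin_le_nhds).congr' ?_
  filter_upwards [self_mem_nhdsWithin] with z hz
  have hz : z ≠ 0 := hz
  have h3 := L.weierstrassPExcept_add 0 z
  rw [← h3]
  simp
  field_simp

lemma countable_lattice : (L.lattice : Set ℂ).Countable :=
  countable_of_Lindelof_of_discrete (X := L.lattice)

lemma isConnected_compl_lattice : IsConnected (L.lattice : Set ℂ)ᶜ :=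
  (countable_lattice L).isConnected_compl_of_one_lt_rank (by simp)

lemma isOpen_compl_lattice : IsOpen (L.lattice : Set ℂ)ᶜ := L.isClosed_lattice.isOpen_compl

/-- The derivative of `ζ(z + v) - ζ(z)` vanishes by the periodicity of `℘`, and the complement of
the countable set `Λ` is connected. -/
lemma zetaW_add_sub {z w : ℂ} (hz : z ∉ L.lattice) (hw : w ∉ L.lattice) {v : ℂ} (hv : v ∈ L.lattice) :
    zetaW L (z + v) - zetaW L z = zetaW L (w + v) - zetaW L w := by
  have hd : ∀ x ∈ (L.lattice : Set ℂ)ᶜ, HasDerivAt (fun z => zetaW L (z + v) - zetaW L z) 0 x := by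
    intro x hx
    have hx' : x + v ∉ L.lattice := fun h => hx (by simpa using sub_mem h hv)
    have h1 := (hasDerivAt_zetaW L hx').comp_add_const x v
    refine (h1.sub (hasDerivAt_zetaW L hx)).congr_deriv ?_
    rw [L.weierstrassP_add_coe x ⟨v, hv⟩, sub_self]
  exact (isOpen_compl_lattice L).is_const_of_deriv_eq_zero (isConnected_compl_lattice L).isPreconnected
    (fun x hx => (hd x hx).differentiableAt.differentiableWithinAt) (fun x hx => (hd x hx).deriv) hz hw

end Zeta

/-! ### Liouville's theorem for elliptic functions -/

section Liouville

open PeriodPair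

variable {L : PeriodPair} {f : ℂ → ℂ}

/-- At `x` the function `f` has a removable singularity. -/
def IsRemovableAt (f : ℂ → ℂ) (x : ℂ) : Prop :=
  (∀ᶠ z in 𝓝[≠] x, DifferentiableAt ℂ f z) ∧ ∃ c, Tendsto f (𝓝[≠] x) (𝓝 c)

lemma tendsto_add_nhdsNE (x v : ℂ) : Tendsto (fun z => z + v) (𝓝[≠] x) (𝓝[≠] (x + v)) :=
  tendsto_nhdsWithin_of_tendsto_nhds_of_eventually_within _
    ((continuous_add_const v).tendsto x |>.mono_left nhdsWithin_le_nhds)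
    (by filter_upwards [self_mem_nhdsWithin] with z hz; simpa using hz)

lemma IsRemovableAt.of_differentiableAt {x : ℂ} (h : ∀ᶠ z in 𝓝 x, DifferentiableAt ℂ f z) :
    IsRemovableAt f x :=
  ⟨h.filter_mono nhdsWithin_le_nhds, f x,
    h.self_of_nhds.continuousAt.tendsto.mono_left nhdsWithin_le_nhds⟩

lemma IsRemovableAt.comp_add {x v : ℂ} (h : IsRemovableAt f (x + v)) :
    IsRemovableAt (fun z => f (z + v)) x := by
  obtain ⟨h1, c, hc⟩ := h
  refine ⟨?_, c, hc.comp (tendsto_add_nhdsNE x v)⟩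
  filter_upwards [(tendsto_add_nhdsNE x v).eventually h1] with z hz
  exact DifferentiableAt.fun_comp' z hz (by fun_prop)

lemma IsRemovableAt.comp_neg {x : ℂ} (h : IsRemovableAt f (-x)) :
    IsRemovableAt (fun z => f (-z)) x := by
  obtain ⟨h1, c, hc⟩ := h
  have t : Tendsto (fun z : ℂ => -z) (𝓝[≠] x) (𝓝[≠] (-x)) :=
    tendsto_nhdsWithin_of_tendsto_nhds_of_eventually_within _
      (continuous_neg.tendsto x |>.mono_left nhdsWithin_le_nhds)
      (by filter_upwards [self_mem_nhdsWithin] with z hz; simpa using hz)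
  refine ⟨?_, c, hc.comp t⟩
  filter_upwards [t.eventually h1] with z hz
  exact hz.fun_comp' z (by fun_prop)

lemma IsRemovableAt.congr {g : ℂ → ℂ} {x : ℂ} (h : IsRemovableAt f x)
    (hfg : ∀ᶠ z in 𝓝[≠] x, f z = g z) : IsRemovableAt g x := by
  obtain ⟨h1, c, hc⟩ := h
  refine ⟨?_, c, hc.congr' hfg⟩
  filter_upwards [h1, eventually_eventually_nhdsWithin.mpr hfg, self_mem_nhdsWithin] with z hz hz' hzx
  refine hz.congr_of_eventuallyEq ?_
  rw [(isOpen_compl_singleton (x := x)).nhdsWithin_eq hzx] at hz'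
  exact hz'.mono fun _ h => h.symm

/-- An elliptic function without poles is constant. -/
theorem eq_const_of_removable (hper : ∀ v ∈ L.lattice, ∀ x, ∀ᶠ z in 𝓝[≠] x, f (z + v) = f z)
    (hf : ∀ x, IsRemovableAt f x) :
    ∃ C, (∀ x, Tendsto f (𝓝[≠] x) (𝓝 C)) ∧ ∀ x, ContinuousAt f x → f x = C := by
  -- The values of `f` at its singularities are arbitrary. The function `c` of its limits is entire
  -- and periodic, hence bounded.
  choose hd c hc using hf
  have hcont : ∀ x, ContinuousAt f x → c x = f x := fun x hx =>
    tendsto_nhds_unique (hc x) (hx.tendsto.mono_left nhdsWithin_le_nhds)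
  have hdiff : Differentiable ℂ c := by
    intro x
    set g := Function.update f x (c x)
    have hg : AnalyticAt ℂ g x := by
      refine Complex.analyticAt_of_differentiable_on_punctured_nhds_of_continuousAt ?_
        (continuousAt_update_same.mpr (hc x))
      filter_upwards [hd x, self_mem_nhdsWithin] with z hz hzx
      refine hz.congr_of_eventuallyEq ?_
      filter_upwards [isOpen_ne.mem_nhds hzx] with y hy
      exact Function.update_of_ne hy _ _
    refine hg.differentiableAt.congr_of_eventuallyEq ?_
    have : ∀ᶠ z in 𝓝 x, z ≠ x → DifferentiableAt ℂ f z := by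
      simpa [eventually_nhdsWithin_iff] using hd x
    filter_upwards [this] with z hz
    by_cases hzx : z = x
    · rw [hzx]; simp [g]
    · rw [hcont z (hz hzx).continuousAt]
      exact (Function.update_of_ne hzx _ _).symm
  have hcper : ∀ z w, w ∈ L.lattice → c (z + w) = c z := fun z w hw =>
    tendsto_nhds_unique ((hc (z + w)).comp (tendsto_add_nhdsNE z w))
      ((hc z).congr' ((hper w hw z).mono fun y hy => hy.symm))
  have hconst : ∀ x, c x = c 0 := fun x =>
    hdiff.apply_eq_apply_of_bounded (IsZLattice.isCompact_range_of_periodic L.lattice _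
      hdiff.continuous hcper).isBounded x 0
  exact ⟨c 0, fun x => hconst x ▸ hc x, fun x hx => by rw [← hcont x hx, hconst]⟩

end Liouville

/-! ### Addition formula for `ζ` and shifts of `℘` by half periods -/

section Addition

open PeriodPair

variable {L : PeriodPair}

lemma eventually_add_notMem (L : PeriodPair) (x p : ℂ) : ∀ᶠ z in 𝓝[≠] x, z + p ∉ L.lattice := by
  have h := (tendsto_add_nhdsNE x p).eventually
    (show ∀ᶠ z in 𝓝[≠] (x + p), z ∉ L.lattice by
      filter_upwards [self_mem_nhdsWithin, mem_nhdsWithin_of_mem_nhds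
        (L.compl_lattice_sdiff_singleton_mem_nhds (x + p))] with z hz hz' hzL
      exact hz' ⟨hzL, hz⟩)
  exact h

lemma eventually_notMem (L : PeriodPair) (x : ℂ) : ∀ᶠ z in 𝓝[≠] x, z ∉ L.lattice := by
  simpa using eventually_add_notMem L x 0

lemma eventually_nhds_notMem {x : ℂ} (hx : x ∉ L.lattice) : ∀ᶠ z in 𝓝 x, z ∉ L.lattice :=
  (isOpen_compl_lattice L).mem_nhds hx

/-- Serves to cancel the double pole of `℘` at the origin by a double zero. -/
lemma tendsto_div_sq_of_deriv_eq_zero {U : ℂ → ℂ} (hU : AnalyticAt ℂ U 0) (h0 : U 0 = 0)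
    (h1 : deriv U 0 = 0) : ∃ c, Tendsto (fun z => U z / z ^ 2) (𝓝[≠] 0) (𝓝 c) := by
  have h2 : ((2 : ℕ) : ℕ∞) ≤ analyticOrderAt U 0 := by
    rw [natCast_le_analyticOrderAt_iff_iteratedDeriv_eq_zero hU]
    intro i hi
    interval_cases i
    · simpa using h0
    · simpa using h1
  obtain ⟨g, hg, he⟩ := (natCast_le_analyticOrderAt hU).mp h2
  refine ⟨g 0, (hg.continuousAt.tendsto.mono_left nhdsWithin_le_nhds).congr' ?_⟩
  filter_upwards [nhdsWithin_le_nhds he, self_mem_nhdsWithin] with z hz hz0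
  have : z ≠ 0 := hz0
  rw [hz]
  simp
  field_simp

/-- By the identity theorem `℘` would be constant off the lattice, against its double pole. -/
lemma weierstrassP_not_const {x C : ℂ} (hx : x ∉ L.lattice) :
    ¬ ∀ᶠ z in 𝓝[≠] x, L.weierstrassP z = C := by
  intro h
  have he := L.analyticOnNhd_weierstrassP.eqOn_of_preconnected_of_frequently_eq
    (g := fun _ => C) analyticOnNhd_const (isConnected_compl_lattice L).isPreconnected hx h.frequently
  have h1 : Tendsto (fun z : ℂ => z ^ 2 * C) (𝓝[≠] 0) (𝓝 1) := by
    refine (tendsto_sq_mul_weierstrassP L).congr' ?_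
    filter_upwards [eventually_notMem L 0] with z hz
    rw [he hz]
  have h2 : Tendsto (fun z : ℂ => z ^ 2 * C) (𝓝[≠] 0) (𝓝 (0 ^ 2 * C)) :=
    (Continuous.tendsto (by fun_prop) 0).mono_left nhdsWithin_le_nhds
  have := tendsto_nhds_unique h1 h2
  simp at this

lemma tendsto_sq_mul_weierstrassP_sub (C : ℂ) :
    Tendsto (fun z => z ^ 2 * (L.weierstrassP z - C)) (𝓝[≠] 0) (𝓝 1) := by
  have h2 : Tendsto (fun z : ℂ => z ^ 2 * C) (𝓝[≠] 0) (𝓝 (0 ^ 2 * C)) :=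
    (Continuous.tendsto (by fun_prop) 0).mono_left nhdsWithin_le_nhds
  have := (tendsto_sq_mul_weierstrassP L).sub h2
  simpa [mul_sub] using this

lemma notMem_of_two_mul {p : ℂ} (hp : 2 * p ∉ L.lattice) : p ∉ L.lattice := fun h =>
  hp (by rw [two_mul]; exact add_mem h h)

lemma analyticAt_zetaW {z : ℂ} (hz : z ∉ L.lattice) : AnalyticAt ℂ (zetaW L) z :=
  DifferentiableOn.analyticAt (s := (L.lattice : Set ℂ)ᶜ)
    (fun _ hx => (hasDerivAt_zetaW L hx).differentiableAt.differentiableWithinAt)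
    ((isOpen_compl_lattice L).mem_nhds hz)

lemma differentiableAt_zetaW {z : ℂ} (hz : z ∉ L.lattice) : DifferentiableAt ℂ (zetaW L) z :=
  (hasDerivAt_zetaW L hz).differentiableAt

lemma differentiableAt_weierstrassP {z : ℂ} (hz : z ∉ L.lattice) :
    DifferentiableAt ℂ L.weierstrassP z := (hasDerivAt_weierstrassP L hz).differentiableAt

lemma tendsto_sub_nhdsNE (x : ℂ) : Tendsto (fun z => z - x) (𝓝[≠] x) (𝓝[≠] 0) := by
  simpa [sub_eq_add_neg] using tendsto_add_nhdsNE x (-x)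

lemma periodic_weierstrassP' {v : ℂ} (hv : v ∈ L.lattice) (z : ℂ) :
    L.weierstrassP (z + v) = L.weierstrassP z := L.weierstrassP_add_coe z ⟨v, hv⟩

/-- In the product `U D` the quasi-periods cancel, so it is elliptic. At `0` the even function `U`
has a double zero against the double pole of `D`; at `± p` a simple pole of `U` meets a zero of `D`.
So `U D` is constant, and its limit at `p` is `-℘'(p)`. If `℘'(p)` were zero, `U D` would vanish,
and since `U` has a pole at `p` the function `℘` would be constant near `p`. This shows `℘'(p) ≠ 0`
without counting zeros. -/
lemma zetaW_sub_mul_aux {p : ℂ} (hp : 2 * p ∉ L.lattice) : L.derivWeierstrassP p ≠ 0 ∧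
    ∀ z, z ∉ L.lattice → z + p ∉ L.lattice → z - p ∉ L.lattice →
      (zetaW L (z + p) - zetaW L (z - p) - 2 * zetaW L p) * (L.weierstrassP z - L.weierstrassP p) =
        -L.derivWeierstrassP p := by
  have hp1 := notMem_of_two_mul hp
  set U : ℂ → ℂ := fun z => zetaW L (z + p) - zetaW L (z - p) - 2 * zetaW L p with hU
  set D : ℂ → ℂ := fun z => L.weierstrassP z - L.weierstrassP p with hD
  have hgen : ∀ x, ∀ᶠ z in 𝓝[≠] x, z ∉ L.lattice ∧ z + p ∉ L.lattice ∧ z - p ∉ L.lattice := fun x =>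
    (eventually_notMem L x).and ((eventually_add_notMem L x p).and
      (by simpa [sub_eq_add_neg] using eventually_add_notMem L x (-p)))
  have hdiff : ∀ z, z ∉ L.lattice → z + p ∉ L.lattice → z - p ∉ L.lattice →
      DifferentiableAt ℂ (fun z => U z * D z) z := fun z h1 h2 h3 => by
    have a := DifferentiableAt.fun_comp' (f := fun z => z + p) z (differentiableAt_zetaW h2) (by fun_prop)
    have b := DifferentiableAt.fun_comp' (f := fun z => z - p) z (differentiableAt_zetaW h3) (by fun_prop)
    have c := differentiableAt_weierstrassP h1
    exact ((a.sub b).sub_const _).mul (c.sub_const _)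
  have hper : ∀ v ∈ L.lattice, ∀ x, ∀ᶠ z in 𝓝[≠] x, U (z + v) * D (z + v) = U z * D z := by
    intro v hv x
    filter_upwards [hgen x] with z hz
    have h := zetaW_add_sub L hz.2.1 hz.2.2 hv
    have e1 : z + v + p = z + p + v := by ring
    have e2 : z + v - p = z - p + v := by ring
    simp only [hU, hD, periodic_weierstrassP' hv, e1, e2]
    linear_combination (L.weierstrassP z - L.weierstrassP p) * h
  have heven : ∀ z, U (-z) * D (-z) = U z * D z := by
    intro z
    simp only [hU, hD, L.weierstrassP_neg]
    rw [show -z + p = -(z - p) by ring, show -z - p = -(z + p) by ring, zetaW_neg, zetaW_neg]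
    ring
  have hUp : Tendsto (fun z => (z - p) * U z) (𝓝[≠] p) (𝓝 (-1)) := by
    have h1 : Tendsto (fun z => (z - p) * (zetaW L (z + p) - 2 * zetaW L p)) (𝓝[≠] p)
        (𝓝 ((p - p) * (zetaW L (p + p) - 2 * zetaW L p))) := by
      refine ContinuousAt.tendsto ?_ |>.mono_left nhdsWithin_le_nhds
      have : ContinuousAt (zetaW L) (p + p) :=
        (differentiableAt_zetaW (by rwa [← two_mul])).continuousAt
      have := ContinuousAt.comp' (f := fun z => z + p) this (by fun_prop)
      exact (by fun_prop : ContinuousAt (fun z => z - p) p).mul (this.sub continuousAt_const)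
    have h2 := (tendsto_mul_zetaW L).comp (tendsto_sub_nhdsNE p)
    have h3 := h1.sub h2
    rw [sub_self, zero_mul, zero_sub] at h3
    refine h3.congr fun z => ?_
    simp only [hU, Function.comp_apply]
    ring
  have hDp : Tendsto (fun z => D z / (z - p)) (𝓝[≠] p) (𝓝 (L.derivWeierstrassP p)) := by
    refine (hasDerivAt_weierstrassP L hp1).tendsto_slope.congr fun z => ?_
    simp [slope, hD, div_eq_inv_mul]
  have hfp : Tendsto (fun z => U z * D z) (𝓝[≠] p) (𝓝 (-L.derivWeierstrassP p)) := by
    have := hUp.mul hDp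
    rw [neg_one_mul] at this
    refine this.congr' ?_
    filter_upwards [self_mem_nhdsWithin] with z hz
    have : z - p ≠ 0 := sub_ne_zero.mpr hz
    field_simp
  have hrem0 : IsRemovableAt (fun z => U z * D z) 0 := by
    refine ⟨(hgen 0).mono fun z hz => hdiff z hz.1 hz.2.1 hz.2.2, ?_⟩
    have hnp : -p ∉ L.lattice := by simpa using hp1
    have hd : HasDerivAt U (-L.weierstrassP p - -L.weierstrassP (-p)) 0 := by
      have a : HasDerivAt (fun z => zetaW L (z + p)) (-L.weierstrassP p) 0 := by
        refine HasDerivAt.comp_add_const 0 p ?_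
        rw [zero_add]; exact hasDerivAt_zetaW L hp1
      have b : HasDerivAt (fun z => zetaW L (z - p)) (-L.weierstrassP (-p)) 0 := by
        refine HasDerivAt.comp_sub_const 0 p ?_
        rw [zero_sub]; exact hasDerivAt_zetaW L hnp
      exact (a.sub b).sub_const _
    have han : AnalyticAt ℂ U 0 := by
      have a : AnalyticAt ℂ (fun z => zetaW L (z + p)) 0 :=
        AnalyticAt.fun_comp (f := fun z => z + p) (by rw [zero_add]; exact analyticAt_zetaW hp1) (by fun_prop)
      have b : AnalyticAt ℂ (fun z => zetaW L (z - p)) 0 :=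
        AnalyticAt.fun_comp (f := fun z => z - p) (by rw [zero_sub]; exact analyticAt_zetaW hnp) (by fun_prop)
      exact (a.sub b).sub analyticAt_const
    obtain ⟨c, hc⟩ := tendsto_div_sq_of_deriv_eq_zero han
      (by simp only [hU]; rw [zero_add, zero_sub, zetaW_neg]; ring)
      (by rw [hd.deriv, L.weierstrassP_neg]; ring)
    refine ⟨c * 1, (hc.mul (tendsto_sq_mul_weierstrassP_sub (L := L) (L.weierstrassP p))).congr' ?_⟩
    filter_upwards [self_mem_nhdsWithin] with z hz
    have : z ≠ 0 := hz
    simp only [hD]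
    field_simp
  have hremp : IsRemovableAt (fun z => U z * D z) p :=
    ⟨(hgen p).mono fun z hz => hdiff z hz.1 hz.2.1 hz.2.2, _, hfp⟩
  have htrans : ∀ x y, x - y ∈ L.lattice → IsRemovableAt (fun z => U z * D z) y →
      IsRemovableAt (fun z => U z * D z) x := by
    intro x y hxy hy
    have h1 : IsRemovableAt (fun z => U z * D z) (x + (y - x)) := by rwa [add_sub_cancel]
    exact h1.comp_add.congr (hper _ (by simpa using neg_mem hxy) x)
  have hrem : ∀ x, IsRemovableAt (fun z => U z * D z) x := by
    intro x
    by_cases h1 : x ∈ L.lattice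
    · exact htrans x 0 (by simpa using h1) hrem0
    by_cases h2 : x - p ∈ L.lattice
    · exact htrans x p h2 hremp
    by_cases h3 : x + p ∈ L.lattice
    · refine htrans x (-p) (by simpa using h3) ?_
      have : IsRemovableAt (fun z => U z * D z) (- -p) := by rwa [neg_neg]
      exact this.comp_neg.congr (Eventually.of_forall heven)
    · refine .of_differentiableAt ?_
      have e2 := (continuous_add_const p).continuousAt.eventually (eventually_nhds_notMem h3)
      have e3 := (continuous_sub_right p).continuousAt.eventually (eventually_nhds_notMem h2)
      filter_upwards [eventually_nhds_notMem h1, e2, e3] with z a b c using hdiff z a b c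
  obtain ⟨C, hC, hC'⟩ := eq_const_of_removable hper hrem
  have hCp : C = -L.derivWeierstrassP p := tendsto_nhds_unique (hC p) hfp
  have key : ∀ z, z ∉ L.lattice → z + p ∉ L.lattice → z - p ∉ L.lattice →
      U z * D z = -L.derivWeierstrassP p := fun z h1 h2 h3 => by
    rw [← hCp]; exact hC' z (hdiff z h1 h2 h3).continuousAt
  refine ⟨fun h0 => weierstrassP_not_const (C := L.weierstrassP p) hp1 ?_, key⟩
  filter_upwards [hgen p, hUp.eventually_ne (by norm_num : (-1 : ℂ) ≠ 0)] with z hz hz'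
  have := key z hz.1 hz.2.1 hz.2.2
  rw [h0, neg_zero] at this
  exact sub_eq_zero.mp ((mul_eq_zero.mp this).resolve_left fun h => hz' (by rw [h, mul_zero]))

lemma derivWeierstrassP_ne_zero {p : ℂ} (hp : 2 * p ∉ L.lattice) : L.derivWeierstrassP p ≠ 0 :=
  (zetaW_sub_mul_aux hp).1

lemma weierstrassP_sub_ne_zero {p z : ℂ} (hp : 2 * p ∉ L.lattice) (h1 : z ∉ L.lattice)
    (h2 : z + p ∉ L.lattice) (h3 : z - p ∉ L.lattice) : L.weierstrassP z - L.weierstrassP p ≠ 0 := by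
  intro h
  have := (zetaW_sub_mul_aux hp).2 z h1 h2 h3
  rw [h, mul_zero] at this
  exact derivWeierstrassP_ne_zero hp (by simpa using this.symm)

/-- Addition formula for `ζ`. -/
theorem zetaW_add_sub_zetaW_sub {p z : ℂ} (hp : 2 * p ∉ L.lattice) (h1 : z ∉ L.lattice)
    (h2 : z + p ∉ L.lattice) (h3 : z - p ∉ L.lattice) :
    zetaW L (z + p) - zetaW L (z - p) =
      2 * zetaW L p - L.derivWeierstrassP p / (L.weierstrassP z - L.weierstrassP p) := by
  have hD := weierstrassP_sub_ne_zero hp h1 h2 h3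
  have := (zetaW_sub_mul_aux hp).2 z h1 h2 h3
  field_simp
  linear_combination this

/-- `℘'` is odd and periodic, so `℘'(c) = ℘'(-c) = -℘'(c)`. -/
lemma derivWeierstrassP_half {c : ℂ} (hc : 2 * c ∈ L.lattice) : L.derivWeierstrassP c = 0 := by
  have h1 := L.derivWeierstrassP_add_coe (-c) ⟨_, hc⟩
  have h2 : -c + 2 * c = c := by ring
  simp only [h2, L.derivWeierstrassP_neg] at h1
  linear_combination h1 / 2

/-- Because `℘'(c) = 0`, the first factor has a double zero at `0`, which cancels the double pole of
the second. The shift by `c` exchanges the factors and so reduces the poles of the first factor to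
those of the second. If the constant were `0`, `℘` would be constant near `c`. -/
theorem weierstrassP_half_mul {c : ℂ} (hc : c ∉ L.lattice) (hc2 : 2 * c ∈ L.lattice) :
    ∃ K : ℂ, K ≠ 0 ∧ ∀ z, z ∉ L.lattice → z + c ∉ L.lattice →
      (L.weierstrassP (z + c) - L.weierstrassP c) * (L.weierstrassP z - L.weierstrassP c) = K := by
  set U : ℂ → ℂ := fun z => L.weierstrassP (z + c) - L.weierstrassP c with hU
  set D : ℂ → ℂ := fun z => L.weierstrassP z - L.weierstrassP c with hD
  have hgen : ∀ x, ∀ᶠ z in 𝓝[≠] x, z ∉ L.lattice ∧ z + c ∉ L.lattice := fun x =>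
    (eventually_notMem L x).and (eventually_add_notMem L x c)
  have hdiff : ∀ z, z ∉ L.lattice → z + c ∉ L.lattice →
      DifferentiableAt ℂ (fun z => U z * D z) z := fun z h1 h2 => by
    have a := DifferentiableAt.fun_comp' (f := fun z => z + c) z (differentiableAt_weierstrassP h2)
      (by fun_prop)
    exact (a.sub_const _).mul ((differentiableAt_weierstrassP h1).sub_const _)
  have hper : ∀ v ∈ L.lattice, ∀ z, U (z + v) * D (z + v) = U z * D z := by
    intro v hv z
    simp only [hU, hD, periodic_weierstrassP' hv, show z + v + c = z + c + v by ring]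
  have hshift : ∀ z, U (z + c) * D (z + c) = U z * D z := by
    intro z
    simp only [hU, hD, show z + c + c = z + 2 * c by ring, periodic_weierstrassP' hc2]
    ring
  have hrem0 : IsRemovableAt (fun z => U z * D z) 0 := by
    refine ⟨(hgen 0).mono fun z hz => hdiff z hz.1 hz.2, ?_⟩
    have hd : HasDerivAt U (L.derivWeierstrassP c) 0 := by
      refine (HasDerivAt.comp_add_const 0 c ?_).sub_const _
      rw [zero_add]; exact hasDerivAt_weierstrassP L hc
    have han : AnalyticAt ℂ U 0 :=
      (AnalyticAt.fun_comp (f := fun z => z + c)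
        (by rw [zero_add]; exact L.analyticOnNhd_weierstrassP c hc) (by fun_prop)).sub analyticAt_const
    obtain ⟨k, hk⟩ := tendsto_div_sq_of_deriv_eq_zero han
      (by simp only [hU]; rw [zero_add, sub_self]) (by rw [hd.deriv, derivWeierstrassP_half hc2])
    refine ⟨k * 1, (hk.mul (tendsto_sq_mul_weierstrassP_sub (L := L) (L.weierstrassP c))).congr' ?_⟩
    filter_upwards [self_mem_nhdsWithin] with z hz
    have : z ≠ 0 := hz
    simp only [hD]
    field_simp
  have htrans : ∀ x, x ∈ L.lattice → IsRemovableAt (fun z => U z * D z) x := by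
    intro x hx
    have h1 : IsRemovableAt (fun z => U z * D z) (x + -x) := by rwa [add_neg_cancel]
    exact h1.comp_add.congr (Eventually.of_forall (hper _ (neg_mem hx)))
  have hrem : ∀ x, IsRemovableAt (fun z => U z * D z) x := by
    intro x
    by_cases h1 : x ∈ L.lattice
    · exact htrans x h1
    by_cases h2 : x + c ∈ L.lattice
    · exact (htrans _ h2).comp_add.congr (Eventually.of_forall hshift)
    · refine .of_differentiableAt ?_
      have e2 := (continuous_add_const c).continuousAt.eventually (eventually_nhds_notMem h2)
      filter_upwards [eventually_nhds_notMem h1, e2] with z a b using hdiff z a b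
  obtain ⟨C, hC, hC'⟩ := eq_const_of_removable (fun v hv x => Eventually.of_forall (hper v hv)) hrem
  refine ⟨C, fun h0 => weierstrassP_not_const (C := L.weierstrassP c) hc ?_,
    fun z h1 h2 => hC' z (hdiff z h1 h2).continuousAt⟩
  have ht : Tendsto (fun z => z - c) (𝓝[≠] c) (𝓝[≠] 0) := tendsto_sub_nhdsNE c
  filter_upwards [ht.eventually ((tendsto_sq_mul_weierstrassP_sub
    (L.weierstrassP c)).eventually_ne one_ne_zero), ht.eventually (hgen 0)] with z hz hz'
  have := hC' (z - c) (hdiff _ hz'.1 hz'.2).continuousAt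
  rw [h0] at this
  have h3 := (mul_eq_zero.mp this).resolve_right fun h => hz (by simp only [hD] at h; rw [h, mul_zero])
  simp only [hU, sub_add_cancel] at h3
  exact sub_eq_zero.mp h3

lemma weierstrassP_half_ne {c z : ℂ} (hc : c ∉ L.lattice) (hc2 : 2 * c ∈ L.lattice)
    (h1 : z ∉ L.lattice) (h2 : z + c ∉ L.lattice) : L.weierstrassP z ≠ L.weierstrassP c := by
  obtain ⟨K, hK, h⟩ := weierstrassP_half_mul hc hc2
  intro e
  refine hK ?_
  rw [← h z h1 h2, e, sub_self, mul_zero]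

end Addition

/-! ### Addition and duplication formulas for `℘` -/

section Cubic

open PeriodPair

variable {L : PeriodPair}

/-- `℘'' = Q'(℘) / 2` if `℘'² = Q(℘)`. -/
lemma hasDerivAt_derivWeierstrassP {p : ℂ} (hp : 2 * p ∉ L.lattice) :
    HasDerivAt L.derivWeierstrassP (6 * L.weierstrassP p ^ 2 - L.g₂ / 2) p := by
  have hp1 := notMem_of_two_mul hp
  have h0 := derivWeierstrassP_ne_zero hp
  have hd : HasDerivAt L.derivWeierstrassP (deriv L.derivWeierstrassP p) p :=
    (L.analyticOnNhd_derivWeierstrassP p hp1).differentiableAt.hasDerivAt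
  have hP := hasDerivAt_weierstrassP L hp1
  have h1 : HasDerivAt (fun z => L.derivWeierstrassP z ^ 2)
      (2 * L.derivWeierstrassP p * deriv L.derivWeierstrassP p) p := by
    simpa using hd.fun_pow 2
  have h2 : HasDerivAt (fun z => 4 * L.weierstrassP z ^ 3 - L.g₂ * L.weierstrassP z - L.g₃)
      (4 * (3 * L.weierstrassP p ^ 2 * L.derivWeierstrassP p) - L.g₂ * L.derivWeierstrassP p) p := by
    simpa using (((hP.fun_pow 3).const_mul 4).fun_sub (hP.const_mul L.g₂)).sub_const L.g₃
  have h3 := h1.unique (h2.congr_of_eventuallyEq (by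
    filter_upwards [eventually_nhds_notMem hp1] with z hz using L.derivWeierstrassP_sq z hz))
  have h4 : deriv L.derivWeierstrassP p = 6 * L.weierstrassP p ^ 2 - L.g₂ / 2 := by
    apply mul_left_cancel₀ (mul_ne_zero two_ne_zero h0)
    linear_combination h3
  rwa [h4] at hd

/-- Addition formula for `℘`. -/
theorem weierstrassP_add_add_weierstrassP_sub {p z : ℂ} (hp : 2 * p ∉ L.lattice)
    (h1 : z ∉ L.lattice) (h2 : z + p ∉ L.lattice) (h3 : z - p ∉ L.lattice) :
    L.weierstrassP (z + p) + L.weierstrassP (z - p) = 2 * L.weierstrassP p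
      + (6 * L.weierstrassP p ^ 2 - L.g₂ / 2) / (L.weierstrassP z - L.weierstrassP p)
      + L.derivWeierstrassP p ^ 2 / (L.weierstrassP z - L.weierstrassP p) ^ 2 := by
  have hp1 := notMem_of_two_mul hp
  have hD := weierstrassP_sub_ne_zero hp h1 h2 h3
  -- The formula is the derivative in `p`, at fixed `z`, of the addition formula for `ζ`.
  have hl : HasDerivAt (fun q => zetaW L (z + q) - zetaW L (z - q))
      (-L.weierstrassP (z + p) - -(-L.weierstrassP (z - p))) p := by
    have a := HasDerivAt.comp_const_add z p (hasDerivAt_zetaW L h2)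
    have b := HasDerivAt.comp_const_sub z p (hasDerivAt_zetaW L h3)
    exact a.sub b
  have hr : HasDerivAt (fun q => 2 * zetaW L q - L.derivWeierstrassP q /
      (L.weierstrassP z - L.weierstrassP q)) (2 * -L.weierstrassP p -
        ((6 * L.weierstrassP p ^ 2 - L.g₂ / 2) * (L.weierstrassP z - L.weierstrassP p)
          - L.derivWeierstrassP p * -L.derivWeierstrassP p) /
            (L.weierstrassP z - L.weierstrassP p) ^ 2) p :=
    ((hasDerivAt_zetaW L hp1).const_mul 2).fun_sub ((hasDerivAt_derivWeierstrassP hp).fun_div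
      ((hasDerivAt_weierstrassP L hp1).const_sub _) hD)
  have e1 : ∀ᶠ q in 𝓝 p, 2 * q ∉ L.lattice :=
    (continuous_const_mul (2 : ℂ)).continuousAt.eventually (eventually_nhds_notMem hp)
  have e2 : ∀ᶠ q in 𝓝 p, z + q ∉ L.lattice :=
    (continuous_const_add z).continuousAt.eventually (eventually_nhds_notMem h2)
  have e3 : ∀ᶠ q in 𝓝 p, z - q ∉ L.lattice :=
    (continuous_sub_left z).continuousAt.eventually (eventually_nhds_notMem h3)
  have := hl.unique (hr.congr_of_eventuallyEq (by
    filter_upwards [e1, e2, e3] with q a b c using zetaW_add_sub_zetaW_sub a h1 b c))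
  field_simp at this ⊢
  linear_combination -this

/-- Sum of the two forms of `zetaW_add_sub_zetaW_sub` in which `p` and `z` exchange their roles. -/
lemma zetaW_add {p z : ℂ} (hp : 2 * p ∉ L.lattice) (hz : 2 * z ∉ L.lattice)
    (h2 : z + p ∉ L.lattice) (h3 : z - p ∉ L.lattice) :
    2 * zetaW L (z + p) = 2 * zetaW L z + 2 * zetaW L p +
      (L.derivWeierstrassP z - L.derivWeierstrassP p) / (L.weierstrassP z - L.weierstrassP p) := by
  have a := zetaW_add_sub_zetaW_sub hp (notMem_of_two_mul hz) h2 h3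
  have b := zetaW_add_sub_zetaW_sub hz (notMem_of_two_mul hp) (by rwa [add_comm])
    (by rw [← neg_sub, neg_mem_iff]; exact h3)
  have hD := weierstrassP_sub_ne_zero hp (notMem_of_two_mul hz) h2 h3
  rw [← neg_sub z p, zetaW_neg, add_comm p z, ← neg_sub (L.weierstrassP z), div_neg] at b
  rw [sub_div]
  linear_combination a + b

/-- The limit of `zetaW_add` as `z → p`: the quotient of differences, being a quotient of slopes,
tends to `℘''(p) / ℘'(p)`. -/
theorem zetaW_two_mul {p : ℂ} (hp : 2 * p ∉ L.lattice) :
    zetaW L (2 * p) = 2 * zetaW L p +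
      (6 * L.weierstrassP p ^ 2 - L.g₂ / 2) / (2 * L.derivWeierstrassP p) := by
  have hp1 := notMem_of_two_mul hp
  have h0 := derivWeierstrassP_ne_zero hp
  have l1 : Tendsto (fun z => 2 * zetaW L (z + p)) (𝓝[≠] p) (𝓝 (2 * zetaW L (2 * p))) := by
    have : ContinuousAt (fun z => 2 * zetaW L (z + p)) p := by
      refine continuousAt_const.mul (ContinuousAt.comp' (f := fun z => z + p) ?_ (by fun_prop))
      rw [← two_mul]
      exact (differentiableAt_zetaW hp).continuousAt
    have := this.tendsto.mono_left (nhdsWithin_le_nhds (s := {p}ᶜ))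
    rwa [← two_mul] at this
  have l2 : Tendsto (fun z => 2 * zetaW L z + 2 * zetaW L p +
      slope L.derivWeierstrassP p z / slope L.weierstrassP p z) (𝓝[≠] p)
      (𝓝 (2 * zetaW L p + 2 * zetaW L p +
        (6 * L.weierstrassP p ^ 2 - L.g₂ / 2) / L.derivWeierstrassP p)) := by
    refine Tendsto.add (Tendsto.add_const _ (Tendsto.const_mul _
      ((differentiableAt_zetaW hp1).continuousAt.tendsto.mono_left nhdsWithin_le_nhds))) ?_
    exact (hasDerivAt_derivWeierstrassP hp).tendsto_slope.div
      (hasDerivAt_weierstrassP L hp1).tendsto_slope h0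
  have e1 : ∀ᶠ q in 𝓝[≠] p, 2 * q ∉ L.lattice := nhdsWithin_le_nhds
    ((continuous_const_mul (2 : ℂ)).continuousAt.eventually (eventually_nhds_notMem hp))
  have e2 : ∀ᶠ q in 𝓝[≠] p, q + p ∉ L.lattice := eventually_add_notMem L p p
  have e3 : ∀ᶠ q in 𝓝[≠] p, q - p ∉ L.lattice := by
    simpa [sub_eq_add_neg] using eventually_add_notMem L p (-p)
  have := tendsto_nhds_unique (l1.congr' (by
    filter_upwards [e1, e2, e3, self_mem_nhdsWithin] with z a b c hz
    have hz' : z - p ≠ 0 := sub_ne_zero.mpr hz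
    rw [zetaW_add hp a b c]
    simp only [slope, vsub_eq_sub, smul_eq_mul]
    rw [mul_div_mul_left _ _ (inv_ne_zero hz')])) l2
  field_simp at this ⊢
  linear_combination this

/-- The derivative of `zetaW_two_mul` in `p`. -/
theorem weierstrassP_two_mul {p : ℂ} (hp : 2 * p ∉ L.lattice) :
    L.weierstrassP (2 * p) = -2 * L.weierstrassP p +
      ((6 * L.weierstrassP p ^ 2 - L.g₂ / 2) / L.derivWeierstrassP p) ^ 2 / 4 := by
  have hp1 := notMem_of_two_mul hp
  have h0 := derivWeierstrassP_ne_zero hp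
  have hP := hasDerivAt_weierstrassP L hp1
  have hl : HasDerivAt (fun q => zetaW L (2 * q)) (-L.weierstrassP (2 * p) * 2) p := by
    have := (hasDerivAt_zetaW L hp).comp p ((hasDerivAt_id p).const_mul 2)
    simpa [Function.comp_def] using this
  have hr : HasDerivAt (fun q => 2 * zetaW L q + (6 * L.weierstrassP q ^ 2 - L.g₂ / 2) /
      (2 * L.derivWeierstrassP q)) (2 * -L.weierstrassP p +
        ((6 * (2 * L.weierstrassP p * L.derivWeierstrassP p)) * (2 * L.derivWeierstrassP p) -
          (6 * L.weierstrassP p ^ 2 - L.g₂ / 2) * (2 * (6 * L.weierstrassP p ^ 2 - L.g₂ / 2))) /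
            (2 * L.derivWeierstrassP p) ^ 2) p := by
    refine ((hasDerivAt_zetaW L hp1).const_mul 2).fun_add (HasDerivAt.fun_div ?_
      ((hasDerivAt_derivWeierstrassP hp).const_mul 2) (mul_ne_zero two_ne_zero h0))
    simpa using ((hP.fun_pow 2).const_mul 6).sub_const (L.g₂ / 2)
  have e1 : ∀ᶠ q in 𝓝 p, 2 * q ∉ L.lattice :=
    (continuous_const_mul (2 : ℂ)).continuousAt.eventually (eventually_nhds_notMem hp)
  have := hl.unique (hr.congr_of_eventuallyEq (by
    filter_upwards [e1] with q a using zetaW_two_mul a))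
  field_simp at this ⊢
  linear_combination -this

end Cubic

/-! ### Coordinates on the torus, half periods and the roots of the cubic -/

section Torus

open PeriodPair

variable {τ : UpperHalfPlane}

lemma mem_lattice_iff {z : ℂ} : z ∈ (periods τ).lattice ↔ ∃ m n : ℤ, (m : ℂ) + n * (τ : ℂ) = z := by
  rw [PeriodPair.mem_lattice]
  simp [periods]

/-- The coordinate of `z` along `τ` in the real basis `1, τ`. -/
def coordY (τ : UpperHalfPlane) (z : ℂ) : ℝ := z.im / τ.im

/-- The coordinate of `z` along `1` in the real basis `1, τ`. -/
def coordX (τ : UpperHalfPlane) (z : ℂ) : ℝ := z.re - coordY τ z * τ.re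

lemma coord_eq (z : ℂ) : z = (coordX τ z : ℂ) + coordY τ z * (τ : ℂ) := by
  have := τ.im_pos.ne'
  apply Complex.ext <;> simp [coordX, coordY]
  field_simp

lemma coordY_mk (a b : ℝ) : coordY τ ((a : ℂ) + b * (τ : ℂ)) = b := by
  have := τ.im_pos.ne'
  simp [coordY, this]

lemma coordX_mk (a b : ℝ) : coordX τ ((a : ℂ) + b * (τ : ℂ)) = a := by
  rw [coordX, coordY_mk]
  simp

lemma coordY_add (z w : ℂ) : coordY τ (z + w) = coordY τ z + coordY τ w := by
  simp [coordY, add_div]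

lemma coordX_add (z w : ℂ) : coordX τ (z + w) = coordX τ z + coordX τ w := by
  simp [coordX, coordY_add]; ring

lemma coordY_neg (z : ℂ) : coordY τ (-z) = -coordY τ z := by simp [coordY, neg_div]

lemma coordX_neg (z : ℂ) : coordX τ (-z) = -coordX τ z := by simp [coordX, coordY_neg]; ring

lemma coordY_sub (z w : ℂ) : coordY τ (z - w) = coordY τ z - coordY τ w := by
  simp [sub_eq_add_neg, coordY_add, coordY_neg]

lemma coordX_sub (z w : ℂ) : coordX τ (z - w) = coordX τ z - coordX τ w := by
  simp [sub_eq_add_neg, coordX_add, coordX_neg]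

lemma coordY_smul (r : ℝ) (z : ℂ) : coordY τ (r * z) = r * coordY τ z := by
  simp [coordY, mul_div_assoc]

lemma coordX_smul (r : ℝ) (z : ℂ) : coordX τ (r * z) = r * coordX τ z := by
  simp [coordX, coordY_smul]; ring

lemma mem_lattice_iff_coord {z : ℂ} :
    z ∈ (periods τ).lattice ↔ (∃ m : ℤ, coordX τ z = m) ∧ ∃ n : ℤ, coordY τ z = n := by
  rw [mem_lattice_iff]
  constructor
  · rintro ⟨m, n, rfl⟩
    have h := coordX_mk (τ := τ) m n
    have h' := coordY_mk (τ := τ) m n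
    push_cast at h h'
    exact ⟨⟨m, h⟩, ⟨n, h'⟩⟩
  · rintro ⟨⟨m, hm⟩, n, hn⟩
    exact ⟨m, n, by rw [coord_eq (τ := τ) z, hm, hn]; push_cast; rfl⟩

lemma half_add_half_notMem {a b : ℤ} (h : ¬(Even a ∧ Even b)) :
    ((a : ℂ) + b * (τ : ℂ)) / 2 ∉ (periods τ).lattice := by
  rw [mem_lattice_iff_coord]
  have e : ((a : ℂ) + b * (τ : ℂ)) / 2 = ((a / 2 : ℝ) : ℂ) + ((b / 2 : ℝ) : ℂ) * (τ : ℂ) := by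
    push_cast; ring
  rw [e, coordX_mk, coordY_mk]
  rintro ⟨⟨m, hm⟩, n, hn⟩
  refine h ⟨⟨m, ?_⟩, ⟨n, ?_⟩⟩
  · have : (a : ℝ) = m + m := by linarith
    exact_mod_cast this
  · have : (b : ℝ) = n + n := by linarith
    exact_mod_cast this

lemma two_mul_notMem_of_notMem_twoTorsion {p : ℂ} (hp : p ∉ twoTorsion τ) :
    2 * p ∉ (periods τ).lattice := by
  intro h
  obtain ⟨a, b, hab⟩ := mem_lattice_iff.mp h
  have hp' : p = ((a : ℂ) + b * (τ : ℂ)) / 2 := by rw [hab]; ring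
  apply hp
  rcases Int.even_or_odd' a with ⟨m, rfl | rfl⟩ <;> rcases Int.even_or_odd' b with ⟨n, rfl | rfl⟩
  · exact ⟨0, mem_lattice_iff.mpr ⟨m, n, by rw [hp']; simp [omega]; ring⟩⟩
  · exact ⟨2, mem_lattice_iff.mpr ⟨m, n, by rw [hp']; simp [omega]; ring⟩⟩
  · exact ⟨1, mem_lattice_iff.mpr ⟨m, n, by rw [hp']; simp [omega]; ring⟩⟩
  · exact ⟨3, mem_lattice_iff.mpr ⟨m, n, by rw [hp']; simp [omega]; ring⟩⟩

lemma one_mem_lattice : (1 : ℂ) ∈ (periods τ).lattice := mem_lattice_iff.mpr ⟨1, 0, by simp⟩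

lemma tau_mem_lattice : (τ : ℂ) ∈ (periods τ).lattice := mem_lattice_iff.mpr ⟨0, 1, by simp⟩

lemma two_mul_omega_half_mem (k : Fin 4) : 2 * (omega τ k / 2) ∈ (periods τ).lattice := by
  rw [mul_div_cancel₀ _ two_ne_zero]
  fin_cases k
  · exact zero_mem _
  · exact one_mem_lattice
  · exact tau_mem_lattice
  · exact add_mem one_mem_lattice tau_mem_lattice

lemma half_one_notMem : (1 : ℂ) / 2 ∉ (periods τ).lattice := by
  simpa using half_add_half_notMem (τ := τ) (a := 1) (b := 0) (by simp)

lemma half_tau_notMem : (τ : ℂ) / 2 ∉ (periods τ).lattice := by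
  simpa using half_add_half_notMem (τ := τ) (a := 0) (b := 1) (by simp)

lemma half_one_add_tau_notMem : (1 + (τ : ℂ)) / 2 ∉ (periods τ).lattice := by
  simpa using half_add_half_notMem (τ := τ) (a := 1) (b := 1) (by simp)

lemma two_mul_half_mem {v : ℂ} (hv : v ∈ (periods τ).lattice) : 2 * (v / 2) ∈ (periods τ).lattice := by
  rwa [mul_div_cancel₀ _ two_ne_zero]

/-- The constant of `weierstrassP_half_mul` is read off at the half period `τ / 2`; the next two
lemmas do the same at `1 / 2`. -/
lemma half_one_mul {z : ℂ} (h1 : z ∉ (periods τ).lattice) (h2 : z + 1 / 2 ∉ (periods τ).lattice) :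
    (wp τ (z + 1 / 2) - e τ 1) * (wp τ z - e τ 1) = (e τ 3 - e τ 1) * (e τ 2 - e τ 1) := by
  obtain ⟨K, _, hK⟩ := weierstrassP_half_mul (L := periods τ) half_one_notMem
    (two_mul_half_mem one_mem_lattice)
  have := hK ((τ : ℂ) / 2) half_tau_notMem (by
    rw [show (τ : ℂ) / 2 + 1 / 2 = (1 + τ) / 2 by ring]; exact half_one_add_tau_notMem)
  rw [show (τ : ℂ) / 2 + 1 / 2 = (1 + τ) / 2 by ring] at this
  exact (hK z h1 h2).trans this.symm

lemma half_tau_mul {z : ℂ} (h1 : z ∉ (periods τ).lattice)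
    (h2 : z + (τ : ℂ) / 2 ∉ (periods τ).lattice) :
    (wp τ (z + (τ : ℂ) / 2) - e τ 2) * (wp τ z - e τ 2) = (e τ 3 - e τ 2) * (e τ 1 - e τ 2) := by
  obtain ⟨K, _, hK⟩ := weierstrassP_half_mul (L := periods τ) half_tau_notMem
    (two_mul_half_mem tau_mem_lattice)
  have := hK (1 / 2) half_one_notMem (by
    rw [show 1 / 2 + (τ : ℂ) / 2 = (1 + τ) / 2 by ring]; exact half_one_add_tau_notMem)
  rw [show 1 / 2 + (τ : ℂ) / 2 = (1 + τ) / 2 by ring] at this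
  exact (hK z h1 h2).trans this.symm

lemma half_one_add_tau_mul {z : ℂ} (h1 : z ∉ (periods τ).lattice)
    (h2 : z + (1 + (τ : ℂ)) / 2 ∉ (periods τ).lattice) :
    (wp τ (z + (1 + (τ : ℂ)) / 2) - e τ 3) * (wp τ z - e τ 3) =
      (e τ 2 - e τ 3) * (e τ 1 - e τ 3) := by
  obtain ⟨K, _, hK⟩ := weierstrassP_half_mul (L := periods τ) half_one_add_tau_notMem
    (two_mul_half_mem (add_mem one_mem_lattice tau_mem_lattice))
  have := hK (1 / 2) half_one_notMem (by
    rw [show 1 / 2 + (1 + (τ : ℂ)) / 2 = τ / 2 + 1 by ring]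
    intro h
    exact half_tau_notMem (by simpa using sub_mem h one_mem_lattice))
  rw [show 1 / 2 + (1 + (τ : ℂ)) / 2 = τ / 2 + 1 by ring,
    periodic_weierstrassP' one_mem_lattice] at this
  exact (hK z h1 h2).trans this.symm

lemma e_two_ne_e_one : e τ 2 ≠ e τ 1 :=
  weierstrassP_half_ne half_one_notMem (two_mul_half_mem one_mem_lattice) half_tau_notMem (by
    change (τ : ℂ) / 2 + 1 / 2 ∉ _
    rw [show (τ : ℂ) / 2 + 1 / 2 = (1 + τ) / 2 by ring]; exact half_one_add_tau_notMem)

lemma e_three_ne_e_one : e τ 3 ≠ e τ 1 :=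
  weierstrassP_half_ne half_one_notMem (two_mul_half_mem one_mem_lattice) half_one_add_tau_notMem (by
    change (1 + (τ : ℂ)) / 2 + 1 / 2 ∉ _
    rw [show (1 + (τ : ℂ)) / 2 + 1 / 2 = τ / 2 + 1 by ring]
    intro h
    exact half_tau_notMem (by simpa using sub_mem h one_mem_lattice))

lemma e_three_ne_e_two : e τ 3 ≠ e τ 2 :=
  weierstrassP_half_ne half_tau_notMem (two_mul_half_mem tau_mem_lattice) half_one_add_tau_notMem (by
    change (1 + (τ : ℂ)) / 2 + (τ : ℂ) / 2 ∉ _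
    rw [show (1 + (τ : ℂ)) / 2 + (τ : ℂ) / 2 = 1 / 2 + τ by ring]
    intro h
    exact half_one_notMem (by simpa using sub_mem h tau_mem_lattice))

lemma e_root {c : ℂ} (hc : c ∉ (periods τ).lattice) (hc2 : 2 * c ∈ (periods τ).lattice) :
    4 * wp τ c ^ 3 - (periods τ).g₂ * wp τ c - (periods τ).g₃ = 0 := by
  have := (periods τ).derivWeierstrassP_sq c hc
  rw [derivWeierstrassP_half hc2] at this
  exact this.symm.trans (by simp)

/-- Vieta's formulas for three distinct roots, obtained by subtracting the cubic equations of two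
roots and cancelling their difference. -/
lemma e_sum : e τ 1 + e τ 2 + e τ 3 = 0 ∧
    (periods τ).g₂ = -4 * (e τ 1 * e τ 2 + e τ 1 * e τ 3 + e τ 2 * e τ 3) ∧
    (periods τ).g₃ = 4 * (e τ 1 * e τ 2 * e τ 3) := by
  have h1 := e_root (τ := τ) half_one_notMem (two_mul_half_mem one_mem_lattice)
  have h2 := e_root (τ := τ) half_tau_notMem (two_mul_half_mem tau_mem_lattice)
  have h3 := e_root (τ := τ) half_one_add_tau_notMem
    (two_mul_half_mem (add_mem one_mem_lattice tau_mem_lattice))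
  change 4 * e τ 1 ^ 3 - _ * e τ 1 - _ = 0 at h1
  change 4 * e τ 2 ^ 3 - _ * e τ 2 - _ = 0 at h2
  change 4 * e τ 3 ^ 3 - _ * e τ 3 - _ = 0 at h3
  have n21 := sub_ne_zero.mpr (e_two_ne_e_one (τ := τ))
  have n31 := sub_ne_zero.mpr (e_three_ne_e_one (τ := τ))
  have n32 := sub_ne_zero.mpr (e_three_ne_e_two (τ := τ))
  set a := e τ 1
  set b := e τ 2
  set c := e τ 3
  have k1 : 4 * (a ^ 2 + a * b + b ^ 2) = (periods τ).g₂ := by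
    apply mul_left_cancel₀ n21
    linear_combination h2 - h1
  have k2 : 4 * (a ^ 2 + a * c + c ^ 2) = (periods τ).g₂ := by
    apply mul_left_cancel₀ n31
    linear_combination h3 - h1
  have k3 : a + b + c = 0 := by
    apply mul_left_cancel₀ n32
    linear_combination (k2 - k1) / 4
  refine ⟨k3, ?_, ?_⟩
  · rw [← k1]
    linear_combination 4 * (a + b) * k3
  · have hc : c = -a - b := by linear_combination k3
    rw [hc]
    linear_combination -h1 + a * k1

lemma g₃_eq_of_roots {z : ℂ} (hz : z ∉ (periods τ).lattice) :
    wpDeriv τ z ^ 2 = 4 * (wp τ z - e τ 1) * (wp τ z - e τ 2) * (wp τ z - e τ 3) := by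
  obtain ⟨h1, h2, h3⟩ := e_sum (τ := τ)
  have := (periods τ).derivWeierstrassP_sq z hz
  rw [h2, h3] at this
  change wpDeriv τ z ^ 2 = 4 * wp τ z ^ 3 - _ * wp τ z - _ at this
  linear_combination this + 4 * wp τ z ^ 2 * h1

end Torus

/-! ### Rational identities behind the substitution -/

section Potential

/-- Writing `μ` as `m` plus the sum in `θ` completes the square in the Hamiltonian. The linear term
`l (l - 1) μ` that remains joins the last term of `coeffP2` to give `l (l - 1) (l - t) μ / (x - l)`.
-/
lemma normalP2_mul_eq (θ : Fin 5 → ℂ) {l t x m : ℂ} (hx : x ≠ 0) (hx1 : x ≠ 1) (hxt : x ≠ t)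
    (hl : l ≠ 0) (hl1 : l ≠ 1) (hlt : l ≠ t) (hxl : x ≠ l) (ht : t ≠ 0) (ht1 : t ≠ 1) :
    x * (x - 1) * (x - t) * normalP2 θ l (m + (θ 1 / (2 * l) + θ 2 / (2 * (l - 1)) + θ 3 / (2 * (l - t)))) t x =
      θ 0 * (θ 0 + θ 4) * (x - l) - l * (l - 1) * (l - t) * m ^ 2 
      + l * (l - 1) * (l - t) * (θ 1 / (2 * l) + θ 2 / (2 * (l - 1)) + θ 3 / (2 * (l - t))) ^ 2
      + l * (l - 1) * (l - t) * (m + (θ 1 / (2 * l) + θ 2 / (2 * (l - 1)) + θ 3 / (2 * (l - t)))) / (x - l)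
      + x * (x - 1) * (x - t) * (-1 / (x - l) ^ 2 - θ 1 / 2 / x ^ 2 - θ 2 / 2 / (x - 1) ^ 2 - θ 3 / 2 / (x - t) ^ 2
        + (1 / (x - l) + (θ 1 / 2 / x + θ 2 / 2 / (x - 1) + θ 3 / 2 / (x - t))) *
          (1 / x + 1 / (x - 1) + 1 / (x - t) - (θ 1 / 2 / x + θ 2 / 2 / (x - 1) + θ 3 / 2 / (x - t)))) := by
  rw [← sub_ne_zero] at hx1 hxt hl1 hlt hxl ht1
  have hK : ∀ mu, t * (t - 1) * hamK θ l mu t = l * (l - 1) * (l - t) * mu ^ 2 + θ 0 * (θ 0 + θ 4) * (l - t)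
      - (θ 1 * (l - 1) * (l - t) + θ 2 * l * (l - t) + (θ 3 - 1) * l * (l - 1)) * mu := by
    intro mu
    rw [hamK]; field_simp
  rw [normalP2, coeffP2, hK, coeffP1, gaugeSecond, gaugeLogDeriv]
  field_simp
  ring

/-- The part of the comparison of the two equations that is free of `A`. With `x`, `l`, `t` and the
`n_k` as independent variables it follows by clearing denominators. -/
lemma potential_rational (n0 n1 n2 n3 : ℂ) {l t x : ℂ} (hx : x ≠ 0) (hx1 : x ≠ 1) (hxt : x ≠ t)
    (hl : l ≠ 0) (hl1 : l ≠ 1) (hlt : l ≠ t) (hxl : x ≠ l) :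
    ((x - 1) * (x - t) + x * (x - t) + x * (x - 1)) * (1 / 2 * (1 / x + 1 / (x - 1) + 1 / (x - t)) + 1 / (x - l))
    + 2 * x * (x - 1) * (x - t) * (-1 / 2 * (1 / x ^ 2 + 1 / (x - 1) ^ 2 + 1 / (x - t) ^ 2) - 1 / (x - l) ^ 2)
    + x * (x - 1) * (x - t) * (1 / 2 * (1 / x + 1 / (x - 1) + 1 / (x - t)) + 1 / (x - l)) ^ 2 
    - 4 * (-(1 + (n0 + n1 + n2 + n3)) / 2 * (-(1 + (n0 + n1 + n2 + n3)) / 2 + (n0 + 1 / 2)) * (x - l)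
      + l * (l - 1) * (l - t) * ((n1 + 1 / 2) / (2 * l) + (n2 + 1 / 2) / (2 * (l - 1)) + (n3 + 1 / 2) / (2 * (l - t))) ^ 2
      + l * (l - 1) * (l - t) * ((n1 + 1 / 2) / (2 * l) + (n2 + 1 / 2) / (2 * (l - 1)) + (n3 + 1 / 2) / (2 * (l - t))) / (x - l)
      + x * (x - 1) * (x - t) * (-1 / (x - l) ^ 2 - (n1 + 1 / 2) / 2 / x ^ 2 - (n2 + 1 / 2) / 2 / (x - 1) ^ 2 - (n3 + 1 / 2) / 2 / (x - t) ^ 2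
        + (1 / (x - l) + ((n1 + 1 / 2) / 2 / x + (n2 + 1 / 2) / 2 / (x - 1) + (n3 + 1 / 2) / 2 / (x - t))) *
          (1 / x + 1 / (x - 1) + 1 / (x - t) - ((n1 + 1 / 2) / 2 / x + (n2 + 1 / 2) / 2 / (x - 1) + (n3 + 1 / 2) / 2 / (x - t)))))
    = n0 * (n0 + 1) * (x - l) + n1 * (n1 + 1) * (t * (1 / x - 1 / l))
      + n2 * (n2 + 1) * ((1 - t) * (1 / (x - 1) - 1 / (l - 1)))
      + n3 * (n3 + 1) * (t * (t - 1) * (1 / (x - t) - 1 / (l - t)))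
      + 3 / 4 * (4 * l - 4 * (1 + t) / 3 + 2 * ((l - 1) * (l - t) + l * (l - t) + l * (l - 1)) / (x - l)
        + 4 * l * (l - 1) * (l - t) / (x - l) ^ 2
        - ((l - 1) * (l - t) + l * (l - t) + l * (l - 1)) ^ 2 / (4 * (l * (l - 1) * (l - t))))
      - ((l - 1) * (l - t) + l * (l - t) + l * (l - 1)) ^ 2 / (l * (l - 1) * (l - t)) / 16
      - ((l - 1) * (l - t) + l * (l - t) + l * (l - 1)) / (x - l) / 2
        := by
  rw [← sub_ne_zero] at hx1 hxt hl1 hlt hxl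
  field_simp
  ring

end Potential

/-! ### The potential as a rational function of `x` -/

section Potential

variable {τ : UpperHalfPlane}

lemma e_sub_ne_zero : e τ 2 - e τ 1 ≠ 0 := sub_ne_zero.mpr e_two_ne_e_one

lemma tPoint_ne_zero : tPoint τ ≠ 0 := div_ne_zero (sub_ne_zero.mpr e_three_ne_e_one) e_sub_ne_zero

lemma tPoint_ne_one : tPoint τ ≠ 1 := by
  rw [tPoint, Ne, div_eq_one_iff_eq e_sub_ne_zero, sub_left_inj]
  exact e_three_ne_e_two

lemma wp_eq (z : ℂ) : wp τ z = (e τ 2 - e τ 1) * xMap τ z + e τ 1 := by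
  rw [xMap, mul_div_cancel₀ _ e_sub_ne_zero]; ring

lemma e_three_eq : e τ 3 = (e τ 2 - e τ 1) * tPoint τ + e τ 1 := by
  rw [tPoint, mul_div_cancel₀ _ e_sub_ne_zero]; ring

lemma e_one_eq : e τ 1 = -((e τ 2 - e τ 1) * (1 + tPoint τ)) / 3 := by
  have h1 := (e_sum (τ := τ)).1
  have h3 := e_three_eq (τ := τ)
  linear_combination (h1 - h3) / 3

lemma xMap_add {v : ℂ} (hv : v ∈ (periods τ).lattice) (z : ℂ) : xMap τ (z + v) = xMap τ z := by
  rw [xMap, wp, periodic_weierstrassP' hv]; rfl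

lemma xMap_neg (z : ℂ) : xMap τ (-z) = xMap τ z := by
  rw [xMap, wp, PeriodPair.weierstrassP_neg]; rfl

lemma add_half_notMem {z : ℂ} (hx : xMap τ z ∈ punctured (tPoint τ)) (k : Fin 4) (hk : k ≠ 0) :
    z + omega τ k / 2 ∉ (periods τ).lattice := by
  intro h
  have hz : xMap τ z = xMap τ (omega τ k / 2) := by
    have := xMap_add h (-(omega τ k / 2))
    rw [xMap_neg (omega τ k / 2)] at this
    rw [← this]
    congr 1; ring
  have h1 : xMap τ (omega τ 1 / 2) = 0 := by simp [xMap, e]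
  have h2 : xMap τ (omega τ 2 / 2) = 1 := by
    rw [xMap]; exact div_self e_sub_ne_zero
  have h3 : xMap τ (omega τ 3 / 2) = tPoint τ := rfl
  obtain ⟨a, b, c⟩ := hx
  fin_cases k
  · exact hk rfl
  · exact a (hz.trans h1)
  · exact b (hz.trans h2)
  · exact c (hz.trans h3)

lemma xMap_mem_punctured {z : ℂ} (hz : z ∉ twoTorsion τ) : xMap τ z ∈ punctured (tPoint τ) := by
  have h0 : z ∉ (periods τ).lattice := fun h => hz ⟨0, by simpa [omega] using h⟩
  have key : ∀ k : Fin 4, omega τ k / 2 ∉ (periods τ).lattice → wp τ z ≠ e τ k := by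
    intro k hk
    refine weierstrassP_half_ne hk (two_mul_omega_half_mem k) h0 fun h => hz ⟨k, ?_⟩
    have := sub_mem h (two_mul_omega_half_mem (τ := τ) k)
    rwa [show z + omega τ k / 2 - 2 * (omega τ k / 2) = z - omega τ k / 2 by ring] at this
  have k1 := key 1 half_one_notMem
  have k2 := key 2 half_tau_notMem
  have k3 := key 3 half_one_add_tau_notMem
  refine ⟨div_ne_zero (sub_ne_zero.mpr k1) e_sub_ne_zero, ?_, ?_⟩
  · rw [xMap, Ne, div_eq_one_iff_eq e_sub_ne_zero, sub_left_inj]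
    exact k2
  · rw [xMap, tPoint, Ne, div_left_inj' e_sub_ne_zero, sub_left_inj]
    exact k3

lemma hasDerivAt_xMap {z : ℂ} (hz : z ∉ (periods τ).lattice) :
    HasDerivAt (xMap τ) (wpDeriv τ z / (e τ 2 - e τ 1)) z :=
  ((hasDerivAt_weierstrassP _ hz).sub_const _).div_const _

lemma xMap_sub_xMap_ne_zero {p z : ℂ} (hp : 2 * p ∉ (periods τ).lattice)
    (h1 : z ∉ (periods τ).lattice) (h2 : z + p ∉ (periods τ).lattice)
    (h3 : z - p ∉ (periods τ).lattice) : xMap τ z ≠ xMap τ p := by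
  intro h
  apply weierstrassP_sub_ne_zero hp h1 h2 h3
  change wp τ z - wp τ p = 0
  rw [wp_eq, wp_eq, h, sub_self]

lemma wpDeriv_sq {z : ℂ} (hz : z ∉ (periods τ).lattice) : wpDeriv τ z ^ 2 =
    (e τ 2 - e τ 1) ^ 3 * (4 * xMap τ z * (xMap τ z - 1) * (xMap τ z - tPoint τ)) := by
  rw [g₃_eq_of_roots hz, wp_eq, e_three_eq]
  ring

/-- `℘''` in terms of `x`. -/
lemma six_wp_sq_sub (z : ℂ) : 6 * wp τ z ^ 2 - (periods τ).g₂ / 2 =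
    (e τ 2 - e τ 1) ^ 2 * (2 * ((xMap τ z - 1) * (xMap τ z - tPoint τ) +
      xMap τ z * (xMap τ z - tPoint τ) + xMap τ z * (xMap τ z - 1))) := by
  obtain ⟨h1, h2, -⟩ := e_sum (τ := τ)
  have h3 := e_three_eq (τ := τ)
  rw [h2, wp_eq, h3]
  rw [h3] at h1
  linear_combination (4 * (e τ 2 - e τ 1) * xMap τ z + 4 * e τ 1) * h1

/-- The potential as a rational function of `x`. -/
lemma potential_eq_xMap (n : Fin 4 → ℕ) {p z : ℂ} (A : ℂ) (hp : p ∉ twoTorsion τ)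
    (hz : z ∉ (periods τ).lattice) (hx : xMap τ z ∈ punctured (tPoint τ))
    (h2 : z + p ∉ (periods τ).lattice) (h3 : z - p ∉ (periods τ).lattice)
    {x l t E α : ℂ} (hx' : xMap τ z = x) (hl' : xMap τ p = l) (ht' : tPoint τ = t)
    (hE' : e τ 2 - e τ 1 = E)
    (hα : α = A * wpDeriv τ p / (E ^ 2 * (4 * l * (l - 1) * (l - t)))) :
    potential τ n p A z = E * ((n 0 : ℂ) * (n 0 + 1) * (x - l)
      + n 1 * (n 1 + 1) * (t * (1 / x - 1 / l))
      + n 2 * (n 2 + 1) * ((1 - t) * (1 / (x - 1) - 1 / (l - 1)))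
      + n 3 * (n 3 + 1) * (t * (t - 1) * (1 / (x - t) - 1 / (l - t)))
      + 3 / 4 * (4 * l - 4 * (1 + t) / 3 + 2 * ((l - 1) * (l - t) + l * (l - t) + l * (l - 1)) / (x - l)
        + 4 * l * (l - 1) * (l - t) / (x - l) ^ 2
        - ((l - 1) * (l - t) + l * (l - t) + l * (l - 1)) ^ 2 / (4 * (l * (l - 1) * (l - t))))
      + α ^ 2 * (4 * l * (l - 1) * (l - t)) - α * (4 * l * (l - 1) * (l - t)) / (x - l)
      - α * ((l - 1) * (l - t) + l * (l - t) + l * (l - 1))) := by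
  have hp2 := two_mul_notMem_of_notMem_twoTorsion hp
  have hp1 := notMem_of_two_mul hp2
  have hpx := xMap_mem_punctured hp
  have hxl := xMap_sub_xMap_ne_zero hp2 hz h2 h3
  -- A shift by a half period acts on `x` by a Möbius involution, which makes the shifted `℘`
  -- rational in `x`.
  have half : ∀ w, w ∉ (periods τ).lattice → xMap τ w ∈ punctured (tPoint τ) →
      wp τ (w + 1 / 2) = e τ 1 + E * (t / xMap τ w) ∧
      wp τ (w + (τ : ℂ) / 2) = e τ 2 + E * ((1 - t) / (xMap τ w - 1)) ∧
      wp τ (w + (1 + (τ : ℂ)) / 2) = e τ 3 + E * (t * (t - 1) / (xMap τ w - t)) := by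
    intro w hw hwx
    have a := half_one_mul hw (add_half_notMem hwx 1 (by decide))
    have b := half_tau_mul hw (add_half_notMem hwx 2 (by decide))
    have c := half_one_add_tau_mul hw (add_half_notMem hwx 3 (by decide))
    have hE0 : E ≠ 0 := hE' ▸ e_sub_ne_zero
    obtain ⟨w0, w1, wt⟩ := hwx
    rw [← sub_ne_zero] at w1 wt
    rw [ht'] at wt
    have he2 : e τ 2 = E + e τ 1 := by rw [← hE']; ring
    rw [e_three_eq, wp_eq w, hE', ht'] at a b c
    rw [e_three_eq, hE', ht']
    rw [he2] at b c ⊢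
    have aux : ∀ {q c u v : ℂ}, u ≠ 0 → (q - c) * (E * u) = E * (E * v) → q = c + E * (v / u) := by
      intro q c u v hu h
      have h1 : (q - c) * u = E * v := by
        apply mul_left_cancel₀ hE0
        linear_combination h
      rw [← sub_eq_iff_eq_add', ← mul_div_assoc, eq_div_iff hu, h1]
    refine ⟨aux w0 ?_, aux w1 ?_, aux wt ?_⟩
    · linear_combination a
    · linear_combination b
    · linear_combination c
  obtain ⟨z1, z2, z3⟩ := half z hz hx
  obtain ⟨p1, p2, p3⟩ := half p hp1 hpx
  have hzeta := zetaW_add_sub_zetaW_sub hp2 hz h2 h3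
  have hzeta2 := zetaW_two_mul hp2
  have hsum := weierstrassP_add_add_weierstrassP_sub hp2 hz h2 h3
  have hdbl := weierstrassP_two_mul hp2
  have hb := wpDeriv_sq hp1
  have hb0 : wpDeriv τ p ≠ 0 := derivWeierstrassP_ne_zero hp2
  change wzeta τ (z + p) - wzeta τ (z - p) = 2 * wzeta τ p - wpDeriv τ p / (wp τ z - wp τ p) at hzeta
  change wzeta τ (2 * p) = 2 * wzeta τ p + (6 * wp τ p ^ 2 - _) / (2 * wpDeriv τ p) at hzeta2
  change wp τ (z + p) + wp τ (z - p) = 2 * wp τ p + (6 * wp τ p ^ 2 - _) / (wp τ z - wp τ p) +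
    wpDeriv τ p ^ 2 / (wp τ z - wp τ p) ^ 2 at hsum
  change wp τ (2 * p) = -2 * wp τ p + ((6 * wp τ p ^ 2 - _) / wpDeriv τ p) ^ 2 / 4 at hdbl
  rw [six_wp_sq_sub] at hzeta2 hsum hdbl
  have hE0 : E ≠ 0 := hE' ▸ e_sub_ne_zero
  -- The terms `2 A ζ(p)` coming from `ζ(z + p) - ζ(z - p)` and from `ζ(2p)` cancel, so no value of
  -- `ζ` survives.
  rw [potential, constB, hsum, hzeta, hzeta2, hdbl]
  simp only [Fin.sum_univ_four, omega, Matrix.cons_val_zero, Matrix.cons_val_one, Matrix.cons_val,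
    zero_div, add_zero]
  rw [z1, z2, z3, p1, p2, p3, wp_eq z, wp_eq p]
  have he1 := e_one_eq (τ := τ)
  obtain ⟨x0, x1, xt⟩ := hx
  obtain ⟨l0, l1, lt⟩ := hpx
  rw [hx', hl', ht', hE'] at *
  rw [← sub_ne_zero] at x1 xt l1 lt hxl
  set b := wpDeriv τ p
  -- The definition of `α` is inverted by means of `b² = E³ · 4 l (l - 1) (l - t)`, where `b =
  -- ℘'(p)`.
  have hAα : A = α * b / E := by
    rw [hα]
    field_simp
    linear_combination (-A) * hb
  have t1 : A ^ 2 = α ^ 2 * (E * (4 * l * (l - 1) * (l - t))) := by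
    rw [hAα, div_pow, mul_pow, hb]
    field_simp
  have hdiff : E * x + e τ 1 - (E * l + e τ 1) = E * (x - l) := by ring
  have t2 : A * (b / (E * (x - l))) = α * (E * (4 * l * (l - 1) * (l - t))) / (x - l) := by
    rw [hAα]
    field_simp
    linear_combination α * hb
  have t3 : A * (E ^ 2 * (2 * ((l - 1) * (l - t) + l * (l - t) + l * (l - 1))) / (2 * b)) =
      α * (E * ((l - 1) * (l - t) + l * (l - t) + l * (l - 1))) := by
    rw [hAα]
    field_simp
  have t4 : (E ^ 2 * (2 * ((l - 1) * (l - t) + l * (l - t) + l * (l - 1))) / b) ^ 2 =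
      E * (4 * (((l - 1) * (l - t) + l * (l - t) + l * (l - 1)) ^ 2 / (4 * (l * (l - 1) * (l - t))))) := by
    rw [div_pow, hb]
    field_simp
    ring
  have t5 : b ^ 2 / (E * (x - l)) ^ 2 = E * (4 * l * (l - 1) * (l - t)) / (x - l) ^ 2 := by
    rw [hb]
    field_simp
  have t6 : E ^ 2 * (2 * ((l - 1) * (l - t) + l * (l - t) + l * (l - 1))) / (E * (x - l)) =
      E * (2 * ((l - 1) * (l - t) + l * (l - t) + l * (l - 1)) / (x - l)) := by
    field_simp
  rw [hdiff, t4, t5, t6, t1]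
  generalize ((l - 1) * (l - t) + l * (l - t) + l * (l - 1)) ^ 2 / (4 * (l * (l - 1) * (l - t))) = r
  linear_combination 3 * he1 - t2 - t3
end Potential

/-! ### From the normal form to the generalized Lamé equation -/

section Gauge

variable {τ : UpperHalfPlane}

/-- `ψ' / ψ` for `ψ ^ 2 = (x (x - 1) (x - t)) ^ (1 / 2) (x - l)`. -/
def halfLogDeriv (l t x : ℂ) : ℂ :=
  1 / 4 * (1 / x + 1 / (x - 1) + 1 / (x - t)) + 1 / 2 * (1 / (x - l))

/-- The part of `muPoint` that is not determined by `θ` and `λ`. -/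
def muShift (τ : UpperHalfPlane) (p A : ℂ) : ℂ :=
  A * wpDeriv τ p / ((e τ 2 - e τ 1) ^ 2 *
      (4 * lamPoint τ p * (lamPoint τ p - 1) * (lamPoint τ p - tPoint τ))) -
    ((lamPoint τ p - 1) * (lamPoint τ p - tPoint τ) + lamPoint τ p * (lamPoint τ p - tPoint τ) +
      lamPoint τ p * (lamPoint τ p - 1)) /
      (8 * (lamPoint τ p * (lamPoint τ p - 1) * (lamPoint τ p - tPoint τ)))

/-- The halves in `θ_k = n_k + 1/2` contribute `1/4` of `𝔭' / 𝔭`, of which `muPoint` contains only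
`1/8`; the subtracted term of `muShift` makes up for it. -/
lemma muPoint_eq (n : Fin 4 → ℕ) {p : ℂ} (A : ℂ) (hp : lamPoint τ p ∈ punctured (tPoint τ)) :
    muPoint τ n p A = muShift τ p A + (theta n 1 / (2 * lamPoint τ p) +
      theta n 2 / (2 * (lamPoint τ p - 1)) + theta n 3 / (2 * (lamPoint τ p - tPoint τ))) := by
  obtain ⟨h0, h1, ht⟩ := hp
  rw [← sub_ne_zero] at h1 ht
  simp only [muPoint, muShift, theta, Matrix.cons_val_one, Matrix.cons_val]
  generalize lamPoint τ p = l at *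
  generalize tPoint τ = t at *
  generalize A * wpDeriv τ p / ((e τ 2 - e τ 1) ^ 2 * (4 * l * (l - 1) * (l - t))) = a
  field_simp
  ring

/-- With `h = Ψ' / Ψ`, the right side is `x'' h + x'² (h' + h² - P₂)`, the coefficient of `y` that
the substitution produces. Here `x'²` and `x''` are `4 (e₂ - e₁)` times the cubic in `x` and `2 (e₂
- e₁)` times its derivative. -/
lemma potential_eq (n : Fin 4 → ℕ) {p z : ℂ} (A : ℂ) (hp : p ∉ twoTorsion τ)
    (hz : z ∉ (periods τ).lattice) (hx : xMap τ z ∈ punctured (tPoint τ))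
    (h2 : z + p ∉ (periods τ).lattice) (h3 : z - p ∉ (periods τ).lattice)
    {x l t : ℂ} (hx' : xMap τ z = x) (hl' : lamPoint τ p = l) (ht' : tPoint τ = t) :
    potential τ n p A z = (e τ 2 - e τ 1) * (
      ((x - 1) * (x - t) + x * (x - t) + x * (x - 1)) * (2 * halfLogDeriv l t x)
      + 2 * x * (x - 1) * (x - t) * (-1 / 2 * (1 / x ^ 2 + 1 / (x - 1) ^ 2 + 1 / (x - t) ^ 2)
        - 1 / (x - l) ^ 2)
      + x * (x - 1) * (x - t) * (2 * halfLogDeriv l t x) ^ 2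
      - 4 * (x * (x - 1) * (x - t) * normalP2 (theta n) l (muPoint τ n p A) t x)) := by
  have hlp := xMap_mem_punctured hp
  rw [muPoint_eq n A hlp]
  have hxl := xMap_sub_xMap_ne_zero (two_mul_notMem_of_notMem_twoTorsion hp) hz h2 h3
  rw [potential_eq_xMap n A hp hz hx h2 h3 hx' hl' ht' rfl rfl]
  change lamPoint τ p ∈ _ at hlp
  change _ ≠ lamPoint τ p at hxl
  have ht0 := tPoint_ne_zero (τ := τ)
  have ht1 := tPoint_ne_one (τ := τ)
  rw [muShift]
  obtain ⟨x0, x1, xt⟩ := hx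
  obtain ⟨l0, l1, lt⟩ := hlp
  rw [hl'] at hxl l0 l1 lt ⊢
  rw [ht'] at ht0 ht1 xt lt ⊢
  rw [hx'] at x0 x1 xt hxl
  rw [normalP2_mul_eq _ x0 x1 xt l0 l1 lt hxl ht0 ht1]
  have key := potential_rational (n 0) (n 1) (n 2) (n 3) x0 x1 xt l0 l1 lt hxl
  simp only [theta, Fin.sum_univ_four, Matrix.cons_val_zero, Matrix.cons_val_one, Matrix.cons_val,
    halfLogDeriv]
  congr 1
  rw [← sub_ne_zero] at l1 lt hxl
  generalize A * wpDeriv τ p / ((e τ 2 - e τ 1) ^ 2 * (4 * l * (l - 1) * (l - t))) = a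
  set S := (l - 1) * (l - t) + l * (l - t) + l * (l - 1)
  have hm : 4 * (l * (l - 1) * (l - t) * (a - S / (8 * (l * (l - 1) * (l - t)))) ^ 2) =
      a ^ 2 * (4 * l * (l - 1) * (l - t)) - a * S + S ^ 2 / (l * (l - 1) * (l - t)) / 16 := by
    field_simp
    ring
  have hm2 : 4 * (l * (l - 1) * (l - t) * (a - S / (8 * (l * (l - 1) * (l - t)))) / (x - l)) =
      a * (4 * l * (l - 1) * (l - t)) / (x - l) - S / (x - l) / 2 := by
    field_simp
    ring
  have hm3 : ∀ q, l * (l - 1) * (l - t) * (a - S / (8 * (l * (l - 1) * (l - t))) + q) / (x - l) =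
      l * (l - 1) * (l - t) * (a - S / (8 * (l * (l - 1) * (l - t)))) / (x - l) +
      l * (l - 1) * (l - t) * q / (x - l) := by
    intro q
    rw [← add_div, ← mul_add]
  rw [hm3]
  linear_combination -hm + hm2 - key

lemma hasDerivAt_halfLogDeriv {l t x : ℂ} (hx : x ∈ punctured t) (hxl : x ≠ l) :
    HasDerivAt (halfLogDeriv l t) (-1 / 4 * (1 / x ^ 2 + 1 / (x - 1) ^ 2 + 1 / (x - t) ^ 2)
        - 1 / 2 * (1 / (x - l) ^ 2)) x := by
  obtain ⟨x0, x1, xt⟩ := hx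
  have aux : ∀ c : ℂ, x ≠ c → HasDerivAt (fun y => 1 / (y - c)) (-(1 / (x - c) ^ 2)) x := by
    intro c hc
    have h := HasDerivAt.fun_inv ((hasDerivAt_id x).sub_const c) (sub_ne_zero.mpr hc)
    simpa [neg_div] using h
  have h0 := aux 0 x0
  simp only [sub_zero] at h0
  have := (((h0.add (aux 1 x1)).add (aux t xt)).const_mul (1 / 4)).add ((aux l hxl).const_mul (1 / 2))
  exact this.congr_deriv (by ring)

lemma normalP1_eq (n : Fin 4 → ℕ) (l t x : ℂ) :
    normalP1 (theta n) l t x = 1 / x + 1 / (x - 1) + 1 / (x - t) + 1 / (x - l) := by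
  rw [normalP1, coeffP1, gaugeLogDeriv]
  ring

lemma eventually_regular {p z₀ : ℂ} (hz : z₀ ∉ (periods τ).lattice)
    (h2 : z₀ + p ∉ (periods τ).lattice) (h3 : z₀ - p ∉ (periods τ).lattice) :
    ∀ᶠ z in 𝓝 z₀, z ∉ (periods τ).lattice ∧ z + p ∉ (periods τ).lattice ∧
      z - p ∉ (periods τ).lattice := by
  have key : ∀ c, z₀ + c ∉ (periods τ).lattice → ∀ᶠ z in 𝓝 z₀, z + c ∉ (periods τ).lattice := by
    intro c hc
    exact ((continuous_add_const c).continuousAt (x := z₀)).eventually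
      ((isOpen_compl_lattice (periods τ)).mem_nhds hc)
  filter_upwards [key 0 (by simpa using hz), key p h2, key (-p) (by simpa [sub_eq_add_neg] using h3)]
    with z a b c
  exact ⟨by simpa using a, b, by simpa [sub_eq_add_neg] using c⟩

lemma isOpen_punctured (t : ℂ) : IsOpen (punctured t) := by
  have : punctured t = {0}ᶜ ∩ ({1}ᶜ ∩ {t}ᶜ) := by ext; simp [punctured]
  rw [this]
  exact isOpen_compl_singleton.inter (isOpen_compl_singleton.inter isOpen_compl_singleton)

lemma notMem_twoTorsion {z : ℂ} (hz : z ∉ (periods τ).lattice)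
    (hx : xMap τ z ∈ punctured (tPoint τ)) : z ∉ twoTorsion τ := by
  rintro ⟨k, hk⟩
  by_cases h0 : k = 0
  · subst h0
    simp [omega] at hk
    exact hz hk
  · refine add_half_notMem hx k h0 ?_
    have := add_mem hk (two_mul_omega_half_mem (τ := τ) k)
    rwa [show z - omega τ k / 2 + 2 * (omega τ k / 2) = z + omega τ k / 2 by ring] at this

lemma hasDerivAt_wpDeriv {z : ℂ} (hz : z ∉ (periods τ).lattice)
    (hx : xMap τ z ∈ punctured (tPoint τ)) :
    HasDerivAt (wpDeriv τ) ((e τ 2 - e τ 1) ^ 2 * (2 * ((xMap τ z - 1) * (xMap τ z - tPoint τ) +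
      xMap τ z * (xMap τ z - tPoint τ) + xMap τ z * (xMap τ z - 1)))) z := by
  rw [← six_wp_sq_sub]
  exact hasDerivAt_derivWeierstrassP
    (two_mul_notMem_of_notMem_twoTorsion (notMem_twoTorsion hz hx))

/-- The substitution `x = xMap τ z` followed by a gauge transformation turns the normal form into
the generalized Lamé equation. -/
lemma potential_solution (n : Fin 4 → ℕ) {p z₀ : ℂ} (A : ℂ) (hp : p ∉ twoTorsion τ)
    (hz : z₀ ∉ (periods τ).lattice) (hx : xMap τ z₀ ∈ punctured (tPoint τ))
    (h2 : z₀ + p ∉ (periods τ).lattice) (h3 : z₀ - p ∉ (periods τ).lattice) {F Ψ : ℂ → ℂ}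
    (hF : AnalyticAt ℂ F (xMap τ z₀))
    (hF' : ∀ᶠ x in 𝓝 (xMap τ z₀), deriv (deriv F) x +
      normalP1 (theta n) (lamPoint τ p) (tPoint τ) x * deriv F x +
      normalP2 (theta n) (lamPoint τ p) (muPoint τ n p A) (tPoint τ) x * F x = 0)
    (hΨ : IsLocalSol (halfLogDeriv (lamPoint τ p) (tPoint τ)) Ψ (xMap τ z₀)) :
    ∀ᶠ z in 𝓝 z₀, deriv (deriv fun z => Ψ (xMap τ z) * F (xMap τ z)) z +
      0 * deriv (fun z => Ψ (xMap τ z) * F (xMap τ z)) z +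
      -potential τ n p A z * (Ψ (xMap τ z) * F (xMap τ z)) = 0 := by
  have hcont : ContinuousAt (xMap τ) z₀ := (hasDerivAt_xMap hz).continuousAt
  set l := lamPoint τ p with hl
  set t := tPoint τ with ht
  have hE0 : e τ 2 - e τ 1 ≠ 0 := e_sub_ne_zero
  have hreg := eventually_regular hz h2 h3
  have hxev := hcont.eventually ((isOpen_punctured t).mem_nhds hx)
  have hFan := hcont.eventually hF.eventually_analyticAt
  have hΨev := hcont.eventually hΨ
  have hev := hcont.eventually hF'
  have hgood := ((hreg.and hxev).and (hFan.and hΨev))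
  have hd1 : ∀ᶠ z in 𝓝 z₀, HasDerivAt (fun z => Ψ (xMap τ z) * F (xMap τ z))
      (wpDeriv τ z / (e τ 2 - e τ 1) * (Ψ (xMap τ z) *
        (deriv F (xMap τ z) + halfLogDeriv l t (xMap τ z) * F (xMap τ z)))) z := by
    filter_upwards [hgood] with z ⟨⟨⟨a, b, c⟩, d⟩, f, g⟩
    have dx := hasDerivAt_xMap a
    have d1 : HasDerivAt (fun z => Ψ (xMap τ z)) _ z := g.comp z dx
    have d2 : HasDerivAt (fun z => F (xMap τ z)) _ z := f.differentiableAt.hasDerivAt.comp z dx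
    exact (d1.mul d2).congr_deriv (by ring)
  have hd1' := hd1.eventually_nhds
  filter_upwards [hgood, hd1', hev] with z ⟨⟨⟨a, b, c⟩, d⟩, f, g⟩ h1 hsol
  have heq : deriv (fun z => Ψ (xMap τ z) * F (xMap τ z)) =ᶠ[𝓝 z] _ :=
    h1.mono fun w hw => hw.deriv
  have hxl := xMap_sub_xMap_ne_zero (two_mul_notMem_of_notMem_twoTorsion hp) a b c
  change _ ≠ l at hxl
  have dx := hasDerivAt_xMap a
  have d1 : HasDerivAt (fun z => Ψ (xMap τ z)) _ z := g.comp z dx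
  have d2 : HasDerivAt (fun z => F (xMap τ z)) _ z := f.differentiableAt.hasDerivAt.comp z dx
  have d3 : HasDerivAt (fun z => deriv F (xMap τ z)) _ z :=
    f.deriv.differentiableAt.hasDerivAt.comp z dx
  have d4 : HasDerivAt (fun z => halfLogDeriv l t (xMap τ z)) _ z :=
    (hasDerivAt_halfLogDeriv d hxl).comp z dx
  have d5 := ((hasDerivAt_wpDeriv a d).div_const (e τ 2 - e τ 1)).mul
    (d1.mul (d3.add (d4.mul d2)))
  rw [heq.deriv_eq, zero_mul, add_zero]
  refine (congrArg (· + _) d5.deriv).trans ?_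
  rw [potential_eq n A hp a d b c rfl rfl rfl]
  have hsq := wpDeriv_sq a
  rw [normalP1_eq] at hsol
  obtain ⟨x0, x1, xt⟩ := d
  simp only [← hl, ← ht] at *
  simp only [Pi.mul_apply, Pi.add_apply]
  generalize normalP2 (theta n) l (muPoint τ n p A) t (xMap τ z) = P2 at *
  generalize deriv (deriv F) (xMap τ z) = F2 at *
  generalize deriv F (xMap τ z) = F1 at *
  generalize F (xMap τ z) = F0 at *
  generalize Ψ (xMap τ z) = s at *
  generalize wpDeriv τ z = w at *
  clear heq h1 d1 d2 d3 d4 d5 dx f g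
  generalize xMap τ z = x at *
  generalize e τ 2 - e τ 1 = E at *
  rw [← sub_ne_zero] at x1 xt hxl
  have hF2 : F2 = -((1 / x + 1 / (x - 1) + 1 / (x - t) + 1 / (x - l)) * F1) - P2 * F0 := by
    linear_combination hsol
  have hD : x * (x - 1) * (x - t) * (1 / x + 1 / (x - 1) + 1 / (x - t)) =
      (x - 1) * (x - t) + x * (x - t) + x * (x - 1) := by
    field_simp
  have hw : w / E * (w / E) = E * (4 * x * (x - 1) * (x - t)) := by
    rw [div_mul_div_comm, ← sq, hsq]
    field_simp
  have hE : ∀ q, E ^ 2 * q / E = E * q := fun q => by field_simp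
  rw [hE, hF2]
  simp only [halfLogDeriv]
  generalize w / E = W at *
  generalize 1 / x + 1 / (x - 1) + 1 / (x - t) = c at *
  generalize 1 / (x - l) = v at *
  -- The coefficient `x'' + x'² (2 h - P₁)` of `F'` vanishes: this is what determines `Ψ`.
  linear_combination (s * ((1 / 4 * c + 1 / 2 * v) * (F1 + (1 / 4 * c + 1 / 2 * v) * F0) +
    (-((c + v) * F1) - P2 * F0) + (-1 / 4 * (1 / x ^ 2 + 1 / (x - 1) ^ 2 + 1 / (x - t) ^ 2) -
      1 / 2 * (1 / (x - l) ^ 2)) * F0 + (1 / 4 * c + 1 / 2 * v) * F1)) * hw - 2 * E * s * F1 * hD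

end Gauge

/-! ### A first order system that is regular at the apparent singularity -/

section System

attribute [local instance] Matrix.linftyOpNormedRing Matrix.linftyOpNormedAlgebra

/-- The cubic `x (x - 1) (x - t)`. -/
def cubic (t x : ℂ) : ℂ := x * (x - 1) * (x - t)

/-- The derivative of `cubic`. -/
def cubicDeriv (t x : ℂ) : ℂ := (x - 1) * (x - t) + x * (x - t) + x * (x - 1)

/-- `cubic` times `θ₁ / (2 x) + θ₂ / (2 (x - 1)) + θ₃ / (2 (x - t))`. -/
def expQuad (θ : Fin 5 → ℂ) (t x : ℂ) : ℂ :=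
  θ 1 / 2 * ((x - 1) * (x - t)) + θ 2 / 2 * (x * (x - t)) + θ 3 / 2 * (x * (x - 1))

/-- The divided difference of `cubic`. -/
def cubicDiff (l t x : ℂ) : ℂ := x ^ 2 + x * l + l ^ 2 - (1 + t) * (x + l) + t

/-- The divided difference of `expQuad`. -/
def expQuadDiff (θ : Fin 5 → ℂ) (l t x : ℂ) : ℂ :=
  θ 1 / 2 * (x + l - 1 - t) + θ 2 / 2 * (x + l - t) + θ 3 / 2 * (x + l - 1)

/-- The lower left coefficient of the system that is regular at the apparent singularity. -/
def sysCoeff (θ : Fin 5 → ℂ) (l t m x : ℂ) : ℂ :=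
  θ 0 * (θ 0 + θ 4) + cubicDiff l t x * m ^ 2 + m * (2 * x + l - (1 + t)) +
    (θ 1 + θ 2 + θ 3) / 2 +
    (expQuad θ t l ^ 2 * cubicDiff l t x -
      cubic t l * expQuadDiff θ l t x * (expQuad θ t x + expQuad θ t l)) / (cubic t x * cubic t l)

/-- The first order system for `((x - l) F, x (x - 1) (x - t) (((x - l) F)' - m (x - l) F) / (x - l))`,
where `F` is a solution of the normal form. -/
def sysMatrix (θ : Fin 5 → ℂ) (l t m x : ℂ) : Matrix (Fin 2) (Fin 2) ℂ :=
  !![m, (x - l) / cubic t x; -sysCoeff θ l t m x, -m]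

lemma cubic_ne_zero {t x : ℂ} (hx : x ∈ punctured t) : cubic t x ≠ 0 :=
  mul_ne_zero (mul_ne_zero hx.1 (sub_ne_zero.mpr hx.2.1)) (sub_ne_zero.mpr hx.2.2)

lemma hasDerivAt_cubic (t x : ℂ) : HasDerivAt (cubic t) (cubicDeriv t x) x := by
  have := ((hasDerivAt_id x).mul ((hasDerivAt_id x).sub_const 1)).mul ((hasDerivAt_id x).sub_const t)
  exact this.congr_deriv (by simp [cubicDeriv]; ring)

/-- Elimination yields the right side, with apparent poles at `l`. The divided differences in
`sysCoeff` show that there is no pole; it is the special value of `K` that removes it. -/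
lemma sysCoeff_eq (θ : Fin 5 → ℂ) {l t x m : ℂ} (hx : x ∈ punctured t) (hl : l ∈ punctured t)
    (hxl : x ≠ l) (ht : t ≠ 0) (ht1 : t ≠ 1) :
    sysCoeff θ l t m x = cubic t x / (x - l) * (normalP2 θ l (m + (θ 1 / (2 * l) +
      θ 2 / (2 * (l - 1)) + θ 3 / (2 * (l - t)))) t x
      - (1 / x + 1 / (x - 1) + 1 / (x - t)) / (x - l) + 1 / (x - l) ^ 2 + m ^ 2 +
      m * ((1 / x + 1 / (x - 1) + 1 / (x - t)) - 1 / (x - l))) := by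
  have hP := normalP2_mul_eq θ (m := m) hx.1 hx.2.1 hx.2.2 hl.1 hl.2.1 hl.2.2 hxl ht ht1
  have hP2 : normalP2 θ l (m + (θ 1 / (2 * l) +
      θ 2 / (2 * (l - 1)) + θ 3 / (2 * (l - t)))) t x = _ / cubic t x :=
    (eq_div_iff (cubic_ne_zero hx)).mpr ((mul_comm _ _).trans hP)
  rw [hP2]
  clear hP hP2
  obtain ⟨x0, x1, xt⟩ := hx
  obtain ⟨l0, l1, lt⟩ := hl
  rw [← sub_ne_zero] at x1 xt l1 lt hxl
  simp only [sysCoeff, cubic, cubicDiff, expQuad, expQuadDiff]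
  field_simp
  ring

variable {n : Fin 4 → ℕ} {l t m x : ℂ}

/-- The value of `μ` with shift `m`. -/
def shiftedMu (θ : Fin 5 → ℂ) (l t m : ℂ) : ℂ :=
  m + (θ 1 / (2 * l) + θ 2 / (2 * (l - 1)) + θ 3 / (2 * (l - t)))

/-- The second component of the first order system. -/
def sysSecond (l t m : ℂ) (F : ℂ → ℂ) (x : ℂ) : ℂ :=
  cubic t x * (F x / (x - l) + deriv F x - m * F x)

lemma cubicDeriv_eq (hx : x ∈ punctured t) :
    cubicDeriv t x = cubic t x * (1 / x + 1 / (x - 1) + 1 / (x - t)) := by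
  obtain ⟨x0, x1, xt⟩ := hx
  rw [← sub_ne_zero] at x1 xt
  simp only [cubic, cubicDeriv]
  field_simp

lemma hasDerivAt_sysFirst {F : ℂ → ℂ} (hF : DifferentiableAt ℂ F x) (hx : x ∈ punctured t)
    (hxl : x ≠ l) : HasDerivAt (fun y => (y - l) * F y)
      (m * ((x - l) * F x) + (x - l) / cubic t x * sysSecond l t m F x) x := by
  have hD := cubic_ne_zero hx
  rw [← sub_ne_zero] at hxl
  refine (((hasDerivAt_id x).sub_const l).mul hF.hasDerivAt).congr_deriv ?_
  simp only [sysSecond, id]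
  field_simp
  ring

lemma hasDerivAt_sysSecond {F : ℂ → ℂ} (hF : AnalyticAt ℂ F x) (hx : x ∈ punctured t)
    (hxl : x ≠ l) (hl : l ∈ punctured t) (ht : t ≠ 0) (ht1 : t ≠ 1)
    (h : deriv (deriv F) x + normalP1 (theta n) l t x * deriv F x +
      normalP2 (theta n) l (shiftedMu (theta n) l t m) t x * F x = 0) :
    HasDerivAt (sysSecond l t m F)
      (-sysCoeff (theta n) l t m x * ((x - l) * F x) + -m * sysSecond l t m F x) x := by
  rw [sysCoeff_eq _ hx hl hxl ht ht1]
  rw [normalP1_eq] at h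
  have hD := cubic_ne_zero hx
  rw [← sub_ne_zero] at hxl
  have d := hF.differentiableAt.hasDerivAt
  have d' := hF.deriv.differentiableAt.hasDerivAt
  refine ((hasDerivAt_cubic t x).mul (((d.div ((hasDerivAt_id x).sub_const l) hxl).add d').sub
    (d.const_mul m))).congr_deriv ?_
  simp only [sysSecond, id, Pi.sub_apply, Pi.add_apply, Pi.div_apply]
  rw [cubicDeriv_eq hx]
  change _ + normalP2 (theta n) l (m + _) t x * F x = 0 at h
  generalize normalP2 (theta n) l (m + _) t x = P at *
  generalize deriv (deriv F) x = F2 at *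
  generalize deriv F x = F1 at *
  generalize F x = F0 at *
  generalize 1 / x + 1 / (x - 1) + 1 / (x - t) = c at *
  generalize cubic t x = D at *
  have hF2 : F2 = -((c + 1 / (x - l)) * F1) - P * F0 := by linear_combination h
  rw [hF2]
  field_simp
  ring

/-- Converse of the two computations above: eliminating the second component leads back to the
normal form. It produces solutions of the normal form from those of the system. -/
lemma sys_solution {f g : ℂ → ℂ} {x₀ : ℂ} (hx₀ : x₀ ∈ punctured t) (hxl₀ : x₀ ≠ l)
    (hl : l ∈ punctured t) (ht : t ≠ 0) (ht1 : t ≠ 1)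
    (hf : ∀ᶠ x in 𝓝 x₀, HasDerivAt f (m * f x + (x - l) / cubic t x * g x) x)
    (hg : ∀ᶠ x in 𝓝 x₀, HasDerivAt g (-sysCoeff (theta n) l t m x * f x + -m * g x) x) :
    ∀ᶠ x in 𝓝 x₀, deriv (deriv fun y => f y / (y - l)) x +
      normalP1 (theta n) l t x * deriv (fun y => f y / (y - l)) x +
      normalP2 (theta n) l (shiftedMu (theta n) l t m) t x * (f x / (x - l)) = 0 := by
  have hreg : ∀ᶠ x in 𝓝 x₀, x ∈ punctured t ∧ x ≠ l :=
    ((isOpen_punctured t).eventually_mem hx₀).and (isOpen_ne.eventually_mem hxl₀)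
  have h1 : ∀ᶠ x in 𝓝 x₀, HasDerivAt (fun y => f y / (y - l))
      (m * (f x / (x - l)) + g x / cubic t x - f x / (x - l) ^ 2) x := by
    filter_upwards [hreg, hf] with x ⟨hx, hxl⟩ hfx
    have hD := cubic_ne_zero hx
    rw [← sub_ne_zero] at hxl
    refine (hfx.div ((hasDerivAt_id x).sub_const l) hxl).congr_deriv ?_
    simp only [id]
    field_simp
  filter_upwards [hreg, hf, hg, h1.eventually_nhds] with x ⟨hx, hxl⟩ hfx hgx h1x
  have heq : deriv (fun y => f y / (y - l)) =ᶠ[𝓝 x] _ := h1x.mono fun w hw => hw.deriv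
  have hD := cubic_ne_zero hx
  have hxl' := sub_ne_zero.mpr hxl
  rw [sysCoeff_eq _ hx hl hxl ht ht1] at hgx
  have dl := (hasDerivAt_id x).sub_const l
  have d := (((hfx.div dl hxl').const_mul m).add (hgx.div (hasDerivAt_cubic t x) hD)).sub
    (hfx.div (dl.pow 2) (pow_ne_zero 2 hxl'))
  rw [heq.deriv_eq, h1x.self_of_nhds.deriv, normalP1_eq]
  refine (congrArg (· + _ + _) d.deriv).trans ?_
  rw [cubicDeriv_eq hx]
  simp only [id, shiftedMu, Pi.pow_apply]
  generalize normalP2 (theta n) l (m + _) t x = P at *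
  generalize f x = f0 at *
  generalize g x = g0 at *
  generalize 1 / x + 1 / (x - 1) + 1 / (x - t) = c at *
  generalize cubic t x = D at *
  push_cast
  field_simp
  ring

lemma hasDerivAt_matrix {W : ℂ → Matrix (Fin 2) (Fin 2) ℂ} {W' : Matrix (Fin 2) (Fin 2) ℂ} :
    HasDerivAt W W' x ↔ ∀ i j, HasDerivAt (fun y => W y i j) (W' i j) x := by
  have h1 : HasDerivAt W W' x ↔ ∀ i, HasDerivAt (fun y => W y i) (W' i) x :=
    hasDerivAt_pi (φ := (W : ℂ → Fin 2 → Fin 2 → ℂ)) (φ' := W')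
  rw [h1]
  exact forall_congr' fun i => hasDerivAt_pi

lemma analyticAt_matrix {W : ℂ → Matrix (Fin 2) (Fin 2) ℂ} (h : ∀ i j, AnalyticAt ℂ (fun y => W y i j) x) :
    AnalyticAt ℂ W x := by
  rw [Complex.analyticAt_iff_eventually_differentiableAt]
  have : ∀ᶠ y in 𝓝 x, ∀ i j, DifferentiableAt ℂ (fun y => W y i j) y := by
    simp only [eventually_all]
    exact fun i j => Complex.analyticAt_iff_eventually_differentiableAt.mp (h i j)
  filter_upwards [this] with y hy
  exact (hasDerivAt_matrix (W' := fun i j => deriv (fun y => W y i j) y).mpr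
    fun i j => (hy i j).hasDerivAt).differentiableAt

lemma analyticAt_sysCoeff (θ : Fin 5 → ℂ) (hx : x ∈ punctured t) (hl : l ∈ punctured t) :
    AnalyticAt ℂ (sysCoeff θ l t m) x := by
  have h1 : cubic t x * cubic t l ≠ 0 := mul_ne_zero (cubic_ne_zero hx) (cubic_ne_zero hl)
  unfold sysCoeff cubicDiff expQuadDiff expQuad
  simp only [cubic] at h1 ⊢
  fun_prop (disch := exact h1)

/-- The point `x = l` is not excluded, so homotopies in `ℂ \ {0, 1, t}` may sweep across `λ`. -/
lemma analyticAt_sysMatrix (θ : Fin 5 → ℂ) (hx : x ∈ punctured t) (hl : l ∈ punctured t) :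
    AnalyticAt ℂ (sysMatrix θ l t m) x := by
  have h2 : AnalyticAt ℂ (fun x => (x - l) / cubic t x) x := by
    have h1 := cubic_ne_zero hx
    simp only [cubic] at h1 ⊢
    fun_prop (disch := exact h1)
  apply analyticAt_matrix
  intro i j
  fin_cases i <;> fin_cases j
  · exact analyticAt_const
  · exact h2
  · exact (analyticAt_sysCoeff θ hx hl).neg
  · exact analyticAt_const

lemma sysMatrix_trace (θ : Fin 5 → ℂ) (l t m x : ℂ) : (sysMatrix θ l t m x).trace = 0 := by
  simp [sysMatrix, Matrix.trace_fin_two]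

/-- The matrix of solutions of the first order system given by two solutions of the normal form. -/
def sysSolution (l t m : ℂ) (F : Fin 2 → ℂ → ℂ) (x : ℂ) : Matrix (Fin 2) (Fin 2) ℂ :=
  !![(x - l) * F 0 x, (x - l) * F 1 x; sysSecond l t m (F 0) x, sysSecond l t m (F 1) x]

variable {x₀ : ℂ}

lemma isLocalSol_sysSolution {F : Fin 2 → ℂ → ℂ} (hx₀ : x₀ ∈ punctured t) (hxl₀ : x₀ ≠ l)
    (hl : l ∈ punctured t) (ht : t ≠ 0) (ht1 : t ≠ 1)
    (hF : IsFundamentalSystem (normalP1 (theta n) l t)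
      (normalP2 (theta n) l (shiftedMu (theta n) l t m) t) x₀ F) :
    IsLocalSol (sysMatrix (theta n) l t m) (sysSolution l t m F) x₀ := by
  have hreg : ∀ᶠ x in 𝓝 x₀, x ∈ punctured t ∧ x ≠ l :=
    ((isOpen_punctured t).eventually_mem hx₀).and (isOpen_ne.eventually_mem hxl₀)
  have ha : ∀ᶠ x in 𝓝 x₀, ∀ i, AnalyticAt ℂ (F i) x :=
    eventually_all.mpr fun i => (hF.analytic i).eventually_analyticAt
  have hs := eventually_all.mpr hF.solves
  filter_upwards [hreg, ha, hs] with x ⟨hx, hxl⟩ hax hsx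
  have k1 := fun i => hasDerivAt_sysFirst (m := m) (hax i).differentiableAt hx hxl
  have k2 := fun i => hasDerivAt_sysSecond (hax i) hx hxl hl ht ht1 (hsx i)
  refine hasDerivAt_matrix.mpr fun i j => ?_
  fin_cases i <;> fin_cases j
  · exact (k1 0).congr_deriv (by simp [sysMatrix, sysSolution, Matrix.mul_apply])
  · exact (k1 1).congr_deriv (by simp [sysMatrix, sysSolution, Matrix.mul_apply])
  · exact (k2 0).congr_deriv (by simp [sysMatrix, sysSolution, Matrix.mul_apply])
  · exact (k2 1).congr_deriv (by simp [sysMatrix, sysSolution, Matrix.mul_apply])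

/-- A matrix whose kernel is trivial on a subspace of constant solutions is invertible. -/
lemma isUnit_of_independent {A W : ℂ → Matrix (Fin 2) (Fin 2) ℂ} (hA : AnalyticAt ℂ A x₀)
    (hW : IsLocalSol A W x₀)
    (h : ∀ c : Fin 2 → ℂ, (∀ᶠ x in 𝓝 x₀, ∑ i, c i * W x 0 i = 0) → c = 0) : IsUnit (W x₀) := by
  rw [← Matrix.mulVec_injective_iff_isUnit]
  refine (injective_iff_map_eq_zero (W x₀).mulVecLin).mpr fun c hc' => h c ?_
  have h1 := hW.mul_const (Matrix.of fun i _ => c i)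
  have h2 : IsLocalSol A (fun _ => (0 : Matrix (Fin 2) (Fin 2) ℂ)) x₀ :=
    Eventually.of_forall fun x => by simpa using hasDerivAt_const x (0 : Matrix (Fin 2) (Fin 2) ℂ)
  have h3 := h1.eventuallyEq hA h2 (by
    ext i j
    exact congrFun hc' i)
  filter_upwards [h3] with x hx
  have := congrFun (congrFun hx 0) 0
  simpa [Matrix.mul_apply, Fin.sum_univ_two, mul_comm] using this

lemma isUnit_sysSolution {F : Fin 2 → ℂ → ℂ} (hx₀ : x₀ ∈ punctured t) (hxl₀ : x₀ ≠ l)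
    (hl : l ∈ punctured t) (ht : t ≠ 0) (ht1 : t ≠ 1)
    (hF : IsFundamentalSystem (normalP1 (theta n) l t)
      (normalP2 (theta n) l (shiftedMu (theta n) l t m) t) x₀ F) :
    IsUnit (sysSolution l t m F x₀) := by
  refine isUnit_of_independent (analyticAt_sysMatrix _ hx₀ hl)
    (isLocalSol_sysSolution hx₀ hxl₀ hl ht ht1 hF) fun c hc => hF.independent c ?_
  filter_upwards [hc, isOpen_ne.eventually_mem hxl₀] with x hx hxl
  rw [← mul_right_inj' (sub_ne_zero.mpr hxl), mul_zero, ← hx, Finset.mul_sum]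
  refine Finset.sum_congr rfl fun i _ => ?_
  fin_cases i <;> simp [sysSolution] <;> ring

/-- A linear relation between the first components passes, by differentiation, to the second ones,
because `(x - l) / cubic t x` does not vanish at `x₀`. It then lies in the kernel of an invertible
matrix. -/
lemma isFundamentalSystem_of_isLocalSol {W : ℂ → Matrix (Fin 2) (Fin 2) ℂ} (hx₀ : x₀ ∈ punctured t)
    (hxl₀ : x₀ ≠ l) (hl : l ∈ punctured t) (ht : t ≠ 0) (ht1 : t ≠ 1)
    (hW : IsLocalSol (sysMatrix (theta n) l t m) W x₀) (hu : IsUnit (W x₀)) :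
    IsFundamentalSystem (normalP1 (theta n) l t)
      (normalP2 (theta n) l (shiftedMu (theta n) l t m) t) x₀ (fun j x => W x 0 j / (x - l)) := by
  have hd : ∀ i j, ∀ᶠ x in 𝓝 x₀, HasDerivAt (fun y => W y i j)
      ((sysMatrix (theta n) l t m x * W x) i j) x := fun i j =>
    hW.mono fun x hx => hasDerivAt_matrix.mp hx i j
  have hxl₀' := sub_ne_zero.mpr hxl₀
  have h0 : ∀ j, ∀ᶠ x in 𝓝 x₀, HasDerivAt (fun y => W y 0 j)
      (m * W x 0 j + (x - l) / cubic t x * W x 1 j) x := fun j => by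
    filter_upwards [hd 0 j] with x hx
    exact hx.congr_deriv (by simp [sysMatrix, Matrix.mul_apply, Fin.sum_univ_two])
  have h1 : ∀ j, ∀ᶠ x in 𝓝 x₀, HasDerivAt (fun y => W y 1 j)
      (-sysCoeff (theta n) l t m x * W x 0 j + -m * W x 1 j) x := fun j => by
    filter_upwards [hd 1 j] with x hx
    exact hx.congr_deriv (by simp [sysMatrix, Matrix.mul_apply, Fin.sum_univ_two])
  have han : ∀ j, AnalyticAt ℂ (fun x => W x 0 j) x₀ := fun j =>
    Complex.analyticAt_iff_eventually_differentiableAt.mpr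
      ((h0 j).mono fun x hx => hx.differentiableAt)
  refine ⟨fun j => (han j).div (by fun_prop) hxl₀', fun j =>
    sys_solution hx₀ hxl₀ hl ht ht1 (h0 j) (h1 j), fun c hc => ?_⟩
  have hz : ∀ᶠ x in 𝓝 x₀, x ≠ l ∧ x ∈ punctured t ∧ ∑ j, c j * W x 0 j = 0 := by
    filter_upwards [hc, isOpen_ne.eventually_mem hxl₀, (isOpen_punctured t).eventually_mem hx₀]
      with x hx hxl hxp
    refine ⟨hxl, hxp, ?_⟩
    have := congrArg (· * (x - l)) hx
    simpa only [Finset.sum_mul, mul_assoc, div_mul_cancel₀ _ (sub_ne_zero.mpr hxl), zero_mul]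
      using this
  have hz1 : ∑ j, c j * W x₀ 1 j = 0 := by
    have hdz : HasDerivAt (fun x => ∑ j, c j * W x 0 j) _ x₀ :=
      HasDerivAt.fun_sum fun j _ => (h0 j).self_of_nhds.const_mul (c j)
    have e1 : (fun x => ∑ j, c j * W x 0 j) =ᶠ[𝓝 x₀] fun _ => 0 := hz.mono fun x hx => hx.2.2
    have e2 := (hdz.congr_of_eventuallyEq e1.symm).unique (hasDerivAt_const x₀ (0 : ℂ))
    have e3 := hz.self_of_nhds.2.2
    simp only [Fin.sum_univ_two] at e2 e3 ⊢
    have : (x₀ - l) / cubic t x₀ * (c 0 * W x₀ 1 0 + c 1 * W x₀ 1 1) = 0 := by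
      linear_combination e2 - m * e3
    exact (mul_eq_zero.mp this).resolve_left (div_ne_zero hxl₀' (cubic_ne_zero hx₀))
  have hker : (W x₀).mulVec c = 0 := by
    ext i
    fin_cases i
    · simpa [Matrix.mulVec, dotProduct, Fin.sum_univ_two, mul_comm (W x₀ _ _)] using
        hz.self_of_nhds.2.2
    · simpa [Matrix.mulVec, dotProduct, Fin.sum_univ_two, mul_comm (W x₀ _ _)] using hz1
  have := Matrix.mulVec_injective_iff_isUnit.mpr hu
  exact this (hker.trans (Matrix.mulVec_zero _).symm)

end System

/-! ### Determinants and local monodromies -/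

section LocalMonodromy

open unitInterval

attribute [local instance] Matrix.linftyOpNormedRing Matrix.linftyOpNormedAlgebra

/-- Liouville's formula. -/
lemma hasDerivAt_det {A : ℂ → Matrix (Fin 2) (Fin 2) ℂ} {W : ℂ → Matrix (Fin 2) (Fin 2) ℂ} {x : ℂ}
    (h : HasDerivAt W (A x * W x) x) :
    HasDerivAt (fun y => (W y).det) ((A x).trace * (W x).det) x := by
  have d := hasDerivAt_matrix.mp h
  simp only [Matrix.det_fin_two]
  refine (((d 0 0).mul (d 1 1)).sub ((d 0 1).mul (d 1 0))).congr_deriv ?_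
  simp only [Matrix.mul_apply, Fin.sum_univ_two, Matrix.trace_fin_two]
  ring

/-- The transport of a trace free system has determinant one. -/
lemma IsTransport.det_eq_one {A : ℂ → Matrix (Fin 2) (Fin 2) ℂ} {γ : I → ℂ} (hγ : Continuous γ)
    {T : Matrix (Fin 2) (Fin 2) ℂ} (hT : IsTransport A γ T) (htr : ∀ x, (A x).trace = 0) :
    T.det = 1 := by
  obtain ⟨w, hw, w0, w1⟩ := hT
  have hloc : IsLocallyConstant fun s => (w s).det := by
    rw [IsLocallyConstant.iff_eventually_eq]
    intro s
    obtain ⟨W, hW, hws⟩ := hw s (Set.mem_univ _)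
    rw [nhdsWithin_univ] at hws
    obtain ⟨r, hr, hball⟩ := Metric.eventually_nhds_iff_ball.mp hW
    have hnear := (hγ.continuousAt (x := s)).eventually (Metric.ball_mem_nhds (γ s) hr)
    filter_upwards [hws, hnear] with s' h1 h2
    rw [h1, hws.self_of_nhds]
    refine (convex_ball (γ s) r).is_const_of_fderivWithin_eq_zero (𝕜 := ℂ)
      (f := fun y => (W y).det) ?_ ?_ h2 (Metric.mem_ball_self hr)
    · exact fun x hx => (hasDerivAt_det (hball x hx)).differentiableAt.differentiableWithinAt
    · intro x hx
      have := hasDerivAt_det (hball x hx)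
      rw [htr, zero_mul] at this
      rw [fderivWithin_of_isOpen Metric.isOpen_ball hx, this.hasFDerivAt.fderiv]
      ext; simp
  have := hloc.apply_eq_of_isPreconnected isPreconnected_univ (Set.mem_univ 1) (Set.mem_univ 0)
  simpa [w0, w1] using this

variable {𝔸 : Type*} [NormedRing 𝔸] [NormedAlgebra ℂ 𝔸] [CompleteSpace 𝔸]

/-- Going along `δ`, around the circle and back conjugates the transport around the circle. The
statement is for any class function, since it serves for the trace of the matrix system and for the
identity map of scalar systems. -/
lemma EncirclesOnce.exists_circle {S : Set ℂ} {A : ℂ → 𝔸} (hA : ∀ x ∈ S, AnalyticAt ℂ A x) {a x₀ : ℂ}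
    {γ : Path x₀ x₀} (h : EncirclesOnce S a γ) {T : 𝔸} (hT : IsTransport A γ T) :
    ∃ r > 0, Metric.closedBall a r \ {a} ⊆ S ∧ ∃ Tc : 𝔸, IsTransport A (circlePath a r) Tc ∧
      ∀ {R : Type} [AddCommGroup R] (tr : 𝔸 → R), (∀ x y, tr (x * y) = tr (y * x)) → tr T = tr Tc := by
  obtain ⟨r, δ, hr, hS, hγ⟩ := h
  have hc : ∀ s, circlePath a r s ∈ S := fun s => hS ⟨by
    rw [Metric.mem_closedBall, dist_eq_norm]
    exact (norm_circle_sub a hr.le s).le, circlePath_ne hr s⟩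
  have hT' := hT.homotopicIn hA hγ
  have hδ : ∀ s, δ s ∈ S := by
    obtain ⟨H, hH⟩ := hγ
    have h1 : ∀ u, ((δ.trans (circlePath a r)).trans δ.symm) u ∈ S := fun u => by
      have := hH (1, u); rwa [H.apply_one] at this
    have h2 : Set.range δ.symm ⊆ S := by
      refine subset_trans ?_ (Set.range_subset_iff.mpr h1)
      rw [Path.trans_range]
      exact Set.subset_union_right
    rw [Path.symm_range] at h2
    exact fun s => h2 ⟨s, rfl⟩
  obtain ⟨Tδ, hTδ⟩ := exists_isTransport (A := A) (fun s => hA _ (hδ s)) δ.continuous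
  obtain ⟨Ts, hTs⟩ := exists_isTransport (A := A) (γ := δ.symm) (fun s => hA _ (hδ _))
    δ.symm.continuous
  obtain ⟨Tc, hTc⟩ := exists_isTransport (A := A) (fun s => hA _ (hc s)) (circlePath a r).continuous
  have hA' : ∀ s, AnalyticAt ℂ A ((δ.trans (circlePath a r)) s) := fun s => by
    have : (δ.trans (circlePath a r)) s ∈ Set.range δ ∪ Set.range (circlePath a r) := by
      rw [← Path.trans_range]; exact ⟨s, rfl⟩
    rcases this with ⟨u, hu⟩ | ⟨u, hu⟩
    · rw [← hu]; exact hA _ (hδ u)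
    · rw [← hu]; exact hA _ (hc u)
  have h2 := (hTδ.trans (fun s => hA _ (hδ s)) hTc).trans hA' hTs
  have hA'' : ∀ s, AnalyticAt ℂ A (((δ.trans (circlePath a r)).trans δ.symm) s) := fun s => by
    obtain ⟨H, hH⟩ := hγ
    have := hH (1, s)
    rw [H.apply_one] at this
    exact hA _ this
  have he := hT'.unique hA'' (Path.continuous _) h2
  have hinv : Tδ * Ts = 1 := hTδ.mul_symm (fun s => hA _ (hδ s)) δ.continuous hTs
  refine ⟨r, hr, hS, Tc, hTc, fun tr htr => ?_⟩
  rw [he, htr, mul_assoc, hinv, mul_one]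

lemma tendsto_matrix {f : ℂ → Matrix (Fin 2) (Fin 2) ℂ} {L : Filter ℂ} {B : Matrix (Fin 2) (Fin 2) ℂ}
    (h : ∀ i j, Tendsto (fun x => f x i j) L (𝓝 (B i j))) : Tendsto f L (𝓝 B) :=
  tendsto_pi_nhds.mpr fun i => tendsto_pi_nhds.mpr fun j => h i j

/-- At a simple pole with residue `B`, `B ^ 2 = (ϑ / 2) ^ 2`, the trace of the local monodromy
vanishes if `cos (π ϑ) = 0`. -/
lemma trace_circle_eq_zero {A : ℂ → Matrix (Fin 2) (Fin 2) ℂ} {a : ℂ} {r : ℝ} (hr : 0 < r)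
    (hA : ∀ x ∈ Metric.closedBall a r \ {a}, AnalyticAt ℂ A x) {B : Matrix (Fin 2) (Fin 2) ℂ}
    (hB : Tendsto (fun x => (x - a) • A x) (𝓝[≠] a) (𝓝 B)) {k : ℕ}
    (hB2 : B * B = ((((k : ℂ) + 1 / 2) / 2) ^ 2) • (1 : Matrix (Fin 2) (Fin 2) ℂ))
    (htr : B.trace = 0) {T : Matrix (Fin 2) (Fin 2) ℂ} (hT : IsTransport A (circlePath a r) T) :
    T.trace = 0 := by
  set κ : ℂ := Real.pi * Complex.I * ((k : ℂ) + 1 / 2) with hκ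
  have hκ0 : κ ≠ 0 := by
    refine mul_ne_zero (mul_ne_zero (by exact_mod_cast Real.pi_ne_zero) Complex.I_ne_zero) ?_
    have : ((k : ℂ) + 1 / 2) = ((k + 1 / 2 : ℝ) : ℂ) := by push_cast; rfl
    rw [this]
    exact_mod_cast (by positivity : (k + 1 / 2 : ℝ) ≠ 0)
  -- This is `exp(2πi s B)`, written out with `(2πi B)² = κ²`. As `B` has trace zero, the trace at
  -- `s = 1` is `2 cosh κ = 2 cos(π (k + 1/2)) = 0`.
  set V : ℝ → Matrix (Fin 2) (Fin 2) ℂ := fun s => Complex.cosh (κ * s) • (1 : Matrix (Fin 2) (Fin 2) ℂ) +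
    (Complex.sinh (κ * s) / κ) • ((2 * Real.pi * Complex.I) • B) with hV
  have hcosh : Complex.cosh κ = 0 := by
    rw [hκ, show (Real.pi * Complex.I * ((k : ℂ) + 1 / 2)) = (((2 * (k : ℤ) + 1 : ℤ) : ℂ) * Real.pi / 2) * Complex.I by
      push_cast; ring, Complex.cosh_mul_I]
    refine Complex.cos_eq_zero_iff.mpr ⟨k, by push_cast; ring⟩
  have key := trace_transport_circle hr hA hB (V := V) (by simp [hV]) ?_
    (LinearMap.toContinuousLinearMap (Matrix.traceLinearMap (Fin 2) ℂ ℂ)) ?_ hT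
  · change T.trace = (V 1).trace at key
    rw [key, hV]
    simp [hcosh, Matrix.trace_smul, htr]
  · intro s
    have d0 : HasDerivAt (fun s : ℝ => κ * (s : ℂ)) κ s := by
      simpa using (Complex.ofRealCLM.hasDerivAt (x := s)).const_mul κ
    have d1 := (Complex.hasDerivAt_cosh (κ * s)).comp s d0
    have d2 := ((Complex.hasDerivAt_sinh (κ * s)).comp s d0).div_const κ
    refine ((d1.smul_const (1 : Matrix (Fin 2) (Fin 2) ℂ)).add
      (d2.smul_const ((2 * (Real.pi : ℂ) * Complex.I) • B))).congr_deriv ?_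
    rw [hV]
    simp only [mul_add, smul_add, Matrix.mul_smul, hB2, mul_one, smul_smul, mul_div_cancel_right₀ _ hκ0]
    rw [add_comm]
    congr 2
    · ring
    · rw [hκ]
      field_simp
  · exact fun x y => Matrix.trace_mul_comm x y

/-- At a root `a` of the cubic the divided differences collapse: the singular numerator `N` of
`sysCoeff` satisfies `(a - l) N(a) = -cubic(l) expQuad(a)²`. The residue then squares to `(ϑ / 2)²`,
so the exponents are `± ϑ / 2`. -/
lemma tendsto_residue (θ : Fin 5 → ℂ) {l t m a ϑ : ℂ} (hl : l ∈ punctured t) (hal : a ≠ l) {q : ℂ → ℂ}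
    (hq : ContinuousAt q a) (hqa : q a ≠ 0) (hcubic : ∀ x, cubic t x = (x - a) * q x)
    (hexp : expQuad θ t a = ϑ / 2 * q a) :
    Tendsto (fun x => (x - a) • sysMatrix θ l t m x) (𝓝[≠] a)
      (𝓝 !![0, (a - l) / q a; q a * ϑ ^ 2 / (4 * (a - l)), 0]) := by
  have hl0 := cubic_ne_zero hl
  have hal' := sub_ne_zero.mpr hal
  have hla : l - a ≠ 0 := sub_ne_zero.mpr hal.symm
  have h1 : Tendsto (fun x => (x - a) * m) (𝓝[≠] a) (𝓝 0) := by
    have : ContinuousAt (fun x => (x - a) * m) a := by fun_prop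
    simpa using this.tendsto.mono_left nhdsWithin_le_nhds
  have h2 : Tendsto (fun x => (x - a) * ((x - l) / cubic t x)) (𝓝[≠] a) (𝓝 ((a - l) / q a)) := by
    have : ContinuousAt (fun x => (x - l) / q x) a := by fun_prop (disch := exact hqa)
    refine (this.tendsto.mono_left nhdsWithin_le_nhds).congr' ?_
    filter_upwards [self_mem_nhdsWithin] with x hx
    rw [hcubic]
    have : x - a ≠ 0 := sub_ne_zero.mpr hx
    field_simp
  have h3 : Tendsto (fun x => (x - a) * -sysCoeff θ l t m x) (𝓝[≠] a)
      (𝓝 (q a * ϑ ^ 2 / (4 * (a - l)))) := by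
    set N : ℂ → ℂ := fun x => expQuad θ t l ^ 2 * cubicDiff l t x -
      cubic t l * expQuadDiff θ l t x * (expQuad θ t x + expQuad θ t l) with hN
    set Q : ℂ → ℂ := fun x => θ 0 * (θ 0 + θ 4) + cubicDiff l t x * m ^ 2 +
      m * (2 * x + l - (1 + t)) + (θ 1 + θ 2 + θ 3) / 2 with hQ
    have hQc : ContinuousAt Q a := by
      unfold Q cubicDiff; fun_prop
    have hNc : ContinuousAt N a := by
      unfold N cubicDiff expQuadDiff expQuad; fun_prop
    have hc : ContinuousAt (fun x => -((x - a) * Q x) - N x / (q x * cubic t l)) a := by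
      fun_prop (disch := exact mul_ne_zero hqa hl0)
    have hval : -((a - a) * Q a) - N a / (q a * cubic t l) = q a * ϑ ^ 2 / (4 * (a - l)) := by
      have e1 : (a - l) * N a = -cubic t l * (ϑ / 2 * q a) ^ 2 := by
        have e2 : (a - l) * cubicDiff l t a = -cubic t l := by
          have : cubic t a = 0 := by rw [hcubic]; ring
          simp only [cubic, cubicDiff] at this ⊢
          linear_combination this
        have e3 : (a - l) * expQuadDiff θ l t a = ϑ / 2 * q a - expQuad θ t l := by
          rw [← hexp]
          simp only [expQuadDiff, expQuad]
          ring
        rw [hN]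
        simp only [hexp]
        linear_combination (expQuad θ t l ^ 2) * e2 - cubic t l * (ϑ / 2 * q a + expQuad θ t l) * e3
      have e4 : N a = -cubic t l * (ϑ / 2 * q a) ^ 2 / (a - l) := by
        rw [← e1]; field_simp
      rw [e4]
      field_simp
      ring
    rw [← hval]
    refine (hc.tendsto.mono_left nhdsWithin_le_nhds).congr' ?_
    filter_upwards [self_mem_nhdsWithin, (hq.eventually_ne hqa).filter_mono nhdsWithin_le_nhds]
      with x hx hqx
    have : x - a ≠ 0 := sub_ne_zero.mpr hx
    change _ = (x - a) * -(Q x + N x / (cubic t x * cubic t l))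
    rw [hcubic x]
    field_simp
    ring
  refine tendsto_matrix fun i j => ?_
  fin_cases i <;> fin_cases j
  · exact h1
  · exact h2
  · exact h3
  · simpa [sysMatrix] using h1.neg

/-- The local monodromies of the regular system have trace zero. -/
lemma trace_eq_zero_of_encircles {θ : Fin 5 → ℂ} {l t m a : ℂ} (k : ℕ) (hl : l ∈ punctured t) (hal : a ≠ l)
    {q : ℂ → ℂ} (hq : ContinuousAt q a) (hqa : q a ≠ 0) (hcubic : ∀ x, cubic t x = (x - a) * q x)
    (hexp : expQuad θ t a = ((k : ℂ) + 1 / 2) / 2 * q a) {x₀ : ℂ} {γ : Path x₀ x₀}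
    (hγ : EncirclesOnce (punctured t) a γ) {T : Matrix (Fin 2) (Fin 2) ℂ}
    (hT : IsTransport (sysMatrix θ l t m) γ T) : T.trace = 0 := by
  obtain ⟨r, hr, hS, Tc, hTc, htr⟩ := hγ.exists_circle (fun x hx => analyticAt_sysMatrix θ hx hl) hT
  rw [htr Matrix.trace Matrix.trace_mul_comm]
  refine trace_circle_eq_zero (k := k) hr (fun x hx => analyticAt_sysMatrix θ (hS hx) hl)
    (tendsto_residue θ hl hal hq hqa hcubic hexp) ?_ ?_ hTc
  · have hal' := sub_ne_zero.mpr hal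
    ext i j
    fin_cases i <;> fin_cases j <;> simp [Matrix.mul_apply, Fin.sum_univ_two] <;> field_simp <;> ring
  · simp [Matrix.trace_fin_two]

variable {n : Fin 4 → ℕ} {l t m x₀ : ℂ} {T : Matrix (Fin 2) (Fin 2) ℂ} {γ : Path x₀ x₀}

lemma trace_eq_zero_of_encircles_zero (hl : l ∈ punctured t) (ht : t ≠ 0)
    (hγ : EncirclesOnce (punctured t) 0 γ) (hT : IsTransport (sysMatrix (theta n) l t m) γ T) :
    T.trace = 0 :=
  trace_eq_zero_of_encircles (n 1) (q := fun x => (x - 1) * (x - t)) hl hl.1.symm (by fun_prop)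
    (by simpa using ht) (fun x => by rw [cubic]; ring) (by simp [expQuad, theta]) hγ hT

lemma trace_eq_zero_of_encircles_one (hl : l ∈ punctured t) (ht : t ≠ 1)
    (hγ : EncirclesOnce (punctured t) 1 γ) (hT : IsTransport (sysMatrix (theta n) l t m) γ T) :
    T.trace = 0 :=
  trace_eq_zero_of_encircles (n 2) (q := fun x => x * (x - t)) hl hl.2.1.symm (by fun_prop)
    (by simpa using sub_ne_zero.mpr ht.symm) (fun x => by rw [cubic]; ring)
    (by simp [expQuad, theta]) hγ hT

lemma trace_eq_zero_of_encircles_t (hl : l ∈ punctured t) (ht : t ≠ 0) (ht1 : t ≠ 1)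
    (hγ : EncirclesOnce (punctured t) t γ) (hT : IsTransport (sysMatrix (theta n) l t m) γ T) :
    T.trace = 0 :=
  trace_eq_zero_of_encircles (n 3) (q := fun x => x * (x - 1)) hl hl.2.2.symm (by fun_prop)
    (by simpa using ⟨ht, sub_ne_zero.mpr ht1⟩) (fun x => by rw [cubic]; ring)
    (by simp [expQuad, theta]) hγ hT

/-- The scalar system whose monodromy around each puncture is `i`. -/
def quarterLogDeriv (t x : ℂ) : ℂ := 1 / 4 * (1 / x + 1 / (x - 1) + 1 / (x - t))

lemma analyticAt_quarterLogDeriv {x : ℂ} (hx : x ∈ punctured t) :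
    AnalyticAt ℂ (quarterLogDeriv t) x := by
  obtain ⟨x0, x1, xt⟩ := hx
  rw [← sub_ne_zero] at x1 xt
  unfold quarterLogDeriv
  exact analyticAt_const.mul (((analyticAt_const.div analyticAt_id x0).add
    (analyticAt_const.div (analyticAt_id.sub analyticAt_const) x1)).add
    (analyticAt_const.div (analyticAt_id.sub analyticAt_const) xt))

/-- The transport of a scalar system along a loop around a pole with residue `1 / 4`. -/
lemma transport_eq_I {a : ℂ → ℂ} {S : Set ℂ} (ha : ∀ x ∈ S, AnalyticAt ℂ a x) {c : ℂ}
    (hres : Tendsto (fun x => (x - c) • a x) (𝓝[≠] c) (𝓝 (1 / 4)))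
    (hγ : EncirclesOnce S c γ) {T : ℂ} (hT : IsTransport a γ T) : T = Complex.I := by
  obtain ⟨r, hr, hS, Tc, hTc, htr⟩ := hγ.exists_circle ha hT
  have h1 : T = Tc := htr id fun x y => mul_comm x y
  have key := trace_transport_circle hr (fun x hx => ha x (hS hx)) hres
    (V := fun s => Complex.exp (2 * Real.pi * Complex.I * (1 / 4) * s)) (by simp) ?_
    (ContinuousLinearMap.id ℂ ℂ) (fun x y => mul_comm x y) hTc
  · rw [h1]
    refine key.trans (Eq.trans ?_ Complex.exp_pi_div_two_mul_I)
    simp only [ContinuousLinearMap.id_apply]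
    congr 1
    push_cast
    ring
  · intro s
    have d0 : HasDerivAt (fun s : ℝ => 2 * Real.pi * Complex.I * (1 / 4) * (s : ℂ))
        (2 * Real.pi * Complex.I * (1 / 4)) s := by
      simpa using (Complex.ofRealCLM.hasDerivAt (x := s)).const_mul (2 * Real.pi * Complex.I * (1 / 4))
    refine d0.cexp.congr_deriv ?_
    simp only [smul_eq_mul]
    ring

lemma tendsto_quarter {a b c : ℂ} (hab : a ≠ b) (hac : a ≠ c) : Tendsto
    (fun x => (x - a) • (1 / 4 * (1 / (x - a) + 1 / (x - b) + 1 / (x - c)))) (𝓝[≠] a) (𝓝 (1 / 4)) := by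
  have hab' := sub_ne_zero.mpr hab
  have hac' := sub_ne_zero.mpr hac
  have hc : ContinuousAt (fun x => 1 / 4 * (1 + (x - a) * (1 / (x - b) + 1 / (x - c)))) a := by
    fun_prop (disch := assumption)
  have h := hc.tendsto.mono_left (nhdsWithin_le_nhds (s := {a}ᶜ))
  simp only [sub_self, zero_mul, add_zero, mul_one] at h
  refine h.congr' ?_
  filter_upwards [self_mem_nhdsWithin] with x hx
  have : x - a ≠ 0 := sub_ne_zero.mpr hx
  rw [smul_eq_mul]
  have e : (x - a) * (1 / (x - a)) = 1 := by field_simp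
  linear_combination -1 / 4 * e

lemma quarter_transport (ht : t ≠ 0) (ht1 : t ≠ 1) {a : ℂ} (ha : a = 0 ∨ a = 1 ∨ a = t)
    (hγ : EncirclesOnce (punctured t) a γ) {T : ℂ} (hT : IsTransport (quarterLogDeriv t) γ T) :
    T = Complex.I := by
  refine transport_eq_I (fun x hx => analyticAt_quarterLogDeriv hx) ?_ hγ hT
  rcases ha with rfl | rfl | rfl
  · refine (tendsto_quarter (zero_ne_one' ℂ) ht.symm).congr fun x => ?_
    rw [quarterLogDeriv, sub_zero]
  · refine (tendsto_quarter (one_ne_zero' ℂ) ht1.symm).congr fun x => ?_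
    rw [quarterLogDeriv, sub_zero]; ring_nf
  · refine (tendsto_quarter ht ht1).congr fun x => ?_
    rw [quarterLogDeriv, sub_zero]; ring_nf

end LocalMonodromy

/-! ### The square root of `x - λ` along the lifted cycles -/

section ApparentSingularity

open unitInterval

variable {τ : UpperHalfPlane}

lemma xMap_ne_xMap {z w : ℂ} (hz : z ∉ (periods τ).lattice) (hw : w ∉ (periods τ).lattice)
    (h1 : z + w ∉ (periods τ).lattice) (h2 : z - w ∉ (periods τ).lattice) : xMap τ z ≠ xMap τ w := by
  by_cases h : 2 * w ∈ (periods τ).lattice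
  · intro h'
    refine weierstrassP_half_ne hw h hz h1 ?_
    change wp τ z = wp τ w
    rw [wp_eq, wp_eq, h']
  · exact xMap_sub_xMap_ne_zero h hz h1 h2

open Classical in
/-- The function `1 / (c - x(w))`, extended by zero to the poles of `x`. -/
def invSub (τ : UpperHalfPlane) (c w : ℂ) : ℂ :=
  if w ∈ (periods τ).lattice then 0 else 1 / (c - xMap τ w)

/-- At a pole `w` of `x`, the fraction is expanded by `(y - w)²`: the numerator then tends to `0`
and the denominator to `-1`, up to the scaling by `e₂ - e₁`. -/
lemma continuousAt_invSub {c w : ℂ} (h : w ∉ (periods τ).lattice → c ≠ xMap τ w) :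
    ContinuousAt (invSub τ c) w := by
  by_cases hw : w ∈ (periods τ).lattice
  · rw [continuousAt_iff_punctured_nhds, invSub, if_pos hw]
    have h0 := (tendsto_sq_mul_weierstrassP (L := periods τ)).comp (tendsto_sub_nhdsNE w)
    have hE : e τ 2 - e τ 1 ≠ 0 := e_sub_ne_zero
    have hc : ContinuousAt (fun y : ℂ => (y - w) ^ 2) w := by fun_prop
    have hc' := hc.tendsto.mono_left (nhdsWithin_le_nhds (s := {w}ᶜ))
    simp only [sub_self, ne_eq, OfNat.ofNat_ne_zero, not_false_eq_true, zero_pow] at hc'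
    have h1 := (hc'.mul_const (e τ 2 - e τ 1)).div
      ((hc'.mul_const ((e τ 2 - e τ 1) * c + e τ 1)).sub h0) (by simp)
    simp only [zero_mul, zero_div] at h1
    refine h1.congr' ?_
    filter_upwards [self_mem_nhdsWithin, eventually_notMem (periods τ) w] with y hy hyL
    have hyw : y - w ≠ 0 := sub_ne_zero.mpr hy
    have e1 : (periods τ).weierstrassP (y - w) = (e τ 2 - e τ 1) * xMap τ y + e τ 1 := by
      rw [← wp_eq, wp, sub_eq_add_neg, periodic_weierstrassP' (neg_mem hw)]
    simp only [Pi.div_apply, Function.comp_apply]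
    rw [invSub, if_neg hyL, e1]
    have e2 : (y - w) ^ 2 * ((e τ 2 - e τ 1) * c + e τ 1) -
        (y - w) ^ 2 * ((e τ 2 - e τ 1) * xMap τ y + e τ 1) =
        ((y - w) ^ 2 * (e τ 2 - e τ 1)) * (c - xMap τ y) := by ring
    rw [e2, ← div_div, div_self (mul_ne_zero (pow_ne_zero 2 hyw) hE)]
  · have h1 : ContinuousAt (fun y => 1 / (c - xMap τ y)) w :=
      continuousAt_const.div (continuousAt_const.sub (hasDerivAt_xMap hw).continuousAt)
        (sub_ne_zero.mpr (h hw))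
    refine h1.congr ?_
    filter_upwards [eventually_nhds_notMem hw] with y hy
    rw [invSub, if_neg hy]

lemma mem_cuts_of_sub {p z : ℂ} (s : I) (h : z - s * p ∈ (periods τ).lattice) : z ∈ cuts τ p :=
  ⟨_, h, by
    rw [sub_sub_cancel]
    refine ⟨(1 - s) / 2, (1 + s) / 2, by linarith [s.2.2], by linarith [s.2.1], by ring, ?_⟩
    simp only [Complex.real_smul]; push_cast; ring⟩

lemma mem_cuts_of_add {p z : ℂ} (s : I) (h : z + s * p ∈ (periods τ).lattice) : z ∈ cuts τ p :=
  ⟨_, h, by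
    rw [sub_add_cancel_left]
    refine ⟨(1 + s) / 2, (1 - s) / 2, by linarith [s.2.1], by linarith [s.2.2], by ring, ?_⟩
    simp only [Complex.real_smul]; push_cast; ring⟩

lemma notMem_lattice_of_notMem_cuts {p z : ℂ} (h : z ∉ cuts τ p) : z ∉ (periods τ).lattice :=
  fun hz => h (mem_cuts_of_sub 0 (by simpa using hz))

/-- The square root of `x - λ` has trivial monodromy along the images of paths that avoid the
cuts. -/
lemma half_transport {p q₀ : ℂ} (hp : p ∉ (periods τ).lattice) {ω : ℂ}
    {ℓ : Path q₀ (q₀ + ω)} (hℓ : ∀ s, ℓ s ∉ cuts τ p) {β : Path (xMap τ q₀) (xMap τ q₀)}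
    (hβ : ∀ s, β s = xMap τ (ℓ s)) {T : ℂ}
    (hT : IsTransport (fun x => 1 / 2 * (1 / (x - lamPoint τ p))) β T) : T = 1 := by
  have hne : ∀ s u : I, (s : ℂ) * p ∉ (periods τ).lattice → xMap τ (ℓ u) ≠ xMap τ (s * p) :=
    fun s u h => xMap_ne_xMap (notMem_lattice_of_notMem_cuts (hℓ u)) h
      (fun h' => hℓ u (mem_cuts_of_add s h')) (fun h' => hℓ u (mem_cuts_of_sub s h'))
  have hne0 : ∀ s : I, (s : ℂ) * p ∉ (periods τ).lattice → xMap τ q₀ ≠ xMap τ (s * p) := fun s h => by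
    simpa using hne s 0 h
  have h0l : xMap τ q₀ - lamPoint τ p ≠ 0 := sub_ne_zero.mpr (by
    have := hne0 1 (by simpa using hp)
    simpa [lamPoint] using this)
  -- A contraction of `β` in `ℂ \ {λ}`. Away from the poles, `(h(s, u) - λ) / (x(q₀) - λ)` equals
  -- `(x(ℓ u) - x(s p)) / (x(q₀) - x(s p))`; it is one where `x(s p)` is infinite, and it never
  -- vanishes because `ℓ` avoids `± s p + Λ`.
  set h : I × I → ℂ := fun y => lamPoint τ p + (xMap τ q₀ - lamPoint τ p) *
    (1 + (β y.2 - xMap τ q₀) * invSub τ (xMap τ q₀) (y.1 * p)) with hh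
  have hr : Continuous fun s : I => invSub τ (xMap τ q₀) (s * p) := by
    rw [continuous_iff_continuousAt]
    intro s
    exact ContinuousAt.comp (f := fun s : I => (s : ℂ) * p) (continuousAt_invSub (hne0 s))
      (by fun_prop)
  have hc : Continuous h := by
    have h1 : Continuous fun y : I × I => invSub τ (xMap τ q₀) (y.1 * p) := hr.comp continuous_fst
    have h2 : Continuous fun y : I × I => β y.2 := β.continuous.comp continuous_snd
    exact continuous_const.add (continuous_const.mul (continuous_const.add
      ((h2.sub continuous_const).mul h1)))
  have hnl : ∀ y, h y - lamPoint τ p ≠ 0 := by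
    rintro ⟨s, u⟩
    rw [hh]
    simp only [add_sub_cancel_left]
    refine mul_ne_zero h0l ?_
    by_cases hs : (s : ℂ) * p ∈ (periods τ).lattice
    · rw [invSub, if_pos hs]; simp
    · rw [invSub, if_neg hs, hβ]
      have h1 := sub_ne_zero.mpr (hne0 s hs)
      have h2 := sub_ne_zero.mpr (hne s u hs)
      rw [show 1 + (xMap τ (ℓ u) - xMap τ q₀) * (1 / (xMap τ q₀ - xMap τ (s * p))) =
        (xMap τ (ℓ u) - xMap τ (s * p)) / (xMap τ q₀ - xMap τ (s * p)) by field_simp; ring]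
      exact div_ne_zero h2 h1
  have hA : ∀ y, AnalyticAt ℂ (fun x => 1 / 2 * (1 / (x - lamPoint τ p))) (h y) := fun y => by
    have := hnl y
    fun_prop (disch := assumption)
  have e0 : ∀ u, h (0, u) = xMap τ q₀ := fun u => by
    rw [hh]
    have : invSub τ (xMap τ q₀) (((0 : I) : ℂ) * p) = 0 := by
      rw [invSub, if_pos]; simp
    simp only [this]; ring
  have e1 : ∀ u, h (1, u) = β u := fun u => by
    rw [hh]
    have : invSub τ (xMap τ q₀) (((1 : I) : ℂ) * p) = 1 / (xMap τ q₀ - lamPoint τ p) := by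
      rw [invSub, if_neg] <;> simp [hp, lamPoint]
    simp only [this]
    field_simp
    ring
  have es : ∀ s, h (s, 0) = xMap τ q₀ := fun s => by simp [hh]
  have es' : ∀ s, h (s, 1) = xMap τ q₀ := fun s => by simp [hh]
  have key := isTransport_square hA hc
    (isTransport_const (fun s => hA _) fun s s' => (e0 s).trans (e0 s').symm)
    (T₁ := T) (by simpa only [e1] using hT)
    (isTransport_const (fun s => hA _) fun s s' => (es s).trans (es s').symm)
    (isTransport_const (fun s => hA _) fun s s' => (es' s).trans (es' s').symm)
  simpa using key.symm

end ApparentSingularity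

/-! ### Uniqueness of analytic continuation and of monodromy matrices -/

section Continuation

open unitInterval

lemma IsTransport.mul_scalar {a₁ a₂ : ℂ → ℂ} {γ : I → ℂ} {T₁ T₂ : ℂ}
    (h₁ : IsTransport a₁ γ T₁) (h₂ : IsTransport a₂ γ T₂) :
    IsTransport (fun x => a₁ x + a₂ x) γ (T₁ * T₂) := by
  obtain ⟨w₁, hw₁, e₁, f₁⟩ := h₁
  obtain ⟨w₂, hw₂, e₂, f₂⟩ := h₂
  refine ⟨fun s => w₁ s * w₂ s, fun s hs => ?_, by simp [e₁, e₂], by simp [f₁, f₂]⟩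
  obtain ⟨W₁, hW₁, h₁⟩ := hw₁ s hs
  obtain ⟨W₂, hW₂, h₂⟩ := hw₂ s hs
  refine ⟨fun x => W₁ x * W₂ x, ?_, ?_⟩
  · filter_upwards [hW₁, hW₂] with x k₁ k₂
    exact (k₁.mul k₂).congr_deriv (by ring)
  · filter_upwards [h₁, h₂] with x k₁ k₂
    rw [k₁, k₂]

/-- The parameters at which the germs agree form an open set, and by the identity theorem on small
discs also a closed one. -/
lemma IsContinuationAlong.eventuallyEq {a b : ℂ} {γ : Path a b} {f g : I → ℂ → ℂ}
    (hf : IsContinuationAlong γ f) (hg : IsContinuationAlong γ g) (h : f 0 =ᶠ[𝓝 a] g 0) :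
    f 1 =ᶠ[𝓝 b] g 1 := by
  set S : Set I := {s | f s =ᶠ[𝓝 (γ s)] g s} with hS
  have hopen : IsOpen S := by
    rw [isOpen_iff_mem_nhds]
    intro s hs
    have h1 := (γ.continuous.continuousAt (x := s)).eventually (Filter.Eventually.eventually_nhds hs)
    filter_upwards [hf.compatible s, hg.compatible s, h1] with s' k1 k2 k3
    exact k1.trans (Filter.EventuallyEq.trans k3 k2.symm)
  have hclosed : IsClosed S := by
    rw [← isOpen_compl_iff, isOpen_iff_mem_nhds]
    intro s hs
    obtain ⟨r, hr, hball⟩ := Metric.eventually_nhds_iff_ball.mp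
      ((hf.analytic s).eventually_analyticAt.and (hg.analytic s).eventually_analyticAt)
    have h1 := (γ.continuous.continuousAt (x := s)).eventually (Metric.ball_mem_nhds (γ s) hr)
    filter_upwards [hf.compatible s, hg.compatible s, h1] with s' k1 k2 k3 k4
    apply hs
    have k5 : f s =ᶠ[𝓝 (γ s')] g s := k1.symm.trans (Filter.EventuallyEq.trans k4 k2)
    have := AnalyticOnNhd.eqOn_of_preconnected_of_eventuallyEq (fun x hx => (hball x hx).1)
      (fun x hx => (hball x hx).2) (convex_ball (γ s) r).isPreconnected k3 k5
    exact this.eventuallyEq_of_mem (Metric.ball_mem_nhds _ hr)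
  have huniv : S = Set.univ := IsClopen.eq_univ ⟨hclosed, hopen⟩ ⟨0, by
    simpa [hS] using h⟩
  have : (1 : I) ∈ S := huniv ▸ Set.mem_univ _
  simpa [hS] using this

lemma IsMonodromyMatrix.unique {P Q : ℂ → ℂ} {a b : ℂ} {γ : Path a b} {Y : Fin 2 → ℂ → ℂ}
    (hY : IsFundamentalSystem P Q a Y) {N N' : Matrix (Fin 2) (Fin 2) ℂ}
    (h : IsMonodromyMatrix γ Y N) (h' : IsMonodromyMatrix γ Y N') : N = N' := by
  obtain ⟨f, hf⟩ := h
  obtain ⟨g, hg⟩ := h'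
  ext i j
  obtain ⟨f1, f2, f3⟩ := hf i
  obtain ⟨g1, g2, g3⟩ := hg i
  have key := f1.eventuallyEq g1 (f2.trans g2.symm)
  have hc : Tendsto (fun z => z + (b - a)) (𝓝 a) (𝓝 b) := by
    have : ContinuousAt (fun z => z + (b - a)) a := by fun_prop
    simpa [ContinuousAt] using this
  have h0 := hY.independent (fun j => N i j - N' i j) (by
    filter_upwards [f3, g3, hc.eventually key] with z k1 k2 k3
    simp only [sub_mul, Finset.sum_sub_distrib]
    rw [← k1, ← k2, k3, sub_self])
  exact sub_eq_zero.mp (congrFun h0 j)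

lemma isMonodromyMatrix_iff {P Q : ℂ → ℂ} {a b : ℂ} {γ : Path a b} {Y : Fin 2 → ℂ → ℂ}
    (hY : IsFundamentalSystem P Q a Y) {N N' : Matrix (Fin 2) (Fin 2) ℂ}
    (h : IsMonodromyMatrix γ Y N) : IsMonodromyMatrix γ Y N' ↔ N' = N :=
  ⟨fun h' => h'.unique hY h, fun h' => h' ▸ h⟩

end Continuation

/-! ### From transports to monodromy matrices -/

section AntiConj

open Matrix

/-- The anti-automorphism of the matrix algebra that turns transports into monodromy matrices. -/
def antiConj (V U : (Matrix (Fin 2) (Fin 2) ℂ)ˣ) (T : Matrix (Fin 2) (Fin 2) ℂ) :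
    Matrix (Fin 2) (Fin 2) ℂ :=
  V * ((U⁻¹ : (Matrix (Fin 2) (Fin 2) ℂ)ˣ) * T * U : Matrix (Fin 2) (Fin 2) ℂ)ᵀ *
    (V⁻¹ : (Matrix (Fin 2) (Fin 2) ℂ)ˣ)

variable (V U : (Matrix (Fin 2) (Fin 2) ℂ)ˣ) (S T : Matrix (Fin 2) (Fin 2) ℂ)

/-- In a product of transports later paths stand on the left; transposition reverses this, and
monodromy matrices multiply in the order of the paths. -/
lemma antiConj_mul : antiConj V U (S * T) = antiConj V U T * antiConj V U S := by
  have h : ((U⁻¹ : (Matrix (Fin 2) (Fin 2) ℂ)ˣ) * (S * T) * U : Matrix (Fin 2) (Fin 2) ℂ) =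
      ((U⁻¹ : (Matrix (Fin 2) (Fin 2) ℂ)ˣ) * S * U) * ((U⁻¹ : (Matrix (Fin 2) (Fin 2) ℂ)ˣ) * T * U) := by
    simp only [mul_assoc, Units.mul_inv_cancel_left]
  rw [antiConj, antiConj, antiConj, h, Matrix.transpose_mul]
  simp only [mul_assoc, Units.inv_mul_cancel_left]

lemma antiConj_one : antiConj V U 1 = 1 := by simp [antiConj]

lemma trace_antiConj : (antiConj V U T).trace = T.trace := by
  rw [antiConj, Matrix.trace_mul_comm, Units.inv_mul_cancel_left, Matrix.trace_transpose,
    Matrix.trace_mul_comm, Units.mul_inv_cancel_left]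

lemma det_antiConj : (antiConj V U T).det = T.det := by
  rw [antiConj, Matrix.det_mul_comm, Units.inv_mul_cancel_left, Matrix.det_transpose,
    Matrix.det_mul_comm, Units.mul_inv_cancel_left]

-- Cayley-Hamilton.
variable {T} in
lemma mul_self_of_trace_eq_zero (h0 : T.trace = 0) (h1 : T.det = 1) : T * T = -1 := by
  rw [Matrix.trace_fin_two] at h0
  rw [Matrix.det_fin_two] at h1
  have h : T 1 1 = -T 0 0 := by linear_combination h0
  rw [h] at h1
  ext i j
  fin_cases i <;> fin_cases j <;> simp [Matrix.mul_apply, Fin.sum_univ_two, h] <;>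
    first | ring1 | linear_combination -h1

end AntiConj

/-! ### Fundamental systems, their change and their pull back -/

section FundamentalSystems

attribute [local instance] Matrix.linftyOpNormedRing Matrix.linftyOpNormedAlgebra

/-- The first order system of `y'' = V y`. -/
def companion (V : ℂ → ℂ) (z : ℂ) : Matrix (Fin 2) (Fin 2) ℂ := !![0, 1; V z, 0]

lemma analyticAt_companion {V : ℂ → ℂ} {a : ℂ} (hV : AnalyticAt ℂ V a) :
    AnalyticAt ℂ (companion V) a := by
  apply analyticAt_matrix
  intro i j
  fin_cases i <;> fin_cases j
  · exact analyticAt_const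
  · exact analyticAt_const
  · exact hV
  · exact analyticAt_const

/-- The Wronskian matrix. -/
def wronskian (Y : Fin 2 → ℂ → ℂ) (z : ℂ) : Matrix (Fin 2) (Fin 2) ℂ :=
  !![Y 0 z, Y 1 z; deriv (Y 0) z, deriv (Y 1) z]

lemma wronskian_zero (Y : Fin 2 → ℂ → ℂ) (z : ℂ) (j : Fin 2) : wronskian Y z 0 j = Y j z := by
  fin_cases j <;> rfl

variable {V : ℂ → ℂ} {a : ℂ} {Y y : Fin 2 → ℂ → ℂ}

lemma isLocalSol_wronskian (hY : IsFundamentalSystem (fun _ => 0) (fun z => -V z) a Y) :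
    IsLocalSol (companion V) (wronskian Y) a := by
  have ha : ∀ᶠ x in 𝓝 a, ∀ i, AnalyticAt ℂ (Y i) x :=
    eventually_all.mpr fun i => (hY.analytic i).eventually_analyticAt
  have hs := eventually_all.mpr hY.solves
  filter_upwards [ha, hs] with x hax hsx
  have k1 := fun i => (hax i).differentiableAt.hasDerivAt
  have k2 := fun i => (hax i).deriv.differentiableAt.hasDerivAt
  have k3 : ∀ i, deriv (deriv (Y i)) x = V x * Y i x := fun i => by linear_combination hsx i
  simp only [k3] at k2
  refine hasDerivAt_matrix.mpr fun i j => ?_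
  fin_cases i <;> fin_cases j
  · exact (k1 0).congr_deriv (by simp [companion, wronskian, Matrix.mul_apply])
  · exact (k1 1).congr_deriv (by simp [companion, wronskian, Matrix.mul_apply])
  · exact (k2 0).congr_deriv (by simp [companion, wronskian, Matrix.mul_apply])
  · exact (k2 1).congr_deriv (by simp [companion, wronskian, Matrix.mul_apply])

lemma isUnit_wronskian (hV : AnalyticAt ℂ V a)
    (hY : IsFundamentalSystem (fun _ => 0) (fun z => -V z) a Y) : IsUnit (wronskian Y a) := by
  refine isUnit_of_independent (analyticAt_companion hV) (isLocalSol_wronskian hY) fun c hc => ?_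
  simp only [wronskian_zero] at hc
  exact hY.independent c hc

/-- Two fundamental systems differ by a constant invertible matrix. -/
lemma IsFundamentalSystem.exists_change (hV : AnalyticAt ℂ V a)
    (hY : IsFundamentalSystem (fun _ => 0) (fun z => -V z) a Y)
    (hy : IsFundamentalSystem (fun _ => 0) (fun z => -V z) a y) :
    ∃ C : (Matrix (Fin 2) (Fin 2) ℂ)ˣ, ∀ᶠ z in 𝓝 a, ∀ i,
      Y i z = ∑ j, (C : Matrix (Fin 2) (Fin 2) ℂ) i j * y j z := by
  obtain ⟨U, hU⟩ := isUnit_wronskian hV hY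
  obtain ⟨u, hu⟩ := isUnit_wronskian hV hy
  have h1 := (isLocalSol_wronskian hy).mul_const ((u⁻¹ : (Matrix (Fin 2) (Fin 2) ℂ)ˣ) * U)
  have h2 := (isLocalSol_wronskian hY).eventuallyEq (analyticAt_companion hV) h1
    (by rw [← hU, ← hu, Units.mul_inv_cancel_left])
  have h3 : IsUnit ((u⁻¹ * U : (Matrix (Fin 2) (Fin 2) ℂ)ˣ) : Matrix (Fin 2) (Fin 2) ℂ).transpose :=
    (Matrix.isUnit_transpose _).mpr (Units.isUnit _)
  obtain ⟨C, hC⟩ := h3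
  refine ⟨C, ?_⟩
  filter_upwards [h2] with z hz i
  have := congrFun (congrFun hz 0) i
  rw [wronskian_zero] at this
  rw [this, hC]
  simp only [Matrix.mul_apply, wronskian_zero, Matrix.transpose_apply, Units.val_mul]
  exact Finset.sum_congr rfl fun j _ => mul_comm _ _

variable {τ : UpperHalfPlane}

lemma analyticAt_wp {z : ℂ} (hz : z ∉ (periods τ).lattice) : AnalyticAt ℂ (wp τ) z :=
  Complex.analyticAt_iff_eventually_differentiableAt.mpr
    ((eventually_nhds_notMem hz).mono fun _ hw => differentiableAt_weierstrassP hw)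

lemma analyticAt_xMap {z : ℂ} (hz : z ∉ (periods τ).lattice) : AnalyticAt ℂ (xMap τ) z := by
  have := analyticAt_wp hz
  have hE := e_sub_ne_zero (τ := τ)
  unfold xMap
  fun_prop (disch := assumption)

lemma analyticAt_potential (n : Fin 4 → ℕ) {p z : ℂ} (A : ℂ) (hz : z ∉ (periods τ).lattice)
    (hx : xMap τ z ∈ punctured (tPoint τ)) (h2 : z + p ∉ (periods τ).lattice)
    (h3 : z - p ∉ (periods τ).lattice) : AnalyticAt ℂ (potential τ n p A) z := by
  have h1 : ∀ k, z + omega τ k / 2 ∉ (periods τ).lattice := fun k => by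
    by_cases hk : k = 0
    · subst hk; simpa [omega] using hz
    · exact add_half_notMem hx k hk
  have hP : ∀ k : Fin 4, AnalyticAt ℂ (fun w => (n k : ℂ) * ((n k : ℂ) + 1) * wp τ (w + omega τ k / 2)) z :=
    fun k => analyticAt_const.mul
      (AnalyticAt.fun_comp (f := fun w => w + omega τ k / 2) (analyticAt_wp (h1 k)) (by fun_prop))
  have hs : AnalyticAt ℂ (fun w => ∑ k : Fin 4, (n k : ℂ) * ((n k : ℂ) + 1) * wp τ (w + omega τ k / 2)) z :=
    Finset.analyticAt_fun_sum _ fun k _ => hP k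
  have hp1 : AnalyticAt ℂ (fun w => wp τ (w + p)) z :=
    AnalyticAt.fun_comp (f := fun w => w + p) (analyticAt_wp h2) (by fun_prop)
  have hp2 : AnalyticAt ℂ (fun w => wp τ (w - p)) z :=
    AnalyticAt.fun_comp (f := fun w => w - p) (analyticAt_wp h3) (by fun_prop)
  have hz1 : AnalyticAt ℂ (fun w => wzeta τ (w + p)) z :=
    AnalyticAt.fun_comp (f := fun w => w + p) (analyticAt_zetaW (L := periods τ) h2) (by fun_prop)
  have hz2 : AnalyticAt ℂ (fun w => wzeta τ (w - p)) z :=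
    AnalyticAt.fun_comp (f := fun w => w - p) (analyticAt_zetaW (L := periods τ) h3) (by fun_prop)
  unfold potential
  fun_prop

/-- Pull back of a fundamental system of the normal form. -/
lemma isFundamentalSystem_pullback (n : Fin 4 → ℕ) {p z₀ : ℂ} (A : ℂ) (hp : p ∉ twoTorsion τ)
    (hz : z₀ ∉ (periods τ).lattice) (hx : xMap τ z₀ ∈ punctured (tPoint τ))
    (h2 : z₀ + p ∉ (periods τ).lattice) (h3 : z₀ - p ∉ (periods τ).lattice)
    {F : Fin 2 → ℂ → ℂ} {Ψ : ℂ → ℂ}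
    (hF : IsFundamentalSystem (normalP1 (theta n) (lamPoint τ p) (tPoint τ))
      (normalP2 (theta n) (lamPoint τ p) (muPoint τ n p A) (tPoint τ)) (xMap τ z₀) F)
    (hΨ : IsLocalSol (halfLogDeriv (lamPoint τ p) (tPoint τ)) Ψ (xMap τ z₀))
    (hΨ0 : Ψ (xMap τ z₀) ≠ 0) :
    IsFundamentalSystem (fun _ => 0) (fun z => -potential τ n p A z) z₀
      (fun j z => Ψ (xMap τ z) * F j (xMap τ z)) := by
  have hxa := analyticAt_xMap hz
  have hΨa := hΨ.analyticAt
  refine ⟨fun j => (hΨa.fun_comp hxa).mul ((hF.analytic j).fun_comp hxa), fun j =>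
    potential_solution n A hp hz hx h2 h3 (hF.analytic j) (hF.solves j) hΨ, fun c hc => ?_⟩
  apply hF.independent
  have hd : wpDeriv τ z₀ / (e τ 2 - e τ 1) ≠ 0 := by
    refine div_ne_zero (fun h => ?_) e_sub_ne_zero
    have := wpDeriv_sq hz
    rw [h] at this
    have h4 := cubic_ne_zero hx
    rw [cubic] at h4
    have h5 := e_sub_ne_zero (τ := τ)
    have : (e τ 2 - e τ 1) ^ 3 * (4 * (xMap τ z₀ * (xMap τ z₀ - 1) * (xMap τ z₀ - tPoint τ))) = 0 := by
      linear_combination -this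
    simp only [mul_eq_zero, pow_eq_zero_iff, ne_eq, OfNat.ofNat_ne_zero, not_false_eq_true, false_or,
      h5] at this h4
    exact h4 this
  have hstrict : HasStrictDerivAt (xMap τ) (wpDeriv τ z₀ / (e τ 2 - e τ 1)) z₀ := by
    have := hxa.hasStrictDerivAt
    rwa [(hasDerivAt_xMap hz).deriv] at this
  -- Since `x'(z₀) ≠ 0`, `x` maps the neighbourhoods of `z₀` onto those of `x(z₀)`, so a linear
  -- relation near `z₀` descends to one near `x(z₀)`.
  rw [← hstrict.map_nhds_eq hd, eventually_map]
  filter_upwards [hc, (hΨa.fun_comp hxa).continuousAt.eventually_ne hΨ0] with z k1 k2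
  refine (mul_eq_zero.mp (?_ : Ψ (xMap τ z) * _ = 0)).resolve_left k2
  rw [← k1, Finset.mul_sum]
  exact Finset.sum_congr rfl fun j _ => by ring

end FundamentalSystems

/-! ### Continuation of fundamental systems -/

section Monodromy

open unitInterval

attribute [local instance] Matrix.linftyOpNormedRing Matrix.linftyOpNormedAlgebra

variable {n : Fin 4 → ℕ} {l t m x₀ : ℂ} {F : Fin 2 → ℂ → ℂ} {T : Matrix (Fin 2) (Fin 2) ℂ}

/-- Continuation of a fundamental system of the normal form along a loop. -/
lemma exists_continuation_normal {γ : Path x₀ x₀} (hγ : ∀ s, γ s ∈ punctured t) (hγl : ∀ s, γ s ≠ l)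
    (hl : l ∈ punctured t) (ht : t ≠ 0) (ht1 : t ≠ 1)
    (hF : IsFundamentalSystem (normalP1 (theta n) l t)
      (normalP2 (theta n) l (shiftedMu (theta n) l t m) t) x₀ F)
    (hT : IsTransport (sysMatrix (theta n) l t m) γ T) {U : (Matrix (Fin 2) (Fin 2) ℂ)ˣ}
    (hU : (U : Matrix (Fin 2) (Fin 2) ℂ) = sysSolution l t m F x₀) :
    ∃ f : Fin 2 → I → ℂ → ℂ, ∀ i, IsContinuationAlong γ (f i) ∧ f i 0 =ᶠ[𝓝 x₀] F i ∧
      ∀ᶠ z in 𝓝 x₀, f i 1 z = ∑ j, antiConj 1 U T i j * F j z := by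
  have hx₀ : x₀ ∈ punctured t := by simpa using hγ 0
  have hx₀l : x₀ ≠ l := by simpa using hγl 0
  have hA : ∀ s, AnalyticAt ℂ (sysMatrix (theta n) l t m) (γ s) := fun s => analyticAt_sysMatrix _ (hγ s) hl
  have hA0 := analyticAt_sysMatrix (m := m) (theta n) hx₀ hl
  have hsol := isLocalSol_sysSolution hx₀ hx₀l hl ht ht1 hF
  obtain ⟨W, hW, hWc, hW0, hW1⟩ := hT.exists_continuation hA γ.continuous U
  rw [γ.source] at hW0
  rw [γ.target] at hW1
  have hdiv : ∀ j x, x ≠ l → sysSolution l t m F x 0 j / (x - l) = F j x := fun j x hx => by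
    have := sub_ne_zero.mpr hx
    fin_cases j <;> simp [sysSolution] <;> field_simp
  refine ⟨fun i s x => W s x 0 i / (x - l), fun i => ⟨⟨fun s => ?_, fun s => ?_⟩, ?_, ?_⟩⟩
  · have h1 : AnalyticAt ℂ (fun x => W s x 0 i) (γ s) :=
      Complex.analyticAt_iff_eventually_differentiableAt.mpr
        ((hW s).mono fun x hx => (hasDerivAt_matrix.mp hx 0 i).differentiableAt)
    exact h1.div (by fun_prop) (sub_ne_zero.mpr (hγl s))
  · filter_upwards [hWc s] with s' hs'
    filter_upwards [hs'] with x hx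
    rw [hx]
  · have h0 := (hW 0)
    rw [γ.source] at h0
    have := h0.eventuallyEq hA0 hsol (hW0.trans hU)
    filter_upwards [this, isOpen_ne.eventually_mem hx₀l] with x hx hxl
    rw [hx, hdiv i x hxl]
  · have h1 := (hW 1)
    rw [γ.target] at h1
    -- The continued matrix has the value `T U = U (U⁻¹ T U)`, so the columns, that is the
    -- solutions, are combined by `U⁻¹ T U` from the right. This explains the transpose in
    -- `antiConj`.
    have := h1.eventuallyEq hA0 (hsol.mul_const ((U⁻¹ : (Matrix (Fin 2) (Fin 2) ℂ)ˣ) * T * U)) (by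
      rw [hW1, ← hU]
      simp only [mul_assoc, Units.mul_inv_cancel_left])
    filter_upwards [this, isOpen_ne.eventually_mem hx₀l] with x hx hxl
    rw [hx, Matrix.mul_apply, Finset.sum_div]
    refine Finset.sum_congr rfl fun j _ => ?_
    rw [← hdiv j x hxl]
    simp only [antiConj, Units.val_one, one_mul, inv_one, mul_one, Matrix.transpose_apply]
    ring

lemma isMonodromyMatrix_normal {γ : Path x₀ x₀} (hγ : ∀ s, γ s ∈ punctured t) (hγl : ∀ s, γ s ≠ l)
    (hl : l ∈ punctured t) (ht : t ≠ 0) (ht1 : t ≠ 1)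
    (hF : IsFundamentalSystem (normalP1 (theta n) l t)
      (normalP2 (theta n) l (shiftedMu (theta n) l t m) t) x₀ F)
    (hT : IsTransport (sysMatrix (theta n) l t m) γ T) {U : (Matrix (Fin 2) (Fin 2) ℂ)ˣ}
    (hU : (U : Matrix (Fin 2) (Fin 2) ℂ) = sysSolution l t m F x₀) :
    IsMonodromyMatrix γ F (antiConj 1 U T) := by
  obtain ⟨f, hf⟩ := exists_continuation_normal hγ hγl hl ht ht1 hF hT hU
  exact ⟨f, fun i => ⟨(hf i).1, (hf i).2.1, by simpa using (hf i).2.2⟩⟩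

variable {τ : UpperHalfPlane}

/-- Continuation of a fundamental system of the generalized Lamé equation. -/
lemma isMonodromyMatrix_lame {p q₀ ω : ℂ} (hω : ω ∈ (periods τ).lattice) {ℓ : Path q₀ (q₀ + ω)}
    (hℓ : ∀ s, ℓ s ∉ (periods τ).lattice) {β : Path (xMap τ q₀) (xMap τ q₀)}
    (hβ : ∀ s, β s = xMap τ (ℓ s)) (hγ : ∀ s, β s ∈ punctured (tPoint τ))
    (hγl : ∀ s, β s ≠ lamPoint τ p) (hl : lamPoint τ p ∈ punctured (tPoint τ))
    (hF : IsFundamentalSystem (normalP1 (theta n) (lamPoint τ p) (tPoint τ))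
      (normalP2 (theta n) (lamPoint τ p) (shiftedMu (theta n) (lamPoint τ p) (tPoint τ) m) (tPoint τ))
      (xMap τ q₀) F)
    (hT : IsTransport (sysMatrix (theta n) (lamPoint τ p) (tPoint τ) m) β T)
    {U : (Matrix (Fin 2) (Fin 2) ℂ)ˣ}
    (hU : (U : Matrix (Fin 2) (Fin 2) ℂ) = sysSolution (lamPoint τ p) (tPoint τ) m F (xMap τ q₀))
    {Ψ : ℂ → ℂ} (hΨ : IsLocalSol (halfLogDeriv (lamPoint τ p) (tPoint τ)) Ψ (xMap τ q₀)) {k : ℂ}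
    (hk : IsTransport (halfLogDeriv (lamPoint τ p) (tPoint τ)) β k) {Y : Fin 2 → ℂ → ℂ}
    {C : (Matrix (Fin 2) (Fin 2) ℂ)ˣ} (hC : ∀ᶠ z in 𝓝 q₀, ∀ i, Y i z =
      ∑ j, (C : Matrix (Fin 2) (Fin 2) ℂ) i j * (Ψ (xMap τ z) * F j (xMap τ z))) :
    IsMonodromyMatrix ℓ Y (k • antiConj C U T) := by
  obtain ⟨f, hf⟩ := exists_continuation_normal hγ hγl hl tPoint_ne_zero tPoint_ne_one hF hT hU
  have ha : ∀ s, AnalyticAt ℂ (halfLogDeriv (lamPoint τ p) (tPoint τ)) (β s) := fun s =>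
    Complex.analyticAt_iff_eventually_differentiableAt.mpr (by
      filter_upwards [(isOpen_punctured _).eventually_mem (hγ s), isOpen_ne.eventually_mem (hγl s)]
        with x h1 h2
      exact (hasDerivAt_halfLogDeriv h1 h2).differentiableAt)
  obtain ⟨P, hP, hPc, hP0, hP1⟩ := hk.exists_continuation ha β.continuous (Ψ (xMap τ q₀))
  rw [β.source] at hP0
  rw [β.target] at hP1
  have ha0 := ha 0
  have hPs := hP 0
  have hPt := hP 1
  rw [β.source] at hPs ha0
  rw [β.target] at hPt
  have hq₀ : q₀ ∉ (periods τ).lattice := by simpa using hℓ 0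
  have hx : ∀ s, ContinuousAt (xMap τ) (ℓ s) := fun s => (hasDerivAt_xMap (hℓ s)).continuousAt
  have hx0 : Tendsto (xMap τ) (𝓝 q₀) (𝓝 (xMap τ q₀)) := (hasDerivAt_xMap hq₀).continuousAt
  refine ⟨fun i s z => ∑ j, (C : Matrix (Fin 2) (Fin 2) ℂ) i j * (P s (xMap τ z) * f j s (xMap τ z)),
    fun i => ⟨⟨fun s => ?_, fun s => ?_⟩, ?_, ?_⟩⟩
  · refine Finset.analyticAt_fun_sum _ fun j _ => analyticAt_const.mul (AnalyticAt.mul ?_ ?_)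
    · exact AnalyticAt.fun_comp (hβ s ▸ (hP s).analyticAt) (analyticAt_xMap (hℓ s))
    · exact AnalyticAt.fun_comp (hβ s ▸ (hf j).1.analytic s) (analyticAt_xMap (hℓ s))
  · have h1 := eventually_all.mpr fun j => (hf j).1.compatible s
    filter_upwards [hPc s, h1] with s' k1 k2
    rw [hβ] at k1
    simp only [hβ] at k2
    filter_upwards [(hx s').eventually k1, (hx s').eventually (eventually_all.mpr k2)] with z e1 e2
    simp only [e1, e2]
  · have h1 := hPs.eventuallyEq ha0 hΨ hP0
    have h2 := eventually_all.mpr fun j => (hf j).2.1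
    filter_upwards [hx0.eventually h1, hx0.eventually h2, hC] with z e1 e2 e3
    simp only [e1, e2, e3]
  · have h1 := hPt.eventuallyEq ha0 (hΨ.mul_const k) (hP1.trans (mul_comm _ _))
    have h2 := eventually_all.mpr fun j => (hf j).2.2
    filter_upwards [hx0.eventually h1, hx0.eventually h2, hC] with z e1 e2 e3
    -- All germs are functions of `x`, which has the period `ω`, so the identification of `z + ω`
    -- with `z` costs nothing.
    rw [add_sub_cancel_left]
    simp only [xMap_add hω, e1, e2, e3]
    have hconj : antiConj C U T * (C : Matrix (Fin 2) (Fin 2) ℂ) =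
        (C : Matrix (Fin 2) (Fin 2) ℂ) * antiConj 1 U T := by
      simp [antiConj, mul_assoc]
    have key : ∀ j, ∑ a, antiConj C U T i a * (C : Matrix (Fin 2) (Fin 2) ℂ) a j =
        ∑ a, (C : Matrix (Fin 2) (Fin 2) ℂ) i a * antiConj 1 U T a j := fun j => by
      rw [← Matrix.mul_apply, ← Matrix.mul_apply, hconj]
    have k0 := key 0
    have k1 := key 1
    simp only [Fin.sum_univ_two] at k0 k1 ⊢
    simp only [Matrix.smul_apply, smul_eq_mul]
    linear_combination (-k * Ψ (xMap τ z) * F 0 (xMap τ z)) * k0 -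
      (k * Ψ (xMap τ z) * F 1 (xMap τ z)) * k1

end Monodromy

/-! ### The monodromy of the lifted cycles and the trace formulas -/

section Traces

open unitInterval

attribute [local instance] Matrix.linftyOpNormedRing Matrix.linftyOpNormedAlgebra

lemma HomotopicIn.left_mem {S : Set ℂ} {a b : ℂ} {γ γ' : Path a b} (h : HomotopicIn S γ γ') (s : I) :
    γ s ∈ S := by
  obtain ⟨H, hH⟩ := h
  have := hH (0, s)
  rwa [H.apply_zero] at this

lemma HomotopicIn.right_mem {S : Set ℂ} {a b : ℂ} {γ γ' : Path a b} (h : HomotopicIn S γ γ') (s : I) :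
    γ' s ∈ S := by
  obtain ⟨H, hH⟩ := h
  have := hH (1, s)
  rwa [H.apply_one] at this

section Algebra

variable {𝔸 : Type*} [NormedRing 𝔸] [NormedAlgebra ℂ 𝔸] [CompleteSpace 𝔸] {A : ℂ → 𝔸} {S : Set ℂ}
  {x₀ : ℂ} {β γ γ' : Path x₀ x₀} {R T T' : 𝔸}

lemma transport_trans (hA : ∀ x ∈ S, AnalyticAt ℂ A x) (hγ : ∀ s, γ s ∈ S)
    (hT : IsTransport A γ T) (hT' : IsTransport A γ' T') (hβ : HomotopicIn S β (γ.trans γ'))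
    (hR : IsTransport A β R) : R = T' * T :=
  (hR.homotopicIn hA hβ).unique (fun s => hA _ (hβ.right_mem s)) (Path.continuous _)
    (hT.trans (fun s => hA _ (hγ s)) hT')

/-- From `T * T = -1` the inverse of `T` is `-T`. The two signs cancel, and the inverse loops give
the same product as the loops. -/
lemma transport_symm_trans_symm (hA : ∀ x ∈ S, AnalyticAt ℂ A x) (hγ : ∀ s, γ s ∈ S)
    (hγ' : ∀ s, γ' s ∈ S) (hT : IsTransport A γ T) (hT' : IsTransport A γ' T') (hT2 : T * T = -1)
    (hT2' : T' * T' = -1) (hβ : HomotopicIn S β (γ.symm.trans γ'.symm)) (hR : IsTransport A β R) :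
    R = T' * T := by
  obtain ⟨Ts, hTs⟩ := exists_isTransport (A := A) (γ := γ.symm) (fun s => hA _ (hγ _)) γ.symm.continuous
  obtain ⟨Ts', hTs'⟩ := exists_isTransport (A := A) (γ := γ'.symm) (fun s => hA _ (hγ' _))
    γ'.symm.continuous
  rw [transport_trans (γ := γ.symm) (γ' := γ'.symm) hA (fun s => hγ _) hTs hTs' hβ hR]
  have h1 : Ts * T = 1 := hT.symm_mul (fun s => hA _ (hγ s)) γ.continuous hTs
  have h2 : Ts' * T' = 1 := hT'.symm_mul (fun s => hA _ (hγ' s)) γ'.continuous hTs'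
  have inv : ∀ {X Y : 𝔸}, Y * X = 1 → X * X = -1 → Y = -X := fun {X Y} h h' => by
    have : Y * (X * X) = X := by rw [← mul_assoc, h, one_mul]
    rw [h', mul_neg, mul_one] at this
    rw [← this, neg_neg]
  rw [inv h1 hT2, inv h2 hT2', neg_mul_neg]

end Algebra

variable {τ : UpperHalfPlane}

lemma xMap_ne_lamPoint {p z : ℂ} (hp : p ∉ (periods τ).lattice) (hz : z ∉ cuts τ p) :
    xMap τ z ≠ lamPoint τ p :=
  xMap_ne_xMap (notMem_lattice_of_notMem_cuts hz) hp
    (fun h => hz (mem_cuts_of_add 1 (by simpa using h)))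
    (fun h => hz (mem_cuts_of_sub 1 (by simpa using h)))

lemma monodromy_of_loopChoice (n : Fin 4 → ℕ) {p : ℂ} (A : ℂ) (hp : p ∉ twoTorsion τ) {q₀ : ℂ}
    {ℓ₁ : Path q₀ (q₀ + 1)} {ℓ₂ : Path q₀ (q₀ + (τ : ℂ))}
    {γ₁ γ₂ γ₃ : Path (xMap τ q₀) (xMap τ q₀)} (h : IsLoopChoice τ p ℓ₁ ℓ₂ γ₁ γ₂ γ₃) :
    (∃ Y, IsFundamentalSystem (fun _ => 0) (fun z => -potential τ n p A z) q₀ Y) ∧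
      (∃ F, IsFundamentalSystem (normalP1 (theta n) (lamPoint τ p) (tPoint τ))
        (normalP2 (theta n) (lamPoint τ p) (muPoint τ n p A) (tPoint τ)) (xMap τ q₀) F) ∧
      ∀ Y F : Fin 2 → ℂ → ℂ,
        IsFundamentalSystem (fun _ => 0) (fun z => -potential τ n p A z) q₀ Y →
        IsFundamentalSystem (normalP1 (theta n) (lamPoint τ p) (tPoint τ))
          (normalP2 (theta n) (lamPoint τ p) (muPoint τ n p A) (tPoint τ)) (xMap τ q₀) F →
        ∃ N₁ N₂ M₁ M₂ M₃ : Matrix.SpecialLinearGroup (Fin 2) ℂ,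
          (∀ N, IsMonodromyMatrix ℓ₁ Y N ↔ N = N₁.1) ∧
          (∀ N, IsMonodromyMatrix ℓ₂ Y N ↔ N = N₂.1) ∧
          (∀ M, IsMonodromyMatrix γ₁ F M ↔ M = M₁.1) ∧
          (∀ M, IsMonodromyMatrix γ₂ F M ↔ M = M₂.1) ∧
          (∀ M, IsMonodromyMatrix γ₃ F M ↔ M = M₃.1) ∧
          N₁.1.trace = -(M₂ * M₃).1.trace ∧
          N₂.1.trace = -(M₁ * M₃).1.trace ∧
          (N₁⁻¹ * N₂).1.trace = -(M₁ * M₂).1.trace := by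
  have hl : lamPoint τ p ∈ punctured (tPoint τ) := xMap_mem_punctured hp
  have hpL := notMem_of_two_mul (two_mul_notMem_of_notMem_twoTorsion hp)
  have ht := tPoint_ne_zero (τ := τ)
  have ht1 := tPoint_ne_one (τ := τ)
  obtain ⟨β₁, hβ₁, H₁⟩ := h.image₁
  obtain ⟨β₂, hβ₂, H₂⟩ := h.image₂
  have hcut : q₀ ∉ cuts τ p := by simpa using h.avoid₁ 0
  have hq₀ := notMem_lattice_of_notMem_cuts hcut
  have hq₁ : q₀ + p ∉ (periods τ).lattice := fun h' => hcut (mem_cuts_of_add 1 (by simpa using h'))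
  have hq₂ : q₀ - p ∉ (periods τ).lattice := fun h' => hcut (mem_cuts_of_sub 1 (by simpa using h'))
  have hx₀ : xMap τ q₀ ∈ punctured (tPoint τ) := by simpa using H₁.left_mem 0
  have hx₀l := xMap_ne_lamPoint hpL hcut
  have hμ : muPoint τ n p A = shiftedMu (theta n) (lamPoint τ p) (tPoint τ) (muShift τ p A) :=
    muPoint_eq n A hl
  have hA : ∀ x ∈ punctured (tPoint τ), AnalyticAt ℂ
      (sysMatrix (theta n) (lamPoint τ p) (tPoint τ) (muShift τ p A)) x :=
    fun x hx => analyticAt_sysMatrix _ hx hl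
  have hlog : AnalyticAt ℂ (halfLogDeriv (lamPoint τ p) (tPoint τ)) (xMap τ q₀) :=
    Complex.analyticAt_iff_eventually_differentiableAt.mpr (by
      filter_upwards [(isOpen_punctured _).eventually_mem hx₀, isOpen_ne.eventually_mem hx₀l]
        with x h1 h2
      exact (hasDerivAt_halfLogDeriv h1 h2).differentiableAt)
  obtain ⟨Ψ, hΨ, hΨ1⟩ := exists_isLocalSol hlog
  have hΨ0 : Ψ (xMap τ q₀) ≠ 0 := by rw [hΨ1]; exact one_ne_zero
  have exF : ∃ F, IsFundamentalSystem (normalP1 (theta n) (lamPoint τ p) (tPoint τ))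
      (normalP2 (theta n) (lamPoint τ p) (muPoint τ n p A) (tPoint τ)) (xMap τ q₀) F := by
    obtain ⟨W, hW, hW1⟩ := exists_isLocalSol (hA _ hx₀)
    rw [hμ]
    exact ⟨_, isFundamentalSystem_of_isLocalSol hx₀ hx₀l hl ht ht1 hW (hW1 ▸ isUnit_one)⟩
  refine ⟨?_, exF, fun Y F hY hF => ?_⟩
  · obtain ⟨F, hF⟩ := exF
    exact ⟨_, isFundamentalSystem_pullback n A hp hq₀ hx₀ hq₁ hq₂ hF hΨ hΨ0⟩
  obtain ⟨C, hC⟩ := hY.exists_change (analyticAt_potential n A hq₀ hx₀ hq₁ hq₂)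
    (isFundamentalSystem_pullback n A hp hq₀ hx₀ hq₁ hq₂ hF hΨ hΨ0)
  rw [hμ] at hF
  obtain ⟨U, hU⟩ := isUnit_sysSolution hx₀ hx₀l hl ht ht1 hF
  have hg₁ : ∀ s, γ₁ s ∈ punctured (tPoint τ) := by
    obtain ⟨r, δ, -, -, H⟩ := h.encircles₁; exact H.left_mem
  have hg₂ : ∀ s, γ₂ s ∈ punctured (tPoint τ) := by
    obtain ⟨r, δ, -, -, H⟩ := h.encircles₂; exact H.left_mem
  have hg₃ : ∀ s, γ₃ s ∈ punctured (tPoint τ) := by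
    obtain ⟨r, δ, -, -, H⟩ := h.encircles₃; exact H.left_mem
  obtain ⟨T₁, hT₁⟩ := exists_isTransport (fun s => hA _ (hg₁ s)) γ₁.continuous
  obtain ⟨T₂, hT₂⟩ := exists_isTransport (fun s => hA _ (hg₂ s)) γ₂.continuous
  obtain ⟨T₃, hT₃⟩ := exists_isTransport (fun s => hA _ (hg₃ s)) γ₃.continuous
  obtain ⟨R₁, hR₁⟩ := exists_isTransport (fun s => hA _ (H₁.left_mem s)) β₁.continuous
  obtain ⟨R₂, hR₂⟩ := exists_isTransport (fun s => hA _ (H₂.left_mem s)) β₂.continuous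
  have htr := sysMatrix_trace (theta n) (lamPoint τ p) (tPoint τ) (muShift τ p A)
  have d₁ := hT₁.det_eq_one γ₁.continuous htr
  have d₂ := hT₂.det_eq_one γ₂.continuous htr
  have d₃ := hT₃.det_eq_one γ₃.continuous htr
  have s₁ := mul_self_of_trace_eq_zero (trace_eq_zero_of_encircles_zero hl ht h.encircles₁ hT₁) d₁
  have s₂ := mul_self_of_trace_eq_zero (trace_eq_zero_of_encircles_one hl ht1 h.encircles₂ hT₂) d₂
  have s₃ := mul_self_of_trace_eq_zero (trace_eq_zero_of_encircles_t hl ht ht1 h.encircles₃ hT₃) d₃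
  have r₁ : R₁ = T₃ * T₂ := transport_symm_trans_symm hA hg₂ hg₃ hT₂ hT₃ s₂ s₃ H₁ hR₁
  have r₂ : R₂ = T₃ * T₁ := transport_trans hA hg₁ hT₁ hT₃ H₂ hR₂
  -- The transport of `Ψ` is that of the fourth root times that of the square root of `x - λ`, and
  -- the latter is one.
  have hpsi : ∀ {ω : ℂ} {ℓ : Path q₀ (q₀ + ω)} {β : Path (xMap τ q₀) (xMap τ q₀)},
      (∀ s, ℓ s ∉ cuts τ p) → (∀ s, β s = xMap τ (ℓ s)) → (∀ s, β s ∈ punctured (tPoint τ)) →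
      (∀ k, IsTransport (quarterLogDeriv (tPoint τ)) β k → k = -1) →
      IsTransport (halfLogDeriv (lamPoint τ p) (tPoint τ)) β (-1) := by
    intro ω ℓ β hℓ hβ hβp hk
    have hne : ∀ s, β s - lamPoint τ p ≠ 0 := fun s =>
      sub_ne_zero.mpr (hβ s ▸ xMap_ne_lamPoint hpL (hℓ s))
    obtain ⟨k₁, hk₁⟩ := exists_isTransport (A := quarterLogDeriv (tPoint τ))
      (fun s => analyticAt_quarterLogDeriv (hβp s)) β.continuous
    obtain ⟨k₂, hk₂⟩ := exists_isTransport (A := fun x => 1 / 2 * (1 / (x - lamPoint τ p)))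
      (γ := β) (fun s => by have := hne s; fun_prop (disch := assumption)) β.continuous
    have := hk₁.mul_scalar hk₂
    rwa [hk _ hk₁, half_transport hpL hℓ hβ hk₂, mul_one] at this
  have hq : ∀ x ∈ punctured (tPoint τ), AnalyticAt ℂ (quarterLogDeriv (tPoint τ)) x :=
    fun x hx => analyticAt_quarterLogDeriv hx
  obtain ⟨c₁, hc₁⟩ := exists_isTransport (fun s => hq _ (hg₁ s)) γ₁.continuous
  obtain ⟨c₂, hc₂⟩ := exists_isTransport (fun s => hq _ (hg₂ s)) γ₂.continuous
  obtain ⟨c₃, hc₃⟩ := exists_isTransport (fun s => hq _ (hg₃ s)) γ₃.continuous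
  have i₁ := quarter_transport ht ht1 (Or.inl rfl) h.encircles₁ hc₁
  have i₂ := quarter_transport ht ht1 (Or.inr (Or.inl rfl)) h.encircles₂ hc₂
  have i₃ := quarter_transport ht ht1 (Or.inr (Or.inr rfl)) h.encircles₃ hc₃
  have k₁ := hpsi h.avoid₁ hβ₁ H₁.left_mem fun k hk => by
    rw [transport_symm_trans_symm hq hg₂ hg₃ hc₂ hc₃ (by simp [i₂]) (by simp [i₃]) H₁ hk, i₂, i₃,
      Complex.I_mul_I]
  have k₂ := hpsi h.avoid₂ hβ₂ H₂.left_mem fun k hk => by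
    rw [transport_trans hq hg₁ hc₁ hc₃ H₂ hk, i₁, i₃, Complex.I_mul_I]
  have n₁ := isMonodromyMatrix_lame one_mem_lattice
    (fun s => notMem_lattice_of_notMem_cuts (h.avoid₁ s)) hβ₁ H₁.left_mem
    (fun s => hβ₁ s ▸ xMap_ne_lamPoint hpL (h.avoid₁ s)) hl hF hR₁ hU hΨ k₁ hC
  have n₂ := isMonodromyMatrix_lame tau_mem_lattice
    (fun s => notMem_lattice_of_notMem_cuts (h.avoid₂ s)) hβ₂ H₂.left_mem
    (fun s => hβ₂ s ▸ xMap_ne_lamPoint hpL (h.avoid₂ s)) hl hF hR₂ hU hΨ k₂ hC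
  have m₁ := isMonodromyMatrix_normal hg₁ (fun s => (h.avoid_lam s).1) hl ht ht1 hF hT₁ hU
  have m₂ := isMonodromyMatrix_normal hg₂ (fun s => (h.avoid_lam s).2.1) hl ht ht1 hF hT₂ hU
  have m₃ := isMonodromyMatrix_normal hg₃ (fun s => (h.avoid_lam s).2.2) hl ht ht1 hF hT₃ hU
  rw [neg_one_smul, r₁] at n₁
  rw [neg_one_smul, r₂] at n₂
  have dN : ∀ S T : Matrix (Fin 2) (Fin 2) ℂ, S.det = 1 → T.det = 1 →
      (-antiConj C U (S * T)).det = 1 := fun S T hS hT => by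
    rw [Matrix.det_neg, det_antiConj, Matrix.det_mul, hS, hT]; simp
  have exSL : ∀ S : Matrix (Fin 2) (Fin 2) ℂ, S.det = 1 →
      ∃ N : Matrix.SpecialLinearGroup (Fin 2) ℂ, N.1 = S := fun S hS => ⟨⟨S, hS⟩, rfl⟩
  obtain ⟨N₁, hN₁⟩ := exSL _ (dN _ _ d₃ d₂)
  obtain ⟨N₂, hN₂⟩ := exSL _ (dN _ _ d₃ d₁)
  -- The inverse of `N₁` in explicit form, because `T₂ T₃ T₃ T₂ = -T₂ T₂ = 1`.
  obtain ⟨X, hX⟩ := exSL _ (dN _ _ d₂ d₃)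
  obtain ⟨M₁, hM₁⟩ := exSL _ ((det_antiConj 1 U _).trans d₁)
  obtain ⟨M₂, hM₂⟩ := exSL _ ((det_antiConj 1 U _).trans d₂)
  obtain ⟨M₃, hM₃⟩ := exSL _ ((det_antiConj 1 U _).trans d₃)
  have hinv : N₁⁻¹ = X := by
    rw [inv_eq_iff_mul_eq_one]
    apply Subtype.ext
    change N₁.1 * X.1 = 1
    rw [hN₁, hX, neg_mul_neg, ← antiConj_mul, mul_assoc, ← mul_assoc T₃, s₃, neg_one_mul, mul_neg,
      s₂, neg_neg, antiConj_one]
  refine ⟨N₁, N₂, M₁, M₂, M₃, hN₁ ▸ fun N => isMonodromyMatrix_iff hY n₁,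
    hN₂ ▸ fun N => isMonodromyMatrix_iff hY n₂, hM₁ ▸ fun N => isMonodromyMatrix_iff hF m₁,
    hM₂ ▸ fun N => isMonodromyMatrix_iff hF m₂, hM₃ ▸ fun N => isMonodromyMatrix_iff hF m₃,
    ?_, ?_, ?_⟩
  · change N₁.1.trace = -(M₂.1 * M₃.1).trace
    rw [hN₁, hM₂, hM₃, Matrix.trace_neg, trace_antiConj, ← antiConj_mul, trace_antiConj]
  · change N₂.1.trace = -(M₁.1 * M₃.1).trace
    rw [hN₂, hM₁, hM₃, Matrix.trace_neg, trace_antiConj, ← antiConj_mul, trace_antiConj]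
  · rw [hinv]
    change (X.1 * N₂.1).trace = -(M₁.1 * M₂.1).trace
    -- Cyclicity of the trace brings the two factors `T₃` together, and `T₃ T₃ = -1` produces the
    -- sign.
    rw [hX, hN₂, hM₁, hM₂, neg_mul_neg, ← antiConj_mul, ← antiConj_mul, trace_antiConj,
      trace_antiConj, Matrix.trace_mul_comm, mul_assoc, ← mul_assoc T₃, s₃, neg_one_mul, mul_neg,
      Matrix.trace_neg]

end Traces

/-! ### Homotopies inside a set and free homotopies of loops -/

section Homotopies

open unitInterval

variable {S : Set ℂ}

lemma trans_mem {X : Type*} [TopologicalSpace X] {K : Set X} {a b c : X} {p : Path a b} {q : Path b c}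
    (hp : ∀ s, p s ∈ K) (hq : ∀ s, q s ∈ K) (s : I) : (p.trans q) s ∈ K := by
  rw [Path.trans_apply]
  split_ifs
  exacts [hp _, hq _]

lemma trans_eq_map {X : Type*} [TopologicalSpace X] {a b c : ℂ} {u v w : X} {f : X → ℂ} {p : Path a b}
    {q : Path b c} {P : Path u v} {Q : Path v w} (hp : ∀ s, p s = f (P s)) (hq : ∀ s, q s = f (Q s))
    (s : I) : (p.trans q) s = f ((P.trans Q) s) := by
  rw [Path.trans_apply, Path.trans_apply]
  split_ifs
  exacts [hp _, hq _]

lemma HomotopicIn.trans {a b : ℂ} {p q r : Path a b} (h : HomotopicIn S p q) (h' : HomotopicIn S q r) :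
    HomotopicIn S p r := by
  obtain ⟨H, hH⟩ := h
  obtain ⟨G, hG⟩ := h'
  refine ⟨H.trans G, fun u => ?_⟩
  rw [Path.Homotopy.trans_apply]
  split_ifs
  exacts [hH _, hG _]

/-- Images of two paths in a convex set are homotopic. -/
lemma homotopicIn_of_convex {E : Type*} [AddCommGroup E] [Module ℝ E] [TopologicalSpace E]
    [ContinuousAdd E] [ContinuousSMul ℝ E] {K : Set E} (hK : Convex ℝ K) {f : E → ℂ}
    (hf : ContinuousOn f K) (hS : Set.MapsTo f K S) {u v u' v' : E} {a b : ℂ} {P : Path u v}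
    {Q : Path u' v'} (hu : f u = a) (hv : f v = b) (huu : u = u') (hvv : v = v')
    (hP : ∀ s, P s ∈ K) (hQ : ∀ s, Q s ∈ K) {p q : Path a b} (hp : ∀ s, p s = f (P s))
    (hq : ∀ s, q s = f (Q s)) : HomotopicIn S p q := by
  subst huu hvv
  have hmem : ∀ y : I × I, (1 - (y.1 : ℝ)) • P y.2 + (y.1 : ℝ) • Q y.2 ∈ K := fun y =>
    hK (hP _) (hQ _) (by linarith [y.1.2.2]) y.1.2.1 (by ring)
  refine ⟨⟨⟨⟨fun y => f ((1 - (y.1 : ℝ)) • P y.2 + (y.1 : ℝ) • Q y.2), ?_⟩, ?_, ?_⟩, ?_⟩, fun y => hS (hmem y)⟩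
  · exact hf.comp_continuous (by fun_prop) hmem
  · intro s; simp [hp]
  · intro s; simp [hq]
  · rintro t s (rfl | rfl)
    · simp [← add_smul, hu]
    · simp [← add_smul, hv]

/-- The lift of a path to a subtype. -/
def liftPath {a b : ℂ} (p : Path a b) (hp : ∀ s, p s ∈ S) :
    Path (⟨a, by simpa using hp 0⟩ : S) (⟨b, by simpa using hp 1⟩ : S) where
  toFun s := ⟨p s, hp s⟩
  continuous_toFun := by fun_prop
  source' := Subtype.ext p.source
  target' := Subtype.ext p.target

lemma homotopicIn_of_liftPath {a b : ℂ} {p q : Path a b} {ha : a ∈ S} {hb : b ∈ S}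
    {P Q : Path (⟨a, ha⟩ : S) (⟨b, hb⟩ : S)} (h : P.Homotopic Q) (hP : ∀ s, p s = P s)
    (hQ : ∀ s, q s = Q s) : HomotopicIn S p q := by
  obtain ⟨H⟩ := h
  refine ⟨⟨⟨⟨fun y => H y, by fun_prop⟩, ?_, ?_⟩, ?_⟩, fun y => (H y).2⟩
  · intro s; simp [hP]
  · intro s; simp [hQ]
  · rintro t s (rfl | rfl)
    · simp
    · simp

/-- Inserts `q · q⁻¹`. The paths are lifted to the subtype `S`, where the groupoid laws for paths
apply. -/
lemma homotopicIn_cancel {a b c d : ℂ} {p : Path a b} {q : Path b c} {r : Path b d}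
    (hp : ∀ s, p s ∈ S) (hq : ∀ s, q s ∈ S) (hr : ∀ s, r s ∈ S) :
    HomotopicIn S (p.trans r) ((p.trans q).trans (q.symm.trans r)) := by
  have key : (((liftPath p hp).trans (liftPath q hq)).trans
      ((liftPath q hq).symm.trans (liftPath r hr))).Homotopic
      ((liftPath p hp).trans (liftPath r hr)) := by
    refine Path.Homotopic.trans ⟨Path.Homotopy.transAssoc _ _ _⟩
      (Path.Homotopic.hcomp (Path.Homotopic.refl _) ?_)
    refine Path.Homotopic.trans ⟨(Path.Homotopy.transAssoc _ _ _).symm⟩ ?_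
    exact Path.Homotopic.trans (Path.Homotopic.hcomp ⟨(Path.Homotopy.reflTransSymm _).symm⟩
      (Path.Homotopic.refl _)) ⟨Path.Homotopy.reflTrans _⟩
  have e : ∀ {a b : ℂ} (p : Path a b) (hp : ∀ s, p s ∈ S) (s : I), p s = ((liftPath p hp) s : ℂ) :=
    fun _ _ _ => rfl
  refine homotopicIn_of_liftPath key.symm (trans_eq_map (e p hp) (e r hr)) ?_
  exact trans_eq_map (trans_eq_map (e p hp) (e q hq)) (trans_eq_map (fun s => e q hq _) (e r hr))

/-- Loops in `S`, as elements of the space of maps on the unit interval. -/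
def loopsIn (S : Set ℂ) : Set C(I, ℂ) := {f | f 0 = f 1 ∧ ∀ s, f s ∈ S}

lemma joinedIn_loopsIn {H : I × I → ℂ} (hH : Continuous H) (hloop : ∀ s, H (s, 0) = H (s, 1))
    (hS : ∀ y, H y ∈ S) {f g : C(I, ℂ)} (hf : ∀ s, f s = H (0, s)) (hg : ∀ s, g s = H (1, s)) :
    JoinedIn (loopsIn S) f g := by
  refine ⟨⟨(ContinuousMap.curry ⟨H, hH⟩), ?_, ?_⟩, fun s => ⟨hloop s, fun u => hS (s, u)⟩⟩
  · ext s; exact (hf s).symm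
  · ext s; exact (hg s).symm

/-- A loop that is freely homotopic in `S` to a small circle around a puncture encircles it. -/
lemma encirclesOnce_of_joinedIn {a x₀ : ℂ} {r : ℝ} (hr : 0 < r) (hS : Metric.closedBall a r \ {a} ⊆ S)
    {γ : Path x₀ x₀} (h : JoinedIn (loopsIn S) (γ : C(I, ℂ)) (circlePath a r : C(I, ℂ))) :
    EncirclesOnce S a γ := by
  obtain ⟨Γ, hΓ⟩ := h
  have h0 : ∀ s, Γ 0 s = γ s := fun s => by rw [Γ.source]; rfl
  have h1 : ∀ s, Γ 1 s = circlePath a r s := fun s => by rw [Γ.target]; rfl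
  let δ : Path x₀ (a + r) :=
    { toFun := fun s => Γ s 0
      continuous_toFun := by fun_prop
      source' := by rw [h0]; simp
      target' := by rw [h1]; simp }
  refine ⟨r, δ, hr, hS, ?_⟩
  -- The free homotopy is extended from the square to the plane by clamping, so that straight line
  -- homotopies in `ℝ × ℝ` give homotopies in `S`.
  let f : ℝ × ℝ → ℂ := fun y => Γ (Set.projIcc 0 1 zero_le_one y.1) (Set.projIcc 0 1 zero_le_one y.2)
  have hf : Continuous f := by
    have h1 : Continuous fun y : ℝ × ℝ => (Set.projIcc (0 : ℝ) 1 zero_le_one y.1) :=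
      continuous_projIcc.comp continuous_fst
    have h2 : Continuous fun y : ℝ × ℝ => (Set.projIcc (0 : ℝ) 1 zero_le_one y.2) :=
      continuous_projIcc.comp continuous_snd
    fun_prop
  have hfI : ∀ s u : I, f (s, u) = Γ s u := fun s u => by
    simp only [f, Set.projIcc_val]
  let ι : Path ((0 : I) : ℝ) ((1 : I) : ℝ) := ⟨⟨fun s => (s : ℝ), by fun_prop⟩, rfl, rfl⟩
  -- One edge of the square is homotopic to the other three; the two lateral edges are `δ` and its
  -- inverse.
  refine homotopicIn_of_convex (E := ℝ × ℝ) convex_univ (f := f) hf.continuousOn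
    (fun y _ => (hΓ _).2 _) (P := Path.prod (Path.refl ((0 : I) : ℝ)) ι)
    (Q := ((Path.prod ι (Path.refl ((0 : I) : ℝ))).trans (Path.prod (Path.refl ((1 : I) : ℝ)) ι)).trans
      (Path.prod ι.symm (Path.refl ((1 : I) : ℝ))))
    ?_ ?_ rfl rfl (fun _ => Set.mem_univ _) (fun _ => Set.mem_univ _) ?_ ?_
  · rw [hfI, h0, γ.source]
  · rw [hfI, h0, γ.target]
  · intro s
    exact (h0 s).symm.trans (hfI 0 s).symm
  · refine trans_eq_map (trans_eq_map ?_ ?_) ?_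
    · intro s; exact (hfI s 0).symm
    · intro s; exact (h1 s).symm.trans (hfI 1 s).symm
    · intro s
      exact (hΓ (σ s)).1.trans (hfI (σ s) 1).symm

end Homotopies

/-! ### Half turns about half periods -/

section Encircling

open unitInterval

variable {τ : UpperHalfPlane}

/-- At a half period, `x` has a critical point of order two. -/
lemma tendsto_xMap_half {c : ℂ} (hc : c ∉ (periods τ).lattice) (hc2 : 2 * c ∈ (periods τ).lattice) :
    ∃ κ : ℂ, κ ≠ 0 ∧ Tendsto (fun h => (xMap τ (c + h) - xMap τ c) / h ^ 2) (𝓝[≠] 0) (𝓝 κ) := by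
  obtain ⟨C, hC0, hC⟩ : ∃ C : ℂ, C ≠ 0 ∧ ∀ h, h ∉ (periods τ).lattice → h + c ∉ (periods τ).lattice →
      (wp τ (h + c) - wp τ c) * (wp τ h - wp τ c) = C :=
    weierstrassP_half_mul (L := periods τ) hc hc2
  have hE := e_sub_ne_zero (τ := τ)
  refine ⟨C / (e τ 2 - e τ 1), div_ne_zero hC0 hE, ?_⟩
  have h0 := tendsto_sq_mul_weierstrassP_sub (L := periods τ) (wp τ c)
  have h1 := (h0.inv₀ one_ne_zero).const_mul (C / (e τ 2 - e τ 1))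
  rw [inv_one, mul_one] at h1
  refine h1.congr' ?_
  filter_upwards [eventually_notMem (periods τ) 0, eventually_add_notMem (periods τ) 0 c,
    self_mem_nhdsWithin] with h k1 k2 k3
  have k4 := hC h k1 k2
  have k5 : wp τ h - wp τ c ≠ 0 := fun h' => hC0 (by rw [← k4, h', mul_zero])
  have k6 : h ≠ 0 := k3
  change C / _ * (h ^ 2 * (wp τ h - wp τ c))⁻¹ = _
  have k7 : wp τ (h + c) - wp τ c = (e τ 2 - e τ 1) * (xMap τ (h + c) - xMap τ c) := by
    rw [wp_eq, wp_eq c]; ring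
  rw [add_comm c h, ← k4, k7]
  field_simp

lemma exists_ball_subset_punctured (t e : ℂ) : ∃ ρ > 0, Metric.ball e ρ \ {e} ⊆ punctured t := by
  have h : ∀ b : ℂ, ∀ᶠ x in 𝓝[≠] e, x ≠ b := fun b => by
    by_cases hb : e = b
    · subst hb; exact self_mem_nhdsWithin
    · exact (isOpen_ne.eventually_mem hb).filter_mono nhdsWithin_le_nhds
  have h3 : punctured t ∈ 𝓝[≠] e := (h 0).and ((h 1).and (h t))
  obtain ⟨ρ, hρ, hsub⟩ := Metric.mem_nhdsWithin_iff.mp h3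
  exact ⟨ρ, hρ, hsub⟩

/-- A continuous logarithm along a path in the closed upper half plane. -/
lemma exists_log_halfTurn {ξ : I → ℂ} (hξ : Continuous ξ) (h0 : ξ 0 = 1) (h1 : ξ 1 = -1)
    (him : ∀ s, 0 < (ξ s).im ∨ ξ s = 1 ∨ ξ s = -1) :
    ∃ g : I → ℂ, Continuous g ∧ (∀ s, Complex.exp (g s) = ξ s) ∧ g 0 = 0 ∧ g 1 = Real.pi * Complex.I := by
  -- A rotation by `-i` takes the upper half plane to the right half plane and `± 1` to `∓ i`, all
  -- in the domain of the principal logarithm.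
  have hslit : ∀ s, -Complex.I * ξ s ∈ Complex.slitPlane := fun s => by
    rw [Complex.mem_slitPlane_iff]
    rcases him s with h | h | h
    · left; simpa using h
    · right; simp [h]
    · right; simp [h]
  refine ⟨fun s => Complex.log (-Complex.I * ξ s) + Real.pi / 2 * Complex.I,
    ((continuous_const.mul hξ).clog hslit).add continuous_const, fun s => ?_, ?_, ?_⟩
  · rw [Complex.exp_add, Complex.exp_log (Complex.slitPlane_ne_zero (hslit s)),
      Complex.exp_pi_div_two_mul_I]
    linear_combination (-ξ s) * Complex.I_mul_I
  · simp only [h0, mul_one, Complex.log_neg_I]; ring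
  · simp only [h1, mul_neg, mul_one, neg_neg, Complex.log_I]; ring

/-- Near `c` the difference `x(c + h) - x(c)` behaves like `κ h²`, so a half turn from `q` to its
reflection `2 c - q` becomes a full turn; the sign condition on `w` makes it counterclockwise. Three
free homotopies lead to a circle: contraction of the path towards `c`, passage from `x` to its
leading term, and straightening in logarithmic coordinates. -/
lemma encirclesOnce_image {c q w : ℂ} (hc : c ∉ (periods τ).lattice)
    (hc2 : 2 * c ∈ (periods τ).lattice) {K : Set ℂ} (hK : Convex ℝ K) (hcK : c ∈ K)
    (hKt : ∀ z ∈ K, z ≠ c → z ∉ twoTorsion τ) (hq : q ∈ K) (hw : w ∈ K) (hq' : 2 * c - q ∈ K)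
    (him : 0 < ((w - c) / (q - c)).im) {γ : Path (xMap τ q) (xMap τ q)}
    (hγ : ∀ s, γ s = xMap τ (((Path.segment q w).trans (Path.segment w (2 * c - q))) s)) :
    EncirclesOnce (punctured (tPoint τ)) (xMap τ c) γ := by
  set P := (Path.segment q w).trans (Path.segment w (2 * c - q)) with hP
  have hv : q - c ≠ 0 := fun h => by simp [h] at him
  have hPK : ∀ s, P s ∈ K := by
    refine trans_mem (fun s => ?_) fun s => ?_
    · exact hK.segment_subset hq hw (Path.range_segment q w ▸ Set.mem_range_self s)
    · exact hK.segment_subset hw hq' (Path.range_segment w (2 * c - q) ▸ Set.mem_range_self s)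
  set ξ : I → ℂ := fun s => (P s - c) / (q - c) with hξ
  have hξc : Continuous ξ := by fun_prop
  have hξim : ∀ s, 0 < (ξ s).im ∨ ξ s = 1 ∨ ξ s = -1 := by
    refine trans_mem (K := {z | 0 < ((z - c) / (q - c)).im ∨ (z - c) / (q - c) = 1 ∨
      (z - c) / (q - c) = -1}) (fun s => ?_) fun s => ?_
    · have e1 : (Path.segment q w s - c) / (q - c) = 1 + (s : ℝ) * ((w - c) / (q - c) - 1) := by
        rw [Path.segment_apply, AffineMap.lineMap_apply, vsub_eq_sub, vadd_eq_add, Complex.real_smul]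
        field_simp
        ring
      by_cases hs : (s : ℝ) = 0
      · right; left; rw [e1, hs]; simp
      · left
        have hs' : 0 < (s : ℝ) := lt_of_le_of_ne s.2.1 (Ne.symm hs)
        rw [e1]
        simpa using mul_pos hs' him
    · have e1 : (Path.segment w (2 * c - q) s - c) / (q - c) = -1 + (1 - (s : ℝ) : ℝ) * ((w - c) / (q - c) + 1) := by
        rw [Path.segment_apply, AffineMap.lineMap_apply, vsub_eq_sub, vadd_eq_add, Complex.real_smul]
        push_cast
        field_simp
        ring
      by_cases hs : 1 - (s : ℝ) = 0
      · right; right; rw [e1, hs]; simp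
      · left
        have hs' : 0 < 1 - (s : ℝ) := lt_of_le_of_ne (by linarith [s.2.2]) (Ne.symm hs)
        rw [e1]
        have := mul_pos hs' him
        simpa using this
  have hξ0 : ∀ s, ξ s ≠ 0 := fun s h => by
    rcases hξim s with h' | h' | h' <;> simp [h] at h'
  obtain ⟨g, hgc, hg, hg0, hg1⟩ := exists_log_halfTurn hξc (by simp [hξ, hv])
    (by simp only [hξ, Path.target]; field_simp; ring) hξim
  have hu : ∀ s, P s - c = (q - c) * ξ s := fun s => by simp only [hξ]; field_simp
  have hu0 : ∀ s, P s - c ≠ 0 := fun s => by rw [hu]; exact mul_ne_zero hv (hξ0 s)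
  obtain ⟨κ, hκ, hlim⟩ := tendsto_xMap_half hc hc2
  obtain ⟨ρ, hρ, hS⟩ := exists_ball_subset_punctured (tPoint τ) (xMap τ c)
  -- As in Rouché's theorem: the remainder is smaller than the leading term, so the linear
  -- deformation between the two never meets `x(c)`.
  obtain ⟨ε₀, hε₀, hnear⟩ : ∃ ε₀ > 0, ∀ h : ℂ, h ≠ 0 → ‖h‖ < ε₀ →
      ‖xMap τ (c + h) - xMap τ c - κ * h ^ 2‖ < ‖κ * h ^ 2‖ := by
    have h1 : ∀ᶠ h in 𝓝[≠] (0 : ℂ), ‖(xMap τ (c + h) - xMap τ c) / h ^ 2 - κ‖ < ‖κ‖ := by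
      have := hlim.eventually (Metric.ball_mem_nhds κ (norm_pos_iff.mpr hκ))
      simpa [dist_eq_norm] using this
    obtain ⟨ε₀, hε₀, h2⟩ := Metric.mem_nhdsWithin_iff.mp h1
    refine ⟨ε₀, hε₀, fun h h0 hh => ?_⟩
    have h3 : ‖(xMap τ (c + h) - xMap τ c) / h ^ 2 - κ‖ < ‖κ‖ := h2 ⟨by simpa using hh, h0⟩
    have h4 : 0 < ‖h ^ 2‖ := norm_pos_iff.mpr (pow_ne_zero 2 h0)
    have h5 : xMap τ (c + h) - xMap τ c - κ * h ^ 2 =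
        ((xMap τ (c + h) - xMap τ c) / h ^ 2 - κ) * h ^ 2 := by field_simp
    rw [h5, norm_mul, norm_mul]
    exact mul_lt_mul_of_pos_right h3 h4
  obtain ⟨M, hM⟩ : ∃ M, ∀ s, ‖P s - c‖ ≤ M := by
    obtain ⟨M, hM⟩ := isCompact_univ.exists_bound_of_continuousOn (f := fun s : I => P s - c)
      (by fun_prop)
    exact ⟨M, fun s => hM s (Set.mem_univ s)⟩
  -- The contracted path has to stay where the estimate holds, and twice the leading term within the
  -- disc of radius `ρ`, which contains no other puncture.
  obtain ⟨ε, hε, hε1, hεM, hερ⟩ : ∃ ε : ℝ, 0 < ε ∧ ε ≤ 1 ∧ ε * M < ε₀ ∧ 2 * (‖κ‖ * (ε * M) ^ 2) < ρ := by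
    have h1 : ∀ᶠ ε : ℝ in 𝓝 0, ε * M < ε₀ :=
      ContinuousAt.eventually_lt (f := fun ε : ℝ => ε * M) (by fun_prop) continuousAt_const (by simpa using hε₀)
    have h2 : ∀ᶠ ε : ℝ in 𝓝 0, 2 * (‖κ‖ * (ε * M) ^ 2) < ρ :=
      ContinuousAt.eventually_lt (f := fun ε : ℝ => 2 * (‖κ‖ * (ε * M) ^ 2)) (by fun_prop) continuousAt_const
        (by simpa using hρ)
    have h3 : ∀ᶠ ε : ℝ in 𝓝 0, ε ≤ 1 := (gt_mem_nhds zero_lt_one).mono fun _ h => le_of_lt h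
    obtain ⟨ε, ⟨a, b, d⟩, h0⟩ := (((h1.and (h2.and h3)).filter_mono
      (nhdsWithin_le_nhds (s := Set.Ioi 0))).and self_mem_nhdsWithin).exists
    exact ⟨ε, h0, d, a, b⟩
  have hεu0 : ∀ s, (ε : ℂ) * (P s - c) ≠ 0 := fun s =>
    mul_ne_zero (by exact_mod_cast hε.ne') (hu0 s)
  have hεu : ∀ s, ‖(ε : ℂ) * (P s - c)‖ ≤ ε * M := fun s => by
    rw [norm_mul, Complex.norm_real, Real.norm_of_nonneg hε.le]
    exact mul_le_mul_of_nonneg_left (hM s) hε.le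
  have hκu : ∀ s, 2 * ‖κ * ((ε : ℂ) * (P s - c)) ^ 2‖ < ρ := fun s => by
    refine lt_of_le_of_lt ?_ hερ
    rw [norm_mul, norm_pow]
    gcongr
    exact hεu s
  have hreg : ∀ {z}, z ∈ K → z ≠ c → z ∉ (periods τ).lattice := fun hz hzc h =>
    hKt _ hz hzc ⟨0, by simpa [omega] using h⟩
  have hscale : ∀ (k : ℝ) (s : I), 0 < k → k ≤ 1 → c + k * (P s - c) ∈ K ∧ c + k * (P s - c) ≠ c := by
    intro k s h0 h1
    constructor
    · have := hK hcK (hPK s) (sub_nonneg.mpr h1) h0.le (by ring)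
      rw [Complex.real_smul, Complex.real_smul] at this
      convert this using 1
      push_cast; ring
    · simpa using mul_ne_zero (by exact_mod_cast h0.ne' : (k : ℂ) ≠ 0) (hu0 s)
  have hxc : ContinuousOn (xMap τ) {z | z ∉ (periods τ).lattice} := fun z hz =>
    (hasDerivAt_xMap hz).continuousAt.continuousWithinAt
  have hend : ∀ k : ℝ, xMap τ (c + k * (P 0 - c)) = xMap τ (c + k * (P 1 - c)) := fun k => by
    rw [P.source, P.target, ← xMap_neg, ← xMap_add hc2]
    congr 1; ring
  have hxε : Continuous fun s => xMap τ (c + ε * (P s - c)) :=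
    hxc.comp_continuous (by fun_prop) fun s => hreg (hscale ε s hε hε1).1 (hscale ε s hε hε1).2
  set f₁ : C(I, ℂ) := ⟨fun s => xMap τ (c + ε * (P s - c)), hxε⟩ with hf₁
  set f₂ : C(I, ℂ) := ⟨fun s => xMap τ c + κ * ((ε : ℂ) * (P s - c)) ^ 2, by fun_prop⟩ with hf₂
  have hconv : ∀ y : I × I, 0 < 1 - (y.1 : ℝ) + y.1 * ε ∧ 1 - (y.1 : ℝ) + y.1 * ε ≤ 1 := fun y => by
    have h0 := y.1.2.1
    have h1 := y.1.2.2
    constructor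
    · rcases lt_or_eq_of_le h1 with h | h
      · nlinarith
      · rw [h]; linarith
    · nlinarith
  have j₁ : JoinedIn (loopsIn (punctured (tPoint τ))) (γ : C(I, ℂ)) f₁ := by
    refine joinedIn_loopsIn (H := fun y => xMap τ (c + ((1 - (y.1 : ℝ) + y.1 * ε : ℝ) : ℂ) * (P y.2 - c)))
      ?_ (fun s => hend _) (fun y => ?_) (fun s => ?_) fun s => ?_
    · exact hxc.comp_continuous (by fun_prop) fun y =>
        hreg (hscale _ y.2 (hconv y).1 (hconv y).2).1 (hscale _ y.2 (hconv y).1 (hconv y).2).2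
    · exact xMap_mem_punctured
        (hKt _ (hscale _ y.2 (hconv y).1 (hconv y).2).1 (hscale _ y.2 (hconv y).1 (hconv y).2).2)
    · refine (hγ s).trans ?_
      congr 1; simp
    · simp [hf₁]
  have j₂ : JoinedIn (loopsIn (punctured (tPoint τ))) f₁ f₂ := by
    refine joinedIn_loopsIn (H := fun y => xMap τ c + (κ * ((ε : ℂ) * (P y.2 - c)) ^ 2 +
      (1 - (y.1 : ℝ) : ℝ) * (xMap τ (c + ε * (P y.2 - c)) - xMap τ c - κ * ((ε : ℂ) * (P y.2 - c)) ^ 2)))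
      ?_ (fun s => ?_) (fun y => ?_) (fun s => ?_) fun s => ?_
    · have := hxε.comp (continuous_snd (X := I) (Y := I))
      simp only [Function.comp_def] at this
      fun_prop
    · simp only [hend ε]
      rw [P.source, P.target]
      ring
    · have hlt := hnear _ (hεu0 y.2) (lt_of_le_of_lt (hεu y.2) hεM)
      have h0 := y.1.2.1
      have h1 := y.1.2.2
      have hle : ‖((1 - (y.1 : ℝ) : ℝ) : ℂ) * (xMap τ (c + ε * (P y.2 - c)) - xMap τ c -
          κ * ((ε : ℂ) * (P y.2 - c)) ^ 2)‖ < ‖κ * ((ε : ℂ) * (P y.2 - c)) ^ 2‖ := by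
        rw [norm_mul, Complex.norm_real, Real.norm_of_nonneg (by linarith)]
        refine lt_of_le_of_lt (mul_le_of_le_one_left (norm_nonneg _) (by linarith)) hlt
      refine hS ⟨?_, ?_⟩
      · rw [Metric.mem_ball, dist_eq_norm, add_sub_cancel_left]
        have := hκu y.2
        refine lt_of_le_of_lt (norm_add_le _ _) (by linarith)
      · intro h
        have h' := add_eq_left.mp (Set.mem_singleton_iff.mp h)
        have h2 := eq_neg_of_add_eq_zero_left h'
        have h3 := congrArg norm h2
        rw [norm_neg] at h3
        exact hle.ne' h3
    · simp [hf₁]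
    · simp [hf₂]
  set r : ℝ := ‖κ * ((ε : ℂ) * (q - c)) ^ 2‖ with hr
  have hne : κ * ((ε : ℂ) * (q - c)) ^ 2 ≠ 0 := by
    have := hεu0 0
    rw [P.source] at this
    exact mul_ne_zero hκ (pow_ne_zero 2 this)
  have hr0 : 0 < r := norm_pos_iff.mpr hne
  have hrρ : r < ρ := by
    have := hκu 0
    rw [P.source] at this
    linarith
  have hexp : ∀ s, Complex.exp (Complex.log (κ * ((ε : ℂ) * (q - c)) ^ 2) + 2 * g s) =
      κ * ((ε : ℂ) * (P s - c)) ^ 2 := fun s => by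
    rw [Complex.exp_add, Complex.exp_log hne, two_mul, Complex.exp_add, hg, hu]
    ring
  refine encirclesOnce_of_joinedIn hr0 ?_ (j₁.trans (j₂.trans ?_))
  · exact subset_trans (Set.sdiff_subset_sdiff_left (Metric.closedBall_subset_ball hrρ)) hS
  · refine joinedIn_loopsIn (H := fun y => xMap τ c + Complex.exp ((1 - (y.1 : ℝ) : ℝ) *
      (Complex.log (κ * ((ε : ℂ) * (q - c)) ^ 2) + 2 * g y.2) +
      (y.1 : ℝ) * (Real.log r + 2 * Real.pi * Complex.I * (y.2 : ℝ)))) ?_ (fun s => ?_) (fun y => ?_)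
      (fun s => ?_) fun s => ?_
    · fun_prop
    · simp only [hg0, hg1, Set.Icc.coe_zero, Set.Icc.coe_one]
      congr 1
      rw [← Complex.exp_periodic]
      congr 1
      push_cast; ring
    · refine hS ⟨?_, ?_⟩
      · rw [Metric.mem_ball, dist_eq_norm, add_sub_cancel_left, Complex.norm_exp, ← Real.lt_log_iff_exp_lt hρ]
        have h1 : (Complex.log (κ * ((ε : ℂ) * (q - c)) ^ 2) + 2 * g y.2).re < Real.log ρ := by
          rw [Real.lt_log_iff_exp_lt hρ, ← Complex.norm_exp, hexp]
          have := hκu y.2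
          have := norm_nonneg (κ * ((ε : ℂ) * (P y.2 - c)) ^ 2)
          linarith
        have h2 : ((Real.log r : ℂ) + 2 * Real.pi * Complex.I * (y.2 : ℝ)).re < Real.log ρ := by
          have : ((Real.log r : ℂ) + 2 * Real.pi * Complex.I * (y.2 : ℝ)).re = Real.log r := by simp
          rw [this]
          exact Real.log_lt_log hr0 hrρ
        rw [Complex.add_re, Complex.re_ofReal_mul, Complex.re_ofReal_mul]
        have := (convex_Iio (Real.log ρ)) h1 h2 (sub_nonneg.mpr y.1.2.2) y.1.2.1 (by ring)
        simpa using this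
      · intro h
        exact Complex.exp_ne_zero _ (add_eq_left.mp (Set.mem_singleton_iff.mp h))
    · simp [hf₂, hexp]
    · have h1 : (Real.log r : ℂ) = Complex.log r := Complex.ofReal_log hr0.le
      simp only [Set.Icc.coe_one, sub_self, Complex.ofReal_zero, zero_mul, zero_add, Complex.ofReal_one,
        one_mul]
      rw [Complex.exp_add, h1, Complex.exp_log (by exact_mod_cast hr0.ne')]
      rfl

end Encircling

/-! ### Paths that avoid the cuts, and half periods in coordinates -/

section ChoiceOfLoops

open unitInterval

variable {τ : UpperHalfPlane}

lemma segment_apply_eq (a b : ℂ) (s : I) : Path.segment a b s = a + (s : ℝ) * (b - a) := by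
  rw [Path.segment_apply, AffineMap.lineMap_apply, vsub_eq_sub, vadd_eq_add, Complex.real_smul]
  ring

lemma mem_cuts_iff {p z : ℂ} : z ∈ cuts τ p ↔
    ∃ v ∈ (periods τ).lattice, ∃ r : ℝ, |r| ≤ 1 ∧ z = v + r * p := by
  constructor
  · rintro ⟨v, hv, a, b, ha, hb, hab, h⟩
    refine ⟨v, hv, b - a, abs_le.mpr ⟨by linarith, by linarith⟩, ?_⟩
    simp only [Complex.real_smul] at h
    push_cast
    linear_combination -h
  · rintro ⟨v, hv, r, hr, rfl⟩
    obtain ⟨h1, h2⟩ := abs_le.mp hr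
    refine ⟨v, hv, (1 - r) / 2, (1 + r) / 2, by linarith, by linarith, by ring, ?_⟩
    simp only [Complex.real_smul]; push_cast; ring

lemma cuts_neg (p : ℂ) : cuts τ (-p) = cuts τ p := by
  ext z
  simp only [mem_cuts_iff]
  constructor <;> rintro ⟨v, hv, r, hr, rfl⟩ <;>
    exact ⟨v, hv, -r, by rwa [abs_neg], by push_cast; ring⟩

lemma add_mem_cuts {p z ω : ℂ} (hω : ω ∈ (periods τ).lattice) (h : z ∈ cuts τ p) :
    z + ω ∈ cuts τ p := by
  rw [mem_cuts_iff] at h ⊢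
  obtain ⟨v, hv, r, hr, rfl⟩ := h
  exact ⟨v + ω, add_mem hv hω, r, hr, by ring⟩

/-- Here `φ` is the coordinate transverse to `ω`. In the strip `-1/2 < φ < 0` only cuts translated
by lattice vectors with `φ = 0` occur, and they stay at `φ ≥ -φ(p)`. The path leaves `q` in the
direction `-p`, passes below that level by `ω`, and returns. If the first leg met a cut, then `q = v
+ r p` with `r ≥ -1`; since `q` is off the cuts, `r > 1`, and `φ(q)` would not be negative. -/
lemma exists_path_avoiding_cuts_of_nonneg {φ : ℂ → ℝ} (hadd : ∀ z w, φ (z + w) = φ z + φ w)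
    (hsmul : ∀ (r : ℝ) z, φ (r * z) = r * φ z) (hΛ : ∀ v ∈ (periods τ).lattice, ∃ k : ℤ, φ v = k)
    {ω : ℂ} (hω : ω ∈ (periods τ).lattice) (hφω : φ ω = 0) {p q : ℂ} (hp0 : 0 ≤ φ p) (hp : φ p < 1 / 2)
    (hq0 : φ q < 0) (hq1 : -(1 / 2) < φ q) (hq : q ∉ cuts τ p) :
    ∃ ℓ : Path q (q + ω), ∀ s, ℓ s ∈ {z | (-(1 / 2) < φ z ∧ φ z < 0) ∧ z ∉ cuts τ p} := by
  -- If `q` is already below the level `-φ(p)`, no descent is needed. Otherwise `κ` leads to the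
  -- midpoint between `-1/2` and `-φ(p)`.
  obtain ⟨κ, hκ, h1, h2⟩ : ∃ κ : ℝ, 0 ≤ κ ∧ φ q - κ * φ p < -φ p ∧ -(1 / 2) < φ q - κ * φ p := by
    by_cases h : φ q < -φ p
    · exact ⟨0, le_rfl, by linarith, by linarith⟩
    · have hd : 0 < φ p := by linarith
      refine ⟨((φ p + 1 / 2) / 2 + φ q) / φ p, div_nonneg (by linarith) hp0, ?_, ?_⟩ <;>
        rw [div_mul_cancel₀ _ hd.ne'] <;> linarith
  have hcut : ∀ z, -(1 / 2) < φ z → φ z < 0 → z ∈ cuts τ p →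
      ∃ v ∈ (periods τ).lattice, φ v = 0 ∧ ∃ r : ℝ, |r| ≤ 1 ∧ z = v + r * p := by
    intro z hz1 hz2 hz
    obtain ⟨v, hv, r, hr, rfl⟩ := mem_cuts_iff.mp hz
    refine ⟨v, hv, ?_, r, hr, rfl⟩
    obtain ⟨k, hk⟩ := hΛ v hv
    rw [hadd, hsmul, hk] at hz1 hz2
    obtain ⟨hr1, hr2⟩ := abs_le.mp hr
    have h3 : (k : ℝ) < 1 := by nlinarith
    have h4 : (-1 : ℝ) < k := by nlinarith
    have h5 : k = 0 := by
      have a : k < 1 := by exact_mod_cast h3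
      have b : -1 < k := by exact_mod_cast h4
      omega
    rw [hk, h5]; simp
  have hneg : ∀ z, φ (-z) = -φ z := fun z => by
    have := hsmul (-1) z
    simpa using this
  have hdown : ∀ s : ℝ, 0 ≤ s → s ≤ 1 → (-(1 / 2) < φ (q + s * (-(κ * p))) ∧ φ (q + s * (-(κ * p))) < 0) ∧
      q + s * (-(κ * p)) ∉ cuts τ p := by
    intro s hs0 hs1
    have e : φ (q + s * (-(κ * p))) = φ q - s * (κ * φ p) := by
      rw [hadd, hsmul, hneg, hsmul]; ring
    have hκp : 0 ≤ κ * φ p := mul_nonneg hκ hp0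
    have hb1 : -(1 / 2) < φ (q + s * (-(κ * p))) := by rw [e]; nlinarith
    have hb2 : φ (q + s * (-(κ * p))) < 0 := by rw [e]; nlinarith
    refine ⟨⟨hb1, hb2⟩, fun hz => hq ?_⟩
    obtain ⟨v, hv, hv0, r, hr, h⟩ := hcut _ hb1 hb2 hz
    have h3 : φ q = (r + s * κ) * φ p := by
      have := congrArg φ h
      rw [e, hadd, hv0, hsmul] at this
      linarith
    obtain ⟨hr1, hr2⟩ := abs_le.mp hr
    have hsκ : 0 ≤ s * κ := mul_nonneg hs0 hκ
    refine mem_cuts_iff.mpr ⟨v, hv, r + s * κ, abs_le.mpr ⟨by linarith, ?_⟩, ?_⟩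
    · by_contra hcon
      push Not at hcon
      nlinarith
    · push_cast
      linear_combination h
  refine ⟨((Path.segment q (q + -(κ * p))).trans
    (Path.segment (q + -(κ * p)) (q + -(κ * p) + ω))).trans
    (Path.segment (q + -(κ * p) + ω) (q + ω)), trans_mem (trans_mem ?_ ?_) ?_⟩
  · intro s
    have := hdown s s.2.1 s.2.2
    rw [Set.mem_ofPred_eq, segment_apply_eq, add_sub_cancel_left]
    exact this
  · intro s
    rw [Set.mem_ofPred_eq, segment_apply_eq, add_sub_cancel_left]
    have e : φ (q + -(κ * p) + (s : ℝ) * ω) = φ q - κ * φ p := by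
      rw [hadd, hsmul, hφω, hadd, hneg, hsmul]; ring
    have hb1 : -(1 / 2) < φ (q + -(κ * p) + (s : ℝ) * ω) := by rw [e]; linarith
    have hb2 : φ (q + -(κ * p) + (s : ℝ) * ω) < 0 := by rw [e]; linarith
    refine ⟨⟨hb1, hb2⟩, fun hz => ?_⟩
    obtain ⟨v, hv, hv0, r, hr, h⟩ := hcut _ hb1 hb2 hz
    rw [h, hadd, hv0, hsmul, zero_add] at e
    obtain ⟨hr1, hr2⟩ := abs_le.mp hr
    nlinarith
  · intro s
    have := hdown (1 - s) (by linarith [s.2.2]) (by linarith [s.2.1])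
    have e : Path.segment (q + -(κ * p) + ω) (q + ω) s = q + ((1 - s : ℝ) : ℂ) * (-(κ * p)) + ω := by
      rw [segment_apply_eq]; push_cast; ring
    rw [Set.mem_ofPred_eq, e, hadd, hφω, add_zero]
    refine ⟨this.1, fun hz => this.2 ?_⟩
    have := add_mem_cuts (neg_mem hω) hz
    rwa [add_neg_cancel_right] at this

/-- The cuts do not change when `p` is replaced by `-p`, so `φ(p)` may be taken nonnegative. -/
lemma exists_path_avoiding_cuts {φ : ℂ → ℝ} (hadd : ∀ z w, φ (z + w) = φ z + φ w)
    (hsmul : ∀ (r : ℝ) z, φ (r * z) = r * φ z) (hΛ : ∀ v ∈ (periods τ).lattice, ∃ k : ℤ, φ v = k)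
    {ω : ℂ} (hω : ω ∈ (periods τ).lattice) (hφω : φ ω = 0) {p q : ℂ} (hp : |φ p| < 1 / 2)
    (hq0 : φ q < 0) (hq1 : -(1 / 2) < φ q) (hq : q ∉ cuts τ p) :
    ∃ ℓ : Path q (q + ω), ∀ s, (-(1 / 2) < φ (ℓ s) ∧ φ (ℓ s) < 0) ∧ ℓ s ∉ cuts τ p := by
  obtain ⟨h1, h2⟩ := abs_lt.mp hp
  rcases le_total 0 (φ p) with h | h
  · exact exists_path_avoiding_cuts_of_nonneg hadd hsmul hΛ hω hφω h h2 hq0 hq1 hq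
  · have hneg : φ (-p) = -φ p := by simpa using hsmul (-1) p
    rw [← cuts_neg] at hq ⊢
    exact exists_path_avoiding_cuts_of_nonneg hadd hsmul hΛ hω hφω (by linarith) (by linarith) hq0 hq1 hq

/-- A point that sees finitely many given points along segments avoiding a countable set. -/
lemma exists_mem_segment_avoiding {U N : Set ℂ} (hU : IsOpen U) (hne : U.Nonempty) (hN : N.Countable)
    {E : Set ℂ} (hE : E.Countable) (hEN : ∀ z ∈ E, z ∉ N) :
    ∃ m ∈ U, ∀ z ∈ E, ∀ s, Path.segment z m s ∉ N := by
  -- The lines through a point of `E` and a point of `N`: countably many null sets.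
  set B : Set ℂ := ⋃ z ∈ E, ⋃ v ∈ N, {m | ∃ r : ℝ, m = z + r * (v - z)} with hB
  have hB0 : MeasureTheory.volume B = 0 := by
    refine (MeasureTheory.measure_biUnion_null_iff hE).mpr fun z _ =>
      (MeasureTheory.measure_biUnion_null_iff hN).mpr fun v _ => ?_
    have h1 : {m : ℂ | ∃ r : ℝ, m = z + r * (v - z)} ⊆
        (AffineSubspace.mk' z (Submodule.span ℝ {v - z}) : Set ℂ) := by
      rintro m ⟨r, rfl⟩
      rw [SetLike.mem_coe, AffineSubspace.mem_mk', vsub_eq_sub, add_sub_cancel_left,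
        Submodule.mem_span_singleton]
      exact ⟨r, Complex.real_smul⟩
    refine MeasureTheory.measure_mono_null h1 (MeasureTheory.Measure.addHaar_affineSubspace _ _ ?_)
    intro htop
    have h2 : Submodule.span ℝ {v - z} = ⊤ := by
      have := congrArg AffineSubspace.direction htop
      rwa [AffineSubspace.direction_mk', AffineSubspace.direction_top] at this
    have h3 := finrank_span_le_card (R := ℝ) ({v - z} : Set ℂ)
    rw [h2, finrank_top, Complex.finrank_real_complex, Set.toFinset_singleton,
      Finset.card_singleton] at h3
    omega
  obtain ⟨m, hmU, hmB⟩ : ∃ m ∈ U, m ∉ B := by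
    by_contra hcon
    push Not at hcon
    have := MeasureTheory.measure_mono_null hcon hB0
    exact (hU.measure_pos MeasureTheory.volume hne).ne' this
  refine ⟨m, hmU, fun z hz s hs => hmB ?_⟩
  have hzv : z ≠ Path.segment z m s := fun h => hEN z hz (h ▸ hs)
  refine Set.mem_biUnion hz (Set.mem_biUnion hs ⟨(s : ℝ)⁻¹, ?_⟩)
  have hs0 : (s : ℂ) ≠ 0 := fun h0 => hzv (by rw [segment_apply_eq]; simp [h0])
  rw [segment_apply_eq]
  push_cast
  field_simp
  ring

lemma xMap_eq_of_sub {z w : ℂ} (h : z - w ∈ (periods τ).lattice) : xMap τ z = xMap τ w := by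
  rw [← xMap_add h w]; congr 1; ring

lemma xMap_eq_of_add {z w : ℂ} (h : z + w ∈ (periods τ).lattice) : xMap τ z = xMap τ w := by
  rw [← xMap_neg w]; exact xMap_eq_of_sub (by simpa using h)

lemma exists_image_path {u v a b : ℂ} (P : Path u v) (hP : ∀ s, P s ∉ twoTorsion τ)
    (ha : xMap τ u = a) (hb : xMap τ v = b) : ∃ π : Path a b, (∀ s, π s = xMap τ (P s)) ∧
      ∀ s, π s ∈ punctured (tPoint τ) := by
  have hL : ∀ s, P s ∉ (periods τ).lattice := fun s h => hP s ⟨0, by simpa [omega] using h⟩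
  refine ⟨⟨⟨fun s => xMap τ (P s), ?_⟩, by simp [ha], by simp [hb]⟩, fun s => rfl,
    fun s => xMap_mem_punctured (hP s)⟩
  exact ContinuousOn.comp_continuous (s := {z | z ∉ (periods τ).lattice}) (fun z hz =>
    (hasDerivAt_xMap hz).continuousAt.continuousWithinAt) P.continuous hL

lemma continuousOn_xMap {K : Set ℂ} (hK : ∀ z ∈ K, z ∉ twoTorsion τ) : ContinuousOn (xMap τ) K :=
  fun z hz => (hasDerivAt_xMap fun h =>
    hK z hz ⟨0, by simpa [omega] using h⟩).continuousAt.continuousWithinAt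

lemma coord_of_mem_twoTorsion {z : ℂ} (hz : z ∈ twoTorsion τ) :
    ∃ i j : ℤ, 2 * coordX τ z = i ∧ 2 * coordY τ z = j := by
  obtain ⟨k, hk⟩ := hz
  have h1 : 2 * z ∈ (periods τ).lattice := by
    have := add_mem (add_mem hk hk) (two_mul_omega_half_mem (τ := τ) k)
    rwa [show z - omega τ k / 2 + (z - omega τ k / 2) + 2 * (omega τ k / 2) = 2 * z by ring] at this
  obtain ⟨⟨i, hi⟩, j, hj⟩ := mem_lattice_iff_coord.mp h1
  rw [show (2 : ℂ) * z = ((2 : ℝ) : ℂ) * z by norm_num, coordX_smul] at hi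
  rw [show (2 : ℂ) * z = ((2 : ℝ) : ℂ) * z by norm_num, coordY_smul] at hj
  exact ⟨i, j, hi, hj⟩

lemma false_of_int_between {x : ℝ} {i k : ℤ} (hi : 2 * x = i) (h1 : (k : ℝ) < 2 * x)
    (h2 : 2 * x < k + 1) : False := by
  rw [hi] at h1 h2
  have a : k < i := by exact_mod_cast h1
  have b : i < k + 1 := by exact_mod_cast h2
  omega

lemma notMem_twoTorsion_of_coordX {z : ℂ} (k : ℤ) (h1 : (k : ℝ) < 2 * coordX τ z)
    (h2 : 2 * coordX τ z < k + 1) : z ∉ twoTorsion τ := fun hz =>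
  let ⟨_, _, hi, _⟩ := coord_of_mem_twoTorsion hz
  false_of_int_between hi h1 h2

lemma notMem_twoTorsion_of_coordY {z : ℂ} (k : ℤ) (h1 : (k : ℝ) < 2 * coordY τ z)
    (h2 : 2 * coordY τ z < k + 1) : z ∉ twoTorsion τ := fun hz =>
  let ⟨_, _, _, hj⟩ := coord_of_mem_twoTorsion hz
  false_of_int_between hj h1 h2

lemma convex_strip {φ : ℂ → ℝ} (hadd : ∀ z w, φ (z + w) = φ z + φ w)
    (hsmul : ∀ (r : ℝ) z, φ (r * z) = r * φ z) (l u : ℝ) : Convex ℝ {z | l < φ z ∧ φ z < u} := by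
  intro z hz w hw a b ha hb hab
  have e : φ (a • z + b • w) = a • φ z + b • φ w := by
    rw [hadd, Complex.real_smul, Complex.real_smul, hsmul, hsmul]; rfl
  have := convex_Ioo l u (x := φ z) hz (y := φ w) hw ha hb hab
  rw [← e] at this
  exact this

/-- The open cell of half size around a point. -/
def cell (τ : UpperHalfPlane) (c : ℂ) : Set ℂ :=
  {z | coordX τ c - 1 / 2 < coordX τ z ∧ coordX τ z < coordX τ c + 1 / 2} ∩
    {z | coordY τ c - 1 / 2 < coordY τ z ∧ coordY τ z < coordY τ c + 1 / 2}

lemma convex_cell (c : ℂ) : Convex ℝ (cell τ c) :=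
  (convex_strip coordX_add coordX_smul _ _).inter (convex_strip coordY_add coordY_smul _ _)

/-- The doubled coordinates of half periods are integers, and in the cell they differ from those of
`c` by less than one. -/
lemma notMem_twoTorsion_of_mem_cell {c z : ℂ} (hc : 2 * c ∈ (periods τ).lattice) (hz : z ∈ cell τ c)
    (hzc : z ≠ c) : z ∉ twoTorsion τ := by
  intro ht
  obtain ⟨i, j, hi, hj⟩ := coord_of_mem_twoTorsion ht
  obtain ⟨⟨i', hi'⟩, j', hj'⟩ := mem_lattice_iff_coord.mp hc
  rw [show (2 : ℂ) * c = ((2 : ℝ) : ℂ) * c by norm_num, coordX_smul] at hi'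
  rw [show (2 : ℂ) * c = ((2 : ℝ) : ℂ) * c by norm_num, coordY_smul] at hj'
  obtain ⟨⟨h1, h2⟩, h3, h4⟩ := hz
  have key : ∀ {x y : ℝ} {m n : ℤ}, 2 * x = m → 2 * y = n → y - 1 / 2 < x → x < y + 1 / 2 → x = y := by
    intro x y m n hx hy k1 k2
    have a : (n : ℝ) - 1 < m := by linarith
    have b : (m : ℝ) < n + 1 := by linarith
    have a' : n - 1 < m := by exact_mod_cast a
    have b' : m < n + 1 := by exact_mod_cast b
    have : m = n := by omega
    subst this
    linarith
  apply hzc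
  rw [coord_eq (τ := τ) z, coord_eq (τ := τ) c, key hi hi' h1 h2, key hj hj' h3 h4]

/-- The basis `1, τ` is positively oriented, so the cross product in its coordinates has the sign of
the one in `ℂ`. -/
lemma im_div_pos {v w : ℂ} (h : 0 < coordX τ v * coordY τ w - coordY τ v * coordX τ w) :
    0 < (w / v).im := by
  have hv : v ≠ 0 := by
    rintro rfl
    simp [coordX, coordY] at h
  have e : (w / v).im = (τ : ℂ).im * (coordX τ v * coordY τ w - coordY τ v * coordX τ w) /
      Complex.normSq v := by
    have hv := coord_eq (τ := τ) v
    have hw := coord_eq (τ := τ) w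
    have a1 := congrArg Complex.re hv
    have a2 := congrArg Complex.im hv
    have a3 := congrArg Complex.re hw
    have a4 := congrArg Complex.im hw
    simp only [Complex.add_re, Complex.add_im, Complex.re_ofReal_mul, Complex.im_ofReal_mul,
      Complex.ofReal_re, Complex.ofReal_im, zero_add] at a1 a2 a3 a4
    rw [Complex.div_im, ← sub_div]
    congr 1
    rw [a1, a2, a3, a4]
    ring
  rw [e]
  exact div_pos (mul_pos τ.im_pos h) (Complex.normSq_pos.mpr hv)

lemma segment_mem {K : Set ℂ} (hK : Convex ℝ K) {u v : ℂ} (hu : u ∈ K) (hv : v ∈ K) (s : I) :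
    Path.segment u v s ∈ K :=
  hK.segment_subset hu hv (Path.range_segment u v ▸ Set.mem_range_self s)

end ChoiceOfLoops

/-! ### Construction of the loops -/

section ExistenceOfLoops

open unitInterval

variable {τ : UpperHalfPlane}

lemma continuous_coordY : Continuous (coordY τ) := by
  unfold coordY; fun_prop

lemma continuous_coordX : Continuous (coordX τ) := by
  unfold coordX coordY; fun_prop

lemma segment_symm_apply (a b : ℂ) (s : I) : Path.segment a b (σ s) = Path.segment b a s := by
  rw [segment_apply_eq, segment_apply_eq, unitInterval.coe_symm_eq]
  push_cast
  ring

/-- Two segments joined at a point `w` on the left of the ray from the half period `c` to `q`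
turn once around `x(c)`. -/
lemma encirclesOnce_trans {c q w : ℂ} (hc : c ∉ (periods τ).lattice)
    (hc2 : 2 * c ∈ (periods τ).lattice) (hq : q ∈ cell τ c) (hw : w ∈ cell τ c)
    (hcross : 0 < (coordX τ q - coordX τ c) * (coordY τ w - coordY τ c) -
      (coordY τ q - coordY τ c) * (coordX τ w - coordX τ c)) {y : ℂ}
    {α : Path (xMap τ q) y} {β : Path y (xMap τ q)} (hα : ∀ s, α s = xMap τ (Path.segment q w s))
    (hβ : ∀ s, β s = xMap τ (Path.segment w (2 * c - q) s)) :
    EncirclesOnce (punctured (tPoint τ)) (xMap τ c) (α.trans β) := by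
  have h2 : (2 : ℂ) * c = ((2 : ℝ) : ℂ) * c := by norm_num
  refine encirclesOnce_image hc hc2 (convex_cell c) ?_
    (fun z hz hzc => notMem_twoTorsion_of_mem_cell hc2 hz hzc) hq hw ?_ ?_
    (trans_eq_map hα hβ)
  · exact ⟨⟨by linarith, by linarith⟩, by linarith, by linarith⟩
  · obtain ⟨⟨h1, h2'⟩, h3, h4⟩ := hq
    simp only [cell, Set.mem_inter_iff, Set.mem_ofPred_eq, coordX_sub, coordY_sub]
    rw [h2, coordX_smul, coordY_smul]
    exact ⟨⟨by linarith, by linarith⟩, by linarith, by linarith⟩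
  · apply im_div_pos (τ := τ)
    simpa only [coordX_sub, coordY_sub] using hcross

/-- A loop `x ∘ ℓ`, where `ℓ` runs in a convex set without half periods from `q` to `q + ω`,
is homotopic to the image of a path with one vertex. -/
lemma homotopicIn_image_trans {K : Set ℂ} (hK : Convex ℝ K) (hKt : ∀ z ∈ K, z ∉ twoTorsion τ)
    {q w ω y : ℂ} (hq : q ∈ K) (hw : w ∈ K) (hqω : q + ω ∈ K) (hω : ω ∈ (periods τ).lattice)
    {ℓ : Path q (q + ω)} (hℓ : ∀ s, ℓ s ∈ K) {β : Path (xMap τ q) (xMap τ q)}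
    (hβ : ∀ s, β s = xMap τ (ℓ s)) {π : Path (xMap τ q) y} {ρ : Path y (xMap τ q)}
    (hπ : ∀ s, π s = xMap τ (Path.segment q w s))
    (hρ : ∀ s, ρ s = xMap τ (Path.segment w (q + ω) s)) :
    HomotopicIn (punctured (tPoint τ)) β (π.trans ρ) :=
  homotopicIn_of_convex hK (continuousOn_xMap hKt) (fun z hz => xMap_mem_punctured (hKt z hz)) rfl
    (xMap_add hω q) rfl rfl hℓ (trans_mem (segment_mem hK hq hw) (segment_mem hK hw hqω)) hβ
    (trans_eq_map hπ hρ)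

/-- Let `α, β, ξ, δ` be the images of the segments to a vertex `m` from `q₀`, `q₀ + 1`, `-τ - q₀`,
`-q₀`. All four run from `x(q₀)` to `x(m)`, since `x` is even and periodic. The loops are `γ₁ = δ
β⁻¹`, `γ₂ = ξ α⁻¹`, `γ₃ = β ξ⁻¹`; they lift to half turns about `-1/2`, `-τ/2`, `-(1 + τ)/2`. By
cancellation `γ₂⁻¹ γ₃⁻¹ ≃ α β⁻¹` and `γ₁ γ₃ ≃ δ ξ⁻¹`. These are images of paths from `q₀` to `q₀ +
1` and to `q₀ + τ` in strips without half periods, where `ℓ₁` and `ℓ₂` also run. -/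
theorem exists_loopChoice {c d : ℝ} (hc : |c| < 1 / 2) (hd : |d| < 1 / 2) {q₀ : ℂ}
    (hq₀ : q₀ ∈ baseCell τ) (hcut : q₀ ∉ cuts τ ((c : ℂ) + d * (τ : ℂ)))
    (hp : (c : ℂ) + d * (τ : ℂ) ∉ twoTorsion τ) :
    ∃ (ℓ₁ : Path q₀ (q₀ + 1)) (ℓ₂ : Path q₀ (q₀ + (τ : ℂ)))
      (γ₁ γ₂ γ₃ : Path (xMap τ q₀) (xMap τ q₀)),
      IsLoopChoice τ ((c : ℂ) + d * (τ : ℂ)) ℓ₁ ℓ₂ γ₁ γ₂ γ₃ := by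
  have hpX : |coordX τ ((c : ℂ) + d * (τ : ℂ))| < 1 / 2 := by rwa [coordX_mk]
  have hpY : |coordY τ ((c : ℂ) + d * (τ : ℂ))| < 1 / 2 := by rwa [coordY_mk]
  generalize (c : ℂ) + d * (τ : ℂ) = p at *
  have hpL : p ∉ (periods τ).lattice := fun h => hp ⟨0, by simpa [omega] using h⟩
  have hX1 : coordX τ 1 = 1 := by simpa using coordX_mk (τ := τ) 1 0
  have hY1 : coordY τ 1 = 0 := by simpa using coordY_mk (τ := τ) 1 0
  have hXτ : coordX τ τ = 0 := by simpa using coordX_mk (τ := τ) 0 1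
  have hYτ : coordY τ τ = 1 := by simpa using coordY_mk (τ := τ) 0 1
  obtain ⟨qX0, qX1, qY0, qY1⟩ : -(1 / 2) < coordX τ q₀ ∧ coordX τ q₀ < 0 ∧
      -(1 / 2) < coordY τ q₀ ∧ coordY τ q₀ < 0 := by
    obtain ⟨a, b, ha, ha', hb, hb', rfl⟩ := hq₀
    rw [coordX_neg, coordY_neg, coordX_mk, coordY_mk]
    exact ⟨by linarith, by linarith, by linarith, by linarith⟩
  -- the apparent singularities, and a vertex in the fourth quadrant from which all segments
  -- to the relevant translates of the base point avoid them
  let N : Set ℂ := {z | z - p ∈ (periods τ).lattice ∨ z + p ∈ (periods τ).lattice}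
  have hNc : N.Countable := by
    refine (((countable_lattice (periods τ)).image (· + p)).union
      ((countable_lattice (periods τ)).image (· - p))).mono ?_
    rintro z (h | h)
    · exact Or.inl ⟨_, h, by simp⟩
    · exact Or.inr ⟨_, h, by simp⟩
  have hNcut : q₀ ∉ N := by
    rintro (h | h)
    · exact hcut (mem_cuts_of_sub 1 (by simpa using h))
    · exact hcut (mem_cuts_of_add 1 (by simpa using h))
  have hNadd : ∀ v ∈ (periods τ).lattice, ∀ z, z + v ∈ N → z ∈ N := by
    rintro v hv z (h | h)
    · exact Or.inl (by simpa using sub_mem (show z - p + v ∈ (periods τ).lattice by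
        convert h using 1; ring) hv)
    · exact Or.inr (by simpa using sub_mem (show z + p + v ∈ (periods τ).lattice by
        convert h using 1; ring) hv)
  have hNneg : ∀ z, -z ∈ N → z ∈ N := by
    rintro z (h | h)
    · exact Or.inr (by convert neg_mem h using 1; ring)
    · exact Or.inl (by convert neg_mem h using 1; ring)
  let U : Set ℂ := {z | (0 < coordX τ z ∧ coordX τ z < 1 / 2) ∧
    (-(1 / 2) < coordY τ z ∧ coordY τ z < 0)}
  have hU : IsOpen U :=
    ((isOpen_Ioo (a := (0 : ℝ)) (b := 1 / 2)).preimage continuous_coordX).inter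
      ((isOpen_Ioo (a := -(1 / 2 : ℝ)) (b := 0)).preimage continuous_coordY)
  have hUne : U.Nonempty := by
    refine ⟨((1 / 4 : ℝ) : ℂ) + ((-(1 / 4) : ℝ) : ℂ) * (τ : ℂ), ?_⟩
    simp only [U, Set.mem_ofPred_eq, coordX_mk, coordY_mk]
    norm_num
  obtain ⟨m, ⟨⟨mX0, mX1⟩, mY0, mY1⟩, hm⟩ := exists_mem_segment_avoiding hU hUne hNc
    (E := {q₀, q₀ + 1, -(τ : ℂ) - q₀, -q₀}) (Set.Finite.countable (by simp)) (by
      rintro z (rfl | rfl | rfl | rfl)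
      · exact hNcut
      · exact fun h => hNcut (hNadd _ one_mem_lattice _ h)
      · exact fun h => hNcut (hNneg _ (hNadd _ (neg_mem tau_mem_lattice) _ (by
          convert h using 1; ring)))
      · exact fun h => hNcut (hNneg _ h))
  have hne : ∀ z, z ∉ twoTorsion τ → z ∉ N → xMap τ z ≠ lamPoint τ p := fun z hz hzN =>
    xMap_ne_xMap (fun h => hz ⟨0, by simpa [omega] using h⟩) hpL (fun h => hzN (Or.inr h))
      (fun h => hzN (Or.inl h))
  have hX : ∀ k : ℤ, ∀ z ∈ {z | (k : ℝ) / 2 < coordX τ z ∧ coordX τ z < ((k : ℝ) + 1) / 2},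
      z ∉ twoTorsion τ := fun k z hz =>
    notMem_twoTorsion_of_coordX k (by linarith [hz.1]) (by linarith [hz.2])
  have hY : ∀ k : ℤ, ∀ z ∈ {z | (k : ℝ) / 2 < coordY τ z ∧ coordY τ z < ((k : ℝ) + 1) / 2},
      z ∉ twoTorsion τ := fun k z hz =>
    notMem_twoTorsion_of_coordY k (by linarith [hz.1]) (by linarith [hz.2])
  have cX := convex_strip (φ := coordX τ) coordX_add coordX_smul
  have cY := convex_strip (φ := coordY τ) coordY_add coordY_smul
  have hend : ∀ z, z - q₀ ∈ (periods τ).lattice ∨ z + q₀ ∈ (periods τ).lattice →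
      xMap τ z = xMap τ q₀ := fun z h => h.elim xMap_eq_of_sub xMap_eq_of_add
  have build : ∀ z ∈ ({q₀, q₀ + 1, -(τ : ℂ) - q₀, -q₀} : Set ℂ), ∀ K : Set ℂ, Convex ℝ K →
      (∀ z ∈ K, z ∉ twoTorsion τ) → z ∈ K → m ∈ K →
      (z - q₀ ∈ (periods τ).lattice ∨ z + q₀ ∈ (periods τ).lattice) →
      ∃ π : Path (xMap τ q₀) (xMap τ m), (∀ s, π s = xMap τ (Path.segment z m s)) ∧
        (∀ s, π s ∈ punctured (tPoint τ)) ∧ ∀ s, π s ∈ {x | x ≠ lamPoint τ p} := by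
    intro z hz K hK hKt hzK hmK he
    have hs : ∀ s, Path.segment z m s ∉ twoTorsion τ := fun s => hKt _ (segment_mem hK hzK hmK s)
    obtain ⟨π, hπ, hπp⟩ := exists_image_path (Path.segment z m) hs (hend z he) rfl
    exact ⟨π, hπ, hπp, fun s => hπ s ▸ hne _ (hs s) (hm z hz s)⟩
  obtain ⟨α, hα, hαp, hαl⟩ := build q₀ (by simp) _ (cY _ _) (hY (-1))
    ⟨by push_cast; linarith, by push_cast; linarith⟩
    ⟨by push_cast; linarith, by push_cast; linarith⟩ (Or.inl (by simp))
  obtain ⟨β, hβ, hβp, hβl⟩ := build (q₀ + 1) (by simp) _ (cY _ _) (hY (-1))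
    ⟨by rw [coordY_add, hY1]; push_cast; linarith, by rw [coordY_add, hY1]; push_cast; linarith⟩
    ⟨by push_cast; linarith, by push_cast; linarith⟩ (Or.inl (by simpa using one_mem_lattice))
  obtain ⟨ξ, hξ, hξp, hξl⟩ := build (-(τ : ℂ) - q₀) (by simp) _ (cX _ _) (hX 0)
    ⟨by rw [coordX_sub, coordX_neg, hXτ]; push_cast; linarith,
      by rw [coordX_sub, coordX_neg, hXτ]; push_cast; linarith⟩
    ⟨by push_cast; linarith, by push_cast; linarith⟩
    (Or.inr (by simpa using tau_mem_lattice))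
  obtain ⟨δ, hδ, hδp, hδl⟩ := build (-q₀) (by simp) _ (cX _ _) (hX 0)
    ⟨by rw [coordX_neg]; push_cast; linarith, by rw [coordX_neg]; push_cast; linarith⟩
    ⟨by push_cast; linarith, by push_cast; linarith⟩ (Or.inr (by simp))
  have symm_apply : ∀ {z : ℂ} {π : Path (xMap τ q₀) (xMap τ m)},
      (∀ s, π s = xMap τ (Path.segment z m s)) → ∀ s, π.symm s = xMap τ (Path.segment m z s) :=
    fun h s => (h (σ s)).trans (by rw [segment_symm_apply])
  have hΛ1 := one_mem_lattice (τ := τ)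
  have hΛτ := tau_mem_lattice (τ := τ)
  obtain ⟨ℓ₁, hℓ₁⟩ := exists_path_avoiding_cuts (φ := coordY τ) coordY_add coordY_smul
    (fun v hv => (mem_lattice_iff_coord.mp hv).2) hΛ1 hY1 hpY qY1 qY0 hcut
  obtain ⟨ℓ₂, hℓ₂⟩ := exists_path_avoiding_cuts (φ := coordX τ) coordX_add coordX_smul
    (fun v hv => (mem_lattice_iff_coord.mp hv).1) hΛτ hXτ hpX qX1 qX0 hcut
  have k₁ : ∀ s, ℓ₁ s ∈ {z | ((-1 : ℤ) : ℝ) / 2 < coordY τ z ∧ coordY τ z < (((-1 : ℤ) : ℝ) + 1) / 2} :=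
    fun s => ⟨by push_cast; linarith [(hℓ₁ s).1.1], by push_cast; linarith [(hℓ₁ s).1.2]⟩
  have k₂ : ∀ s, ℓ₂ s ∈ {z | ((-1 : ℤ) : ℝ) / 2 < coordX τ z ∧ coordX τ z < (((-1 : ℤ) : ℝ) + 1) / 2} :=
    fun s => ⟨by push_cast; linarith [(hℓ₂ s).1.1], by push_cast; linarith [(hℓ₂ s).1.2]⟩
  obtain ⟨β₁, hβ₁, -⟩ := exists_image_path ℓ₁ (fun s => hY (-1) _ (k₁ s)) rfl (xMap_add hΛ1 q₀)
  obtain ⟨β₂, hβ₂, -⟩ := exists_image_path ℓ₂ (fun s => hX (-1) _ (k₂ s)) rfl (xMap_add hΛτ q₀)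
  have cX1 : coordX τ (-(1 / 2)) = -(1 / 2) := by
    simpa using coordX_mk (τ := τ) (-(1 / 2)) 0
  have cY1 : coordY τ (-(1 / 2)) = 0 := by
    simpa using coordY_mk (τ := τ) (-(1 / 2)) 0
  have cX2 : coordX τ (-((τ : ℂ) / 2)) = 0 := by
    convert coordX_mk (τ := τ) 0 (-(1 / 2)) using 2; push_cast; ring
  have cY2 : coordY τ (-((τ : ℂ) / 2)) = -(1 / 2) := by
    convert coordY_mk (τ := τ) 0 (-(1 / 2)) using 2; push_cast; ring
  have cX3 : coordX τ (-((1 + (τ : ℂ)) / 2)) = -(1 / 2) := by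
    convert coordX_mk (τ := τ) (-(1 / 2)) (-(1 / 2)) using 2; push_cast; ring
  have cY3 : coordY τ (-((1 + (τ : ℂ)) / 2)) = -(1 / 2) := by
    convert coordY_mk (τ := τ) (-(1 / 2)) (-(1 / 2)) using 2; push_cast; ring
  refine ⟨ℓ₁, ℓ₂, δ.trans β.symm, ξ.trans α.symm, β.trans ξ.symm, fun s => (hℓ₁ s).2,
    fun s => (hℓ₂ s).2, ?_, ?_, ?_, fun s => ⟨?_, ?_, ?_⟩, ⟨β₁, hβ₁, ?_⟩, ⟨β₂, hβ₂, ?_⟩⟩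
  -- Reflected at the origin, the segments of `δ` and `β⁻¹` run from `q₀` through `-m` to `-1 - q₀`.
  · have := encirclesOnce_trans (τ := τ) (c := -(1 / 2)) (q := q₀) (w := -m) (α := δ) (β := β.symm)
      (fun h => half_one_notMem (by simpa using neg_mem h)) (by simpa using neg_mem hΛ1)
      (by
        simp only [cell, Set.mem_inter_iff, Set.mem_ofPred_eq, cX1, cY1]
        refine ⟨⟨?_, ?_⟩, ?_, ?_⟩ <;> linarith)
      (by
        simp only [cell, Set.mem_inter_iff, Set.mem_ofPred_eq, cX1, cY1, coordX_neg, coordY_neg]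
        refine ⟨⟨?_, ?_⟩, ?_, ?_⟩ <;> linarith)
      (by simp only [cX1, cY1, coordX_neg, coordY_neg]; nlinarith)
      (fun s => (hδ s).trans (xMap_eq_of_add (by
        convert zero_mem (periods τ).lattice using 1
        simp only [segment_apply_eq]; ring)))
      (fun s => (symm_apply hβ s).trans (xMap_eq_of_add (by
        convert zero_mem (periods τ).lattice using 1
        simp only [segment_apply_eq]; ring)))
    rwa [xMap_neg, show xMap τ (1 / 2) = 0 by simp [xMap, e, omega]] at this
  -- Under `z ↦ -τ - z` the segments of `ξ` and `α⁻¹` run from `q₀` through `-τ - m` to `-τ - q₀`.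
  · have := encirclesOnce_trans (τ := τ) (c := -((τ : ℂ) / 2)) (q := q₀) (w := -τ - m) (α := ξ)
      (β := α.symm)
      (fun h => half_tau_notMem (by simpa using neg_mem h))
      (by convert neg_mem hΛτ using 1; ring)
      (by
        simp only [cell, Set.mem_inter_iff, Set.mem_ofPred_eq, cX2, cY2]
        refine ⟨⟨?_, ?_⟩, ?_, ?_⟩ <;> linarith)
      (by
        simp only [cell, Set.mem_inter_iff, Set.mem_ofPred_eq, cX2, cY2, coordX_neg, coordY_neg,
          coordX_sub, coordY_sub, hXτ, hYτ]
        refine ⟨⟨?_, ?_⟩, ?_, ?_⟩ <;> linarith)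
      (by
        simp only [cX2, cY2, coordX_neg, coordY_neg, coordX_sub, coordY_sub, hXτ, hYτ]
        nlinarith)
      (fun s => (hξ s).trans (xMap_eq_of_add (by
        convert neg_mem hΛτ using 1
        simp only [segment_apply_eq]; ring)))
      (fun s => (symm_apply hα s).trans (xMap_eq_of_add (by
        convert neg_mem hΛτ using 1
        simp only [segment_apply_eq]; ring)))
    rwa [xMap_neg, show xMap τ ((τ : ℂ) / 2) = 1 by
      simpa [xMap, e, omega] using div_self e_sub_ne_zero] at this
  -- Translated by `-1`, the segments of `β` and `ξ⁻¹` run from `q₀` through `m - 1` to `-1 - τ -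
  -- q₀`.
  · have := encirclesOnce_trans (τ := τ) (c := -((1 + (τ : ℂ)) / 2)) (q := q₀) (w := m - 1)
      (α := β) (β := ξ.symm)
      (fun h => half_one_add_tau_notMem (by simpa using neg_mem h))
      (by convert neg_mem (add_mem hΛ1 hΛτ) using 1; ring)
      (by
        simp only [cell, Set.mem_inter_iff, Set.mem_ofPred_eq, cX3, cY3]
        refine ⟨⟨?_, ?_⟩, ?_, ?_⟩ <;> linarith)
      (by
        simp only [cell, Set.mem_inter_iff, Set.mem_ofPred_eq, cX3, cY3,
          coordX_sub, coordY_sub, hX1, hY1]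
        refine ⟨⟨?_, ?_⟩, ?_, ?_⟩ <;> linarith)
      (by
        simp only [cX3, cY3, coordX_sub, coordY_sub, hX1, hY1]
        nlinarith)
      (fun s => (hβ s).trans (xMap_eq_of_sub (by
        convert hΛ1 using 1
        simp only [segment_apply_eq]; ring)))
      (fun s => (symm_apply hξ s).trans (xMap_eq_of_sub (by
        convert hΛ1 using 1
        simp only [segment_apply_eq]; ring)))
    rwa [xMap_neg] at this
  · exact trans_mem hδl (fun s => hβl (σ s)) s
  · exact trans_mem hξl (fun s => hαl (σ s)) s
  · exact trans_mem hβl (fun s => hξl (σ s)) s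
  · refine HomotopicIn.trans (homotopicIn_image_trans (cY _ _) (hY (-1))
      ⟨by push_cast; linarith, by push_cast; linarith⟩
      ⟨by push_cast; linarith, by push_cast; linarith⟩
      ⟨by rw [coordY_add, hY1]; push_cast; linarith, by rw [coordY_add, hY1]; push_cast; linarith⟩
      hΛ1 k₁ hβ₁ hα (symm_apply hβ)) ?_
    have := homotopicIn_cancel hαp (fun s => hξp (σ s)) (q := ξ.symm) (r := β.symm)
      (fun s => hβp (σ s))
    simpa only [Path.trans_symm, Path.symm_symm] using this
  · refine HomotopicIn.trans (homotopicIn_image_trans (w := -m) (cX _ _) (hX (-1))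
      ⟨by push_cast; linarith, by push_cast; linarith⟩
      ⟨by rw [coordX_neg]; push_cast; linarith, by rw [coordX_neg]; push_cast; linarith⟩
      ⟨by rw [coordX_add, hXτ]; push_cast; linarith, by rw [coordX_add, hXτ]; push_cast; linarith⟩
      hΛτ k₂ hβ₂ (π := δ) (ρ := ξ.symm)
      (fun s => (hδ s).trans (xMap_eq_of_add (by
        convert zero_mem (periods τ).lattice using 1
        simp only [segment_apply_eq]; ring)))
      (fun s => (symm_apply hξ s).trans (xMap_eq_of_add (by
        convert zero_mem (periods τ).lattice using 1
        simp only [segment_apply_eq]; ring)))) ?_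
    have := homotopicIn_cancel hδp (fun s => hβp (σ s)) (q := β.symm) (r := ξ.symm)
      (fun s => hξp (σ s))
    simpa only [Path.symm_symm] using this

end ExistenceOfLoops

end GLame

end

theorem lemma5p3 (τ : UpperHalfPlane) (n : Fin 4 → ℕ) (p A : ℂ)
    (hp : p ∉ GLame.twoTorsion τ) :
    -- loops as required exist
    ((∃ c d : ℝ, |c| < 1 / 2 ∧ |d| < 1 / 2 ∧ p = (c : ℂ) + d * (τ : ℂ)) →
      ∀ q₀ ∈ GLame.baseCell τ, q₀ ∉ GLame.cuts τ p →
        ∃ (ℓ₁ : Path q₀ (q₀ + 1)) (ℓ₂ : Path q₀ (q₀ + (τ : ℂ)))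
          (γ₁ γ₂ γ₃ : Path (GLame.xMap τ q₀) (GLame.xMap τ q₀)),
          GLame.IsLoopChoice τ p ℓ₁ ℓ₂ γ₁ γ₂ γ₃) ∧
    -- for every choice of such loops
    (∀ (q₀ : ℂ) (ℓ₁ : Path q₀ (q₀ + 1)) (ℓ₂ : Path q₀ (q₀ + (τ : ℂ)))
      (γ₁ γ₂ γ₃ : Path (GLame.xMap τ q₀) (GLame.xMap τ q₀)),
      GLame.IsLoopChoice τ p ℓ₁ ℓ₂ γ₁ γ₂ γ₃ →
      -- both equations have fundamental systems of solutions at the base points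
      (∃ Y, GLame.IsFundamentalSystem (fun _ => 0) (fun z => -GLame.potential τ n p A z) q₀ Y) ∧
      (∃ F, GLame.IsFundamentalSystem
        (GLame.normalP1 (GLame.theta n) (GLame.lamPoint τ p) (GLame.tPoint τ))
        (GLame.normalP2 (GLame.theta n) (GLame.lamPoint τ p) (GLame.muPoint τ n p A)
          (GLame.tPoint τ)) (GLame.xMap τ q₀) F) ∧
      -- and with respect to any such fundamental systems
      ∀ Y F : Fin 2 → ℂ → ℂ,
        GLame.IsFundamentalSystem (fun _ => 0) (fun z => -GLame.potential τ n p A z) q₀ Y →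
        GLame.IsFundamentalSystem
          (GLame.normalP1 (GLame.theta n) (GLame.lamPoint τ p) (GLame.tPoint τ))
          (GLame.normalP2 (GLame.theta n) (GLame.lamPoint τ p) (GLame.muPoint τ n p A)
            (GLame.tPoint τ)) (GLame.xMap τ q₀) F →
        ∃ N₁ N₂ M₁ M₂ M₃ : Matrix.SpecialLinearGroup (Fin 2) ℂ,
          (∀ N, GLame.IsMonodromyMatrix ℓ₁ Y N ↔ N = N₁.1) ∧
          (∀ N, GLame.IsMonodromyMatrix ℓ₂ Y N ↔ N = N₂.1) ∧
          (∀ M, GLame.IsMonodromyMatrix γ₁ F M ↔ M = M₁.1) ∧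
          (∀ M, GLame.IsMonodromyMatrix γ₂ F M ↔ M = M₂.1) ∧
          (∀ M, GLame.IsMonodromyMatrix γ₃ F M ↔ M = M₃.1) ∧
          N₁.1.trace = -(M₂ * M₃).1.trace ∧
          N₂.1.trace = -(M₁ * M₃).1.trace ∧
          (N₁⁻¹ * N₂).1.trace = -(M₁ * M₂).1.trace) := by
  refine ⟨?_, fun q₀ ℓ₁ ℓ₂ γ₁ γ₂ γ₃ h => GLame.monodromy_of_loopChoice n A hp h⟩
  rintro ⟨c, d, hc, hd, rfl⟩ q₀ hq₀ hcut
  exact GLame.exists_loopChoice hc hd hq₀ hcut hp
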